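/- Let $m>1$, $n_H\ge 1$, $\nu=n_E-m>1$ be fixed integers and let $\Sigma$ be a fixed positive definite $m\times m$ matrix. $W_m(n,\Sigma,\Omega)$ denotes the law of $X^TX$, where $X$ is $n\times m$ with independent rows, normal with covariance $\Sigma$, and with mean $M=\mathbb E X$ such that $\Omega=\Sigma^{-1}M^TM$; $W_m(n,\Sigma)=W_m(n,\Sigma,0)$. For every $\omega>0$ let $H\sim W_m(n_H,\Sigma,\Omega)$ and $E\sim W_m(n_E,\Sigma)$ be independent, where $\Omega$ has rank one, $\Omega=\omega\,\Sigma^{-1}vv^T$ for a fixed vector $v$ with $v^T\Sigma^{-1}v=1$. (If $\Omega=\omega\mu\mu^T$ with $\|\mu\|=1$, it is of this form with $v=\sqrt\lambda\,\mu$, $\Sigma\mu=\lambda\mu$.) Let $\ell_1=\ell_1(E^{-1}H)$ be the largest eigenvalue of $E^{-1}H$, and let $$a_1=n_H,\quad b_1=\nu+1,\quad a_2=m-1,\quad b_2=\nu+2,\quad c_1=\frac{a_1}{b_1},\quad c_2=\frac{a_2}{b_2},\quad c_3=\frac{a_1a_2}{\nu(\nu-1)} .$$ With $w=\Sigma^{-1}v$,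 $h=w^THw$, $b=(Hw-hv)/\sqrt h$, $Q=I-vw^T$ and $e=v^TE^{-1}v$, put $$c_1F_1=h\,e,\qquad c_2F_2=b^TE^{-1}b-\frac{(b^TE^{-1}v)^2}{e},\qquad T_1=2\sqrt h\;b^TE^{-1}v,\qquad T_2=\frac{v^TE^{-1}QHQ^TE^{-1}v}{e}.$$ Then the following hold. 1. (Expansion) $\ell_1=c_1F_1+c_2F_2+T_1+T_2+O_p(\omega^{-1/2})$ as $\omega\to\infty$. 2. (Exact law of the retained terms) For every $\omega>0$, $F_1$ and $F_2$ are independent, $F_1\sim F_{a_1,b_1}(\omega)$ (noncentral $F$ with noncentrality $\omega$) and $F_2\sim F_{a_2,b_2}$. 3. (Neglected term) For every $\omega>0$, $T_1$ is integrable, has a symmetric law, and $\mathbb E T_1=0$. 4. (Averaged term) For every $\omega>0$, $T_2$ is integrable and $\mathbb E T_2=c_3$. 5. (Approximation) Neglecting $T_1$ and replacing $T_2$ by $\mathbb E T_2$ gives $\ell_1\approx c_1F_{a_1,b_1}(\omega)+c_2F_{a_2,b_2}+c_3$ in the following sense: $\ell_1-(c_1F_1+c_2F_2+c_3)=O_p(\omega^{1/2})$,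 and $$\sup_{t\in\mathbb R}\bigl|\,P(\ell_1\le t)-P(c_1F_{a_1,b_1}(\omega)+c_2F_{a_2,b_2}+c_3\le t)\bigr|\to 0\qquad(\omega\to\infty),$$ with independent $F$ variates; the last limit also holds with any other fixed real constant in place of $c_3$. -/

import Mathlib

open MeasureTheory ProbabilityTheory Matrix Filter Topology

noncomputable section

namespace RoyRoot

/-- Real matrices carry the product (= Borel) sigma-algebra. -/
instance matrixMeasurableSpace (k l : ℕ) : MeasurableSpace (Matrix (Fin k) (Fin l) ℝ) :=
  MeasurableSpace.pi

/-! ### Wishart matrices -/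

/-- The law of the `n × m` random matrix with independent rows, the `i`-th row having the
normal distribution with mean `M i` and covariance matrix `S`. -/
def gaussianRows {n m : ℕ} (M : Matrix (Fin n) (Fin m) ℝ) (S : Matrix (Fin m) (Fin m) ℝ) :
    Measure (Matrix (Fin n) (Fin m) ℝ) :=
  (Measure.pi fun i : Fin n => multivariateGaussian (WithLp.toLp 2 (M i)) S).map
    fun x => Matrix.of fun i j => x i j

/-- The law of `Xᵀ X`, where `X` has independent normal rows with common covariance matrix `S`
and mean matrix `𝔼 X = M`. -/
def wishartOfMean {n m : ℕ} (M : Matrix (Fin n) (Fin m) ℝ) (S : Matrix (Fin m) (Fin m) ℝ) :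
    Measure (Matrix (Fin m) (Fin m) ℝ) :=
  (gaussianRows M S).map fun X => Xᵀ * X

/-- `W ∼ W_m(n, S, N)`: the random matrix `W` has the noncentral Wishart distribution with
`n` degrees of freedom, covariance matrix `S` and noncentrality matrix `N = S⁻¹ Mᵀ M`, where
`M` is the mean of the underlying normal data matrix. The central case is `N = 0`. -/
def IsWishart {𝓧 : Type*} [MeasurableSpace 𝓧] (P : Measure 𝓧) {m : ℕ}
    (W : 𝓧 → Matrix (Fin m) (Fin m) ℝ) (n : ℕ) (S N : Matrix (Fin m) (Fin m) ℝ) : Prop :=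
  ∃ M : Matrix (Fin n) (Fin m) ℝ, S⁻¹ * (Mᵀ * M) = N ∧ HasLaw W (wishartOfMean M S) P

/-- With the noncentrality matrix `S⁻¹ Mᵀ M`, the form `ω μ μᵀ` with a unit vector `μ` is a case
of the form `ω S⁻¹ v vᵀ` with `vᵀ S⁻¹ v = 1`. -/
theorem exists_signal_vector {n m : ℕ} {S : Matrix (Fin m) (Fin m) ℝ} (hS : S.PosDef)
    (M : Matrix (Fin n) (Fin m) ℝ) {ω : ℝ} (hω : 0 < ω) {μ : Fin m → ℝ} (hμ : μ ⬝ᵥ μ = 1)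
    (h : S⁻¹ * (Mᵀ * M) = ω • vecMulVec μ μ) :
    ∃ v : Fin m → ℝ, v ⬝ᵥ (S⁻¹ *ᵥ v) = 1 ∧ vecMulVec μ μ = S⁻¹ * vecMulVec v v := by
  have hdet : IsUnit S.det := hS.det_pos.ne'.isUnit
  have hST : Sᵀ = S := by simpa [conjTranspose_eq_transpose_of_trivial] using hS.1.eq
  have h1 : Mᵀ * M = ω • (S * vecMulVec μ μ) := by
    rw [← Matrix.mul_smul, ← h, Matrix.mul_nonsing_inv_cancel_left _ _ hdet]
  have h2 : vecMulVec (S *ᵥ μ) μ = vecMulVec μ (S *ᵥ μ) := by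
    have h3 : (Mᵀ * M)ᵀ = Mᵀ * M := by simp
    rw [h1, transpose_smul] at h3
    have h4 := smul_right_injective _ hω.ne' h3
    rw [mul_vecMulVec, transpose_vecMulVec] at h4
    exact h4.symm
  have h5 : S *ᵥ μ = (μ ⬝ᵥ (S *ᵥ μ)) • μ := by
    have h6 := congrArg (fun A => A *ᵥ μ) h2
    simp only [vecMulVec_mulVec, hμ] at h6
    rw [dotProduct_comm μ]
    simpa using h6
  have hμ0 : μ ≠ 0 := by rintro rfl; simp at hμ
  have hpos : 0 < μ ⬝ᵥ (S *ᵥ μ) := by simpa using hS.dotProduct_mulVec_pos hμ0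
  set l := μ ⬝ᵥ (S *ᵥ μ) with hl
  have h7 : l • (S⁻¹ *ᵥ μ) = μ := by
    rw [← mulVec_smul, ← h5, mulVec_mulVec, nonsing_inv_mul _ hdet, one_mulVec]
  have hsq : √l * √l = l := Real.mul_self_sqrt hpos.le
  refine ⟨√l • μ, ?_, ?_⟩
  · rw [mulVec_smul, smul_dotProduct, dotProduct_smul, smul_smul, hsq, ← dotProduct_smul, h7, hμ]
  · rw [mul_vecMulVec, mulVec_smul, smul_vecMulVec, vecMulVec_smul, smul_smul, hsq,
      ← smul_vecMulVec, h7]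

/-! ### The `χ²` and `F` distributions -/

/-- The noncentral chi-square law `χ²_n(ω)`: the law of `∑ᵢ xᵢ²` for independent
`xᵢ ∼ N(θᵢ, 1)`, `i < n`, with `∑ᵢ θᵢ² = ω`; we take `θ = (√ω, 0, …, 0)`. -/
def noncentralChiSq (n : ℕ) (ω : ℝ) : Measure ℝ :=
  (Measure.pi fun i : Fin n => gaussianReal (if (i : ℕ) = 0 then √ω else 0) 1).map
    fun x => ∑ i, x i ^ 2

/-- The noncentral `F` law `F_{a,b}(ω)`: the law of `(χ²_a(ω) / a) / (χ²_b / b)` with independent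
numerator and denominator. The central law `F_{a,b}` is the case `ω = 0`. -/
def noncentralF (a b : ℕ) (ω : ℝ) : Measure ℝ :=
  ((noncentralChiSq a ω).prod (noncentralChiSq b 0)).map fun p => (p.1 / a) / (p.2 / b)

/-! ### The largest root and the terms of its expansion -/

/-- The largest (real) eigenvalue of a square matrix. -/
def largestRoot {m : ℕ} (A : Matrix (Fin m) (Fin m) ℝ) : ℝ := sSup (spectrum ℝ A)

section Terms

variable {m : ℕ} (S : Matrix (Fin m) (Fin m) ℝ) (v : Fin m → ℝ) (H E : Matrix (Fin m) (Fin m) ℝ)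

/-- `H₁₁`, the entry of `H` in the signal direction: `wᵀ H w` with `w = S⁻¹ v`. -/
def signalSq : ℝ := (S⁻¹ *ᵥ v) ⬝ᵥ (H *ᵥ (S⁻¹ *ᵥ v))

/-- The vector `b = (H w - H₁₁ v) / √H₁₁`, `w = S⁻¹ v`. For `S = 1` and `v = e₁` it is
`(0, H₂₁, …, H_{m1}) / √H₁₁`. -/
def crossVec : Fin m → ℝ :=
  (√(signalSq S v H))⁻¹ • (H *ᵥ (S⁻¹ *ᵥ v) - signalSq S v H • v)

/-- `x ↦ Qᵀ x`, where `Q = 1 - v (S⁻¹ v)ᵀ` is the projection along `v` onto the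
`S⁻¹`-orthogonal complement of `v`. -/
def complProj (x : Fin m → ℝ) : Fin m → ℝ := x - (v ⬝ᵥ x) • (S⁻¹ *ᵥ v)

/-- The term of zeroth order, `H₁₁ · vᵀ E⁻¹ v`. -/
def leadTerm : ℝ := signalSq S v H * (v ⬝ᵥ (E⁻¹ *ᵥ v))

/-- The term of first order, `2 √H₁₁ · bᵀ E⁻¹ v`. -/
def crossTerm : ℝ := 2 * √(signalSq S v H) * (crossVec S v H ⬝ᵥ (E⁻¹ *ᵥ v))

/-- First term of second order, `bᵀ E⁻¹ b - (bᵀ E⁻¹ v)² / (vᵀ E⁻¹ v)`, which is the reciprocal of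
the lower right entry of the inverse of the `2 × 2` matrix `[v b]ᵀ E⁻¹ [v b]`. -/
def schurTerm : ℝ :=
  crossVec S v H ⬝ᵥ (E⁻¹ *ᵥ crossVec S v H)
    - (crossVec S v H ⬝ᵥ (E⁻¹ *ᵥ v)) ^ 2 / (v ⬝ᵥ (E⁻¹ *ᵥ v))

/-- Second term of second order, `vᵀ E⁻¹ (Q H Qᵀ) E⁻¹ v / (vᵀ E⁻¹ v)`. -/
def residualTerm : ℝ :=
  (complProj S v (E⁻¹ *ᵥ v) ⬝ᵥ (H *ᵥ complProj S v (E⁻¹ *ᵥ v))) / (v ⬝ᵥ (E⁻¹ *ᵥ v))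

end Terms

/-! ### Stochastic order -/

/-- `X ω = O_p(r ω)` as `ω → ∞`, for random variables `X ω` on probability spaces that may depend
on `ω`. -/
def IsBigOp {𝓧 : ℝ → Type*} [∀ ω, MeasurableSpace (𝓧 ω)] (P : ∀ ω, Measure (𝓧 ω))
    (X : ∀ ω, 𝓧 ω → ℝ) (r : ℝ → ℝ) : Prop :=
  ∀ η : ℝ, 0 < η → ∃ K : ℝ, ∀ᶠ ω in atTop,
    P ω {x | K * r ω < |X ω x|} ≤ ENNReal.ofReal η

/-- The law of `c₁ F_{a₁,b₁}(ω) + c₂ F_{a₂,b₂} + c` with independent `F` variates. -/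
def combinedFLaw (a₁ b₁ a₂ b₂ : ℕ) (c₁ c₂ c ω : ℝ) : Measure ℝ :=
  ((noncentralF a₁ b₁ ω).prod (noncentralF a₂ b₂ 0)).map fun p => c₁ * p.1 + c₂ * p.2 + c

end RoyRoot

end

open RoyRoot

noncomputable section

namespace RoyRoot

/-! ### Whitening and orthogonal completion -/

/-! Choose `A` with `A S Aᵀ = 1` and `A v = e₀`. The largest root and all terms are unchanged under
`(S, v, H, E) ↦ (A S Aᵀ, A v, A H Aᵀ, A E Aᵀ)`, so one may take `S = 1`. With `m = p + 1` and `k = ν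
+ 1`, `H` is then the Gram matrix of a vector `x ∼ N(θ, 1)` with `|θ|² = ω` and `p` standard normal
vectors `X`, and `E` that of `p + 1` standard normal vectors `y`, `Y` in dimension `p + k`.

The expansion is deterministic (`largestRoot_expansion`). In coordinates with `E = 1`, put `g =
Hw/√h = √h v + b`; then `H = g gᵀ + R` with `R` positive semidefinite and `R w = 0`. The Rayleigh
quotient at `g` is a lower bound for the largest root, and `rank_one_perturbation_le` gives a
matching upper bound up to `O(1/h)`. Expanding `|g|² + gᵀRg/|g|²` in powers of `√h` gives the four
terms. The error is controlled by `noiseSize`, which does not see `x` and is therefore tight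
uniformly in `ω`, while `h` is of order `ω`.

The exact laws come from least squares regression of `y` on `Y`, with coefficients `q` and residual
sum of squares `d`. Set `β = X x/|x|` and let `G` be the Gram matrix of `Y`. The block inverse of
`E` gives `|x|²/d` for the lead term, `βᵀG⁻¹β` for the Schur term, `-2|x| β·q/d` for the cross term
and `|qᵀX|²/d` for the residual term. Here `|x|²`, `d`, `|β|²` and `|β|²/βᵀG⁻¹β` are independent
chi-squares, which yields the two `F` laws. The cross term is odd under `y ↦ -y`. Given `Y`, `q` and
`d` are independent with `q ∼ N(0, G⁻¹)`, so the residual term has mean `nH · E tr G⁻¹ · E d⁻¹`.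

For the distribution functions, the total error is `O_p(√ω)`, whereas `c₁F₁ = |x|²/d` spreads over
the scale `ω`: since `1/d` has no atoms, an interval of length `O(√ω)` carries vanishing mass
(`eventually_combinedFLaw_concentration_le`). Any additive constant is absorbed in the same way. -/

theorem exists_whitening {κ : Type*} [Fintype κ] [DecidableEq κ] {D : Matrix κ κ ℝ}
    (hD : D.PosDef) : ∃ B : Matrix κ κ ℝ, B * D * Bᵀ = 1 := by
  obtain ⟨C, hC, hDC⟩ : ∃ C : Matrix κ κ ℝ, IsUnit C ∧ D = Cᵀ * C := by
    open scoped MatrixOrder in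
    obtain ⟨C, h⟩ := CStarAlgebra.nonneg_iff_eq_star_mul_self.mp hD.posSemidef.nonneg
    rw [star_eq_conjTranspose, conjTranspose_eq_transpose_of_trivial] at h
    have hdet := hD.det_pos.ne'
    rw [h, det_mul] at hdet
    exact ⟨C, (isUnit_iff_isUnit_det _).2 (right_ne_zero_of_mul hdet).isUnit, h⟩
  refine ⟨(C⁻¹)ᵀ, ?_⟩
  have hdet := (isUnit_iff_isUnit_det _).1 hC
  rw [hDC, transpose_transpose, Matrix.mul_assoc, Matrix.mul_assoc, mul_nonsing_inv _ hdet, Matrix.mul_one,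
    ← transpose_mul, mul_nonsing_inv _ hdet, transpose_one]

theorem inv_eq_of_whitening {κ : Type*} [Fintype κ] [DecidableEq κ] {D B : Matrix κ κ ℝ}
    (h : B * D * Bᵀ = 1) : D⁻¹ = Bᵀ * B := by
  apply inv_eq_left_inv
  rw [Matrix.mul_assoc]
  exact mul_eq_one_comm.1 h

/-- Only the rows of `A₁` indexed by `s` matter; the others are placeholders to be replaced. It
serves both to rotate one unit vector to an axis and to complete `p` orthonormal rows to `p + k`. -/
theorem exists_orthogonal_extension {κ ι : Type*} [Fintype κ] [Fintype ι] [DecidableEq κ]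
    [DecidableEq ι] (hcard : Fintype.card ι = Fintype.card κ) (A₁ : Matrix κ ι ℝ) (s : Set κ)
    (h : ∀ j ∈ s, ∀ k ∈ s, A₁ j ⬝ᵥ A₁ k = (1 : Matrix κ κ ℝ) j k) :
    ∃ A : Matrix κ ι ℝ, A * Aᵀ = 1 ∧ ∀ j ∈ s, A j = A₁ j := by
  have ho : Orthonormal ℝ (s.domRestrict fun j => (WithLp.toLp 2 (A₁ j) : EuclideanSpace ℝ ι)) := by
    rw [orthonormal_iff_ite]
    rintro ⟨j, hj⟩ ⟨k, hk⟩
    have := h k hk j hj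
    simp only [Set.domRestrict_apply, EuclideanSpace.inner_toLp_toLp, star_trivial, this,
      one_apply, Subtype.mk.injEq]
    simp [eq_comm]
  obtain ⟨b, hb⟩ := ho.exists_orthonormalBasis_extension_of_card_eq (by simp [hcard])
  refine ⟨Matrix.of fun j => (b j).ofLp, ?_, fun j hj => by ext; simp [hb j hj]⟩
  ext j k
  have := orthonormal_iff_ite.1 b.orthonormal j k
  rw [EuclideanSpace.inner_eq_star_dotProduct] at this
  rw [one_apply, ← this]
  simp [mul_apply, dotProduct, mul_comm]

theorem exists_orthogonal_mulVec_eq_single {p : ℕ} {u : Fin (p + 1) → ℝ} (hu : u ⬝ᵥ u = 1) :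
    ∃ O : Matrix (Fin (p + 1)) (Fin (p + 1)) ℝ, O * Oᵀ = 1 ∧ O *ᵥ u = Pi.single 0 1 := by
  obtain ⟨O, hO, h0⟩ := exists_orthogonal_extension rfl (fun _ => u : Matrix (Fin (p+1)) (Fin (p+1)) ℝ) {0}
    (by rintro j rfl k rfl; simpa using hu)
  refine ⟨O, hO, ?_⟩
  have : u = Oᵀ *ᵥ Pi.single 0 1 := by
    rw [mulVec_single_one]
    exact (h0 0 rfl).symm
  rw [this, mulVec_mulVec, hO, one_mulVec]

/-- The normalization of `v` says that a whitened `v` is a unit vector; a rotation, which preserves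
whiteness, then sends it to the first axis. -/
theorem exists_whitening_single {p : ℕ} {S : Matrix (Fin (p + 1)) (Fin (p + 1)) ℝ} (hS : S.PosDef)
    {v : Fin (p + 1) → ℝ} (hv : v ⬝ᵥ (S⁻¹ *ᵥ v) = 1) :
    ∃ A : Matrix (Fin (p + 1)) (Fin (p + 1)) ℝ, A * S * Aᵀ = 1 ∧ A *ᵥ v = Pi.single 0 1 := by
  obtain ⟨B, hB⟩ := exists_whitening hS
  have hu : (B *ᵥ v) ⬝ᵥ (B *ᵥ v) = 1 := by
    rw [inv_eq_of_whitening hB, ← mulVec_mulVec, dotProduct_mulVec, vecMul_transpose] at hv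
    exact hv
  obtain ⟨O, hO, h⟩ := exists_orthogonal_mulVec_eq_single hu
  refine ⟨O * B, ?_, by rw [← mulVec_mulVec, h]⟩
  rw [transpose_mul, ← Matrix.mul_assoc, Matrix.mul_assoc O, Matrix.mul_assoc O, hB, Matrix.mul_one, hO]

/-! ### Equivariance of the terms under linear changes of coordinates -/

section Equivariance

variable {m : ℕ} {A S : Matrix (Fin m) (Fin m) ℝ} {v : Fin m → ℝ} {H E : Matrix (Fin m) (Fin m) ℝ}

theorem isUnit_det_of_whitening (hA : A * S * Aᵀ = 1) : IsUnit A.det := by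
  apply (isUnit_iff_isUnit_det _).1
  exact IsUnit.of_mul_eq_one (S * Aᵀ) (by rw [← Matrix.mul_assoc, hA])

/-- Vectors such as `v` transform by `A`, dual vectors such as `E⁻¹ v` and `S⁻¹ v` by `(A⁻¹)ᵀ`, and
their pairing is invariant. Equivariance of all the terms follows from these three rules. -/
theorem inv_congr_mulVec (hA : IsUnit A.det) (x : Fin m → ℝ) :
    (A * E * Aᵀ)⁻¹ *ᵥ (A *ᵥ x) = (A⁻¹)ᵀ *ᵥ (E⁻¹ *ᵥ x) := by
  rw [Matrix.mul_inv_rev, Matrix.mul_inv_rev, mulVec_mulVec, mulVec_mulVec, Matrix.mul_assoc,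
    Matrix.mul_assoc, nonsing_inv_mul _ hA, Matrix.mul_one, transpose_nonsing_inv]

theorem dotProduct_inv_congr (hA : IsUnit A.det) (x y : Fin m → ℝ) :
    (A *ᵥ x) ⬝ᵥ ((A⁻¹)ᵀ *ᵥ y) = x ⬝ᵥ y := by
  rw [dotProduct_mulVec, vecMul_transpose, mulVec_mulVec, nonsing_inv_mul _ hA, one_mulVec]

theorem congr_mulVec_inv (hA : IsUnit A.det) (x : Fin m → ℝ) :
    (A * H * Aᵀ) *ᵥ ((A⁻¹)ᵀ *ᵥ x) = A *ᵥ (H *ᵥ x) := by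
  rw [mulVec_mulVec, Matrix.mul_assoc, ← transpose_mul, nonsing_inv_mul _ hA, transpose_one,
    Matrix.mul_one, mulVec_mulVec]

theorem signalSq_congr (hA : IsUnit A.det) :
    signalSq (A * S * Aᵀ) (A *ᵥ v) (A * H * Aᵀ) = signalSq S v H := by
  unfold signalSq
  rw [inv_congr_mulVec hA, congr_mulVec_inv hA, dotProduct_comm, dotProduct_inv_congr hA,
    dotProduct_comm]

theorem crossVec_congr (hA : IsUnit A.det) :
    crossVec (A * S * Aᵀ) (A *ᵥ v) (A * H * Aᵀ) = A *ᵥ crossVec S v H := by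
  unfold crossVec
  rw [signalSq_congr hA, inv_congr_mulVec hA, congr_mulVec_inv hA, mulVec_smul, mulVec_sub,
    mulVec_smul]

theorem complProj_congr (hA : IsUnit A.det) (x : Fin m → ℝ) :
    complProj (A * S * Aᵀ) (A *ᵥ v) ((A⁻¹)ᵀ *ᵥ x) = (A⁻¹)ᵀ *ᵥ complProj S v x := by
  unfold complProj
  rw [inv_congr_mulVec hA, dotProduct_inv_congr hA, mulVec_sub, mulVec_smul]

theorem leadTerm_congr (hA : IsUnit A.det) :
    leadTerm (A * S * Aᵀ) (A *ᵥ v) (A * H * Aᵀ) (A * E * Aᵀ) = leadTerm S v H E := by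
  unfold leadTerm
  rw [signalSq_congr hA, inv_congr_mulVec hA, dotProduct_inv_congr hA]

theorem crossTerm_congr (hA : IsUnit A.det) :
    crossTerm (A * S * Aᵀ) (A *ᵥ v) (A * H * Aᵀ) (A * E * Aᵀ) = crossTerm S v H E := by
  unfold crossTerm
  rw [signalSq_congr hA, crossVec_congr hA, inv_congr_mulVec hA, dotProduct_inv_congr hA]

theorem schurTerm_congr (hA : IsUnit A.det) :
    schurTerm (A * S * Aᵀ) (A *ᵥ v) (A * H * Aᵀ) (A * E * Aᵀ) = schurTerm S v H E := by
  unfold schurTerm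
  rw [crossVec_congr hA, inv_congr_mulVec hA, inv_congr_mulVec hA, dotProduct_inv_congr hA,
    dotProduct_inv_congr hA, dotProduct_inv_congr hA]

theorem residualTerm_congr (hA : IsUnit A.det) :
    residualTerm (A * S * Aᵀ) (A *ᵥ v) (A * H * Aᵀ) (A * E * Aᵀ) = residualTerm S v H E := by
  unfold residualTerm
  rw [inv_congr_mulVec hA, complProj_congr hA, congr_mulVec_inv hA, dotProduct_inv_congr hA,
    dotProduct_comm, dotProduct_inv_congr hA, dotProduct_comm]

theorem largestRoot_congr (hA : IsUnit A.det) :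
    largestRoot ((A * E * Aᵀ)⁻¹ * (A * H * Aᵀ)) = largestRoot (E⁻¹ * H) := by
  unfold largestRoot
  have h : (A * E * Aᵀ)⁻¹ * (A * H * Aᵀ) = (Aᵀ)⁻¹ * (E⁻¹ * H) * Aᵀ := by
    rw [Matrix.mul_inv_rev, Matrix.mul_inv_rev]
    simp only [Matrix.mul_assoc]
    rw [nonsing_inv_mul_cancel_left _ _ hA]
  have hT : IsUnit (Aᵀ) := (isUnit_iff_isUnit_det _).2 (by rwa [det_transpose])
  obtain ⟨U, hU⟩ := hT
  rw [h, ← hU, ← coe_units_inv, spectrum.units_conjugate']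

end Equivariance

/-! ### Variational bounds for the largest root -/

section Rayleigh

variable {m : ℕ} {H : Matrix (Fin m) (Fin m) ℝ}

theorem bddAbove_spectrum (A : Matrix (Fin m) (Fin m) ℝ) : BddAbove (spectrum ℝ A) :=
  (Matrix.finite_real_spectrum (A := A)).bddAbove

/-- An eigenvalue `μ` of `largestRoot H • 1 - H` makes `largestRoot H - μ` an eigenvalue of `H`, so
`μ ≥ 0` by maximality. -/
theorem rayleigh_le_largestRoot (hH : H.PosSemidef) (x : Fin m → ℝ) :
    x ⬝ᵥ (H *ᵥ x) ≤ largestRoot H * (x ⬝ᵥ x) := by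
  have hK : (largestRoot H • (1 : Matrix (Fin m) (Fin m) ℝ) - H).IsHermitian :=
    (isHermitian_one.smul (.all _)).sub hH.1
  have hP : (largestRoot H • (1 : Matrix (Fin m) (Fin m) ℝ) - H).PosSemidef := by
    rw [hK.posSemidef_iff_eigenvalues_nonneg]
    intro i
    have h := hK.eigenvalues_mem_spectrum_real i
    have h2 : largestRoot H - hK.eigenvalues i ∈ spectrum ℝ H := by
      rw [spectrum.mem_iff] at h ⊢
      intro hu
      apply h
      convert hu.neg using 1
      rw [Algebra.algebraMap_eq_smul_one, Algebra.algebraMap_eq_smul_one, sub_smul]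
      abel
    have := le_csSup (bddAbove_spectrum H) h2
    change _ ≤ largestRoot H at this
    simp only [Pi.zero_apply]
    linarith
  have := hP.dotProduct_mulVec_nonneg x
  rw [sub_mulVec, smul_mulVec, one_mulVec, star_trivial, dotProduct_sub, dotProduct_smul,
    smul_eq_mul] at this
  linarith

/-- Evaluate the form at an eigenvector. In dimension zero the spectrum is empty and its `sSup` is
`0`, so the bound would fail for negative `c`. -/
theorem largestRoot_le [NeZero m] (hH : H.PosSemidef) {c : ℝ}
    (h : ∀ x : Fin m → ℝ, x ⬝ᵥ (H *ᵥ x) ≤ c * (x ⬝ᵥ x)) : largestRoot H ≤ c := by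
  apply csSup_le
  · rw [hH.1.spectrum_real_eq_range_eigenvalues]
    exact Set.range_nonempty _
  · intro μ hμ
    rw [← Matrix.spectrum_toLin', ← Module.End.hasEigenvalue_iff_mem_spectrum] at hμ
    obtain ⟨x, hx⟩ := hμ.exists_hasEigenvector
    have h1 := hx.apply_eq_smul
    have h2 := h x
    rw [toLin'_apply] at h1
    rw [h1, dotProduct_smul, smul_eq_mul] at h2
    have h3 : 0 < x ⬝ᵥ x := by
      have := dotProduct_star_self_pos_iff.2 hx.2
      simpa using this
    exact le_of_mul_le_mul_right h2 h3

end Rayleigh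

/-! ### Deterministic expansion of the largest root -/

section Expansion

variable {m : ℕ}

theorem dotProduct_self_nonneg' {ι : Type*} [Fintype ι] (x : ι → ℝ) : 0 ≤ x ⬝ᵥ x :=
  Finset.sum_nonneg fun _ _ => mul_self_nonneg _

theorem dotProduct_sq_le {ι : Type*} [Fintype ι] (x y : ι → ℝ) :
    (x ⬝ᵥ y) ^ 2 ≤ (x ⬝ᵥ x) * (y ⬝ᵥ y) := by
  have := Finset.sum_mul_sq_le_sq_mul_sq Finset.univ x y
  simpa [dotProduct, sq] using this

theorem dotProduct_mulVec_comm {ι : Type*} [Fintype ι] {R : Matrix ι ι ℝ} (hR : Rᵀ = R)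
    (x y : ι → ℝ) : x ⬝ᵥ (R *ᵥ y) = y ⬝ᵥ (R *ᵥ x) := by
  rw [dotProduct_mulVec, dotProduct_comm, ← mulVec_transpose, hR]

theorem posSemidef_transpose_eq {ι : Type*} [Fintype ι] {R : Matrix ι ι ℝ} (hR : R.PosSemidef) :
    Rᵀ = R := by
  simpa [conjTranspose_eq_transpose_of_trivial] using hR.1.eq

theorem posSemidef_nonneg {ι : Type*} [Fintype ι] {R : Matrix ι ι ℝ} (hR : R.PosSemidef)
    (x : ι → ℝ) : 0 ≤ x ⬝ᵥ (R *ᵥ x) := by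
  simpa using hR.dotProduct_mulVec_nonneg x

theorem posSemidef_cauchy_schwarz {ι : Type*} [Fintype ι] {R : Matrix ι ι ℝ} (hR : R.PosSemidef)
    (x y : ι → ℝ) : (x ⬝ᵥ (R *ᵥ y)) ^ 2 ≤ (x ⬝ᵥ (R *ᵥ x)) * (y ⬝ᵥ (R *ᵥ y)) := by
  classical
  open scoped MatrixOrder in
  obtain ⟨C, hC⟩ := CStarAlgebra.nonneg_iff_eq_star_mul_self.mp hR.nonneg
  have key (a b : ι → ℝ) : a ⬝ᵥ (R *ᵥ b) = (C *ᵥ a) ⬝ᵥ (C *ᵥ b) := by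
    rw [hC, star_eq_conjTranspose, conjTranspose_eq_transpose_of_trivial, ← mulVec_mulVec,
      dotProduct_mulVec, vecMul_transpose]
  rw [key, key, key]
  exact dotProduct_sq_le _ _

/-- Split `x = s g + z` with `z ⊥ g`. The mixed term `2 s gᵀRz` is absorbed by AM-GM: the gap `|g|²
- M` pays for the part along `z`, and the last summand of the constant for the part along `g`. -/
theorem rank_one_perturbation_le {R : Matrix (Fin m) (Fin m) ℝ} (hR : R.PosSemidef)
    {g : Fin m → ℝ} {M : ℝ} (hM : 0 ≤ M) (hRM : ∀ x, x ⬝ᵥ (R *ᵥ x) ≤ M * (x ⬝ᵥ x))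
    (hG : M < g ⬝ᵥ g) (x : Fin m → ℝ) :
    (g ⬝ᵥ x) ^ 2 + x ⬝ᵥ (R *ᵥ x) ≤
      (g ⬝ᵥ g + g ⬝ᵥ (R *ᵥ g) / (g ⬝ᵥ g) + M ^ 2 / (g ⬝ᵥ g - M)) * (x ⬝ᵥ x) := by
  set G := g ⬝ᵥ g with hGdef
  have hG0 : 0 < G := hM.trans_lt hG
  obtain ⟨s, hs⟩ : ∃ s, s = g ⬝ᵥ x / G := ⟨_, rfl⟩
  obtain ⟨z, hz⟩ : ∃ z, z = x - s • g := ⟨_, rfl⟩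
  have hgz : g ⬝ᵥ z = 0 := by
    rw [hz, dotProduct_sub, dotProduct_smul, smul_eq_mul, hs, ← hGdef, div_mul_cancel₀ _ hG0.ne',
      sub_self]
  have hx : x = s • g + z := by rw [hz]; abel
  have hgx : g ⬝ᵥ x = s * G := by rw [hs, div_mul_cancel₀ _ hG0.ne']
  have hxx : x ⬝ᵥ x = s ^ 2 * G + z ⬝ᵥ z := by
    rw [hx, dotProduct_add, add_dotProduct, add_dotProduct, smul_dotProduct, smul_dotProduct,
      dotProduct_smul, dotProduct_smul, dotProduct_comm z g, hgz, ← hGdef]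
    simp only [smul_eq_mul]
    ring
  have hcomm := dotProduct_mulVec_comm (posSemidef_transpose_eq hR) z g
  have hRx : x ⬝ᵥ (R *ᵥ x) =
      s ^ 2 * (g ⬝ᵥ (R *ᵥ g)) + 2 * s * (g ⬝ᵥ (R *ᵥ z)) + z ⬝ᵥ (R *ᵥ z) := by
    rw [hx, mulVec_add, mulVec_smul, dotProduct_add, add_dotProduct, add_dotProduct,
      smul_dotProduct, smul_dotProduct, dotProduct_smul, dotProduct_smul, hcomm]
    simp only [smul_eq_mul]
    ring
  rw [hRx, hxx, hgx]
  have hcs := posSemidef_cauchy_schwarz hR g z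
  have hRg := hRM g
  have hRz := hRM z
  have hRg0 := posSemidef_nonneg hR g
  have hRz0 := posSemidef_nonneg hR z
  have hZ0 := dotProduct_self_nonneg' z
  rw [← hGdef] at hRg
  generalize g ⬝ᵥ (R *ᵥ g) = r at *
  generalize g ⬝ᵥ (R *ᵥ z) = a at *
  generalize z ⬝ᵥ (R *ᵥ z) = q at *
  generalize z ⬝ᵥ z = Z at *
  have hGM : 0 < G - M := by linarith
  -- The value of `δ` is forced by `δ (G - M) = M²`, which makes the AM-GM step for `2 s a` exact.
  obtain ⟨δ, hδ⟩ : ∃ δ, δ = M ^ 2 / (G - M) := ⟨_, rfl⟩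
  have hδ0 : 0 ≤ δ := by rw [hδ]; positivity
  have hδG : δ * (G - M) = M ^ 2 := by rw [hδ, div_mul_cancel₀ _ hGM.ne']
  have hrG : 0 ≤ r / G := by positivity
  have hrG' : r / G * G = r := div_mul_cancel₀ _ hG0.ne'
  have ha : a ^ 2 ≤ M ^ 2 * G * Z := by
    calc a ^ 2 ≤ r * q := hcs
      _ ≤ (M * G) * (M * Z) := by gcongr
      _ = _ := by ring
  have h2 : 2 * s * a ≤ δ * s ^ 2 * G + (G - M) * Z := by
    apply le_of_abs_le
    apply abs_le_of_sq_le_sq _ (by positivity)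
    have h3 : s ^ 2 * a ^ 2 ≤ (δ * s ^ 2 * G) * ((G - M) * Z) := by
      calc s ^ 2 * a ^ 2 ≤ s ^ 2 * (M ^ 2 * G * Z) := by gcongr
        _ = (δ * s ^ 2 * G) * ((G - M) * Z) := by rw [← hδG]; ring
    nlinarith [sq_nonneg (δ * s ^ 2 * G - (G - M) * Z)]
  rw [← hδ]
  have h4 : 0 ≤ (r / G) * Z := by positivity
  have h5 : 0 ≤ δ * Z := by positivity
  have h6 : (G + r / G + δ) * (s ^ 2 * G + Z) =
      s ^ 2 * G ^ 2 + s ^ 2 * (r / G * G) + δ * s ^ 2 * G + G * Z + (r / G) * Z + δ * Z := by ring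
  rw [h6, hrG']
  nlinarith

/-- Scalar part of the expansion, with `t = √h`, `G = |g|²`, `e = |v|²`, `β2 = |b|²`, `βv = b·v`,
and `Rv`, `Rvb`, `Rb` the values of `R` on `v` and `b`. -/
theorem expansion_scalar_bound {t M e β2 βv Rv Rb Rvb G : ℝ} (hM : 1 ≤ M) (he1 : e ≤ M)
    (he2 : 1 ≤ M * e) (ht : 4 * M ^ 2 ≤ t) (hβ0 : 0 ≤ β2) (hβ : β2 ≤ M) (hβv : |βv| ≤ M)
    (hRv0 : 0 ≤ Rv) (hRv : Rv ≤ M ^ 2) (hRb0 : 0 ≤ Rb) (hRb : Rb ≤ M ^ 2) (hRvb : |Rvb| ≤ M ^ 2)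
    (hG : G = t ^ 2 * e + 2 * t * βv + β2) :
    2 * M ≤ G ∧ M ^ 2 / (G - M) ≤ 4 * M ^ 5 / t ∧
      |(t ^ 2 * Rv + 2 * t * Rvb + Rb) / G - Rv / e| ≤ 12 * M ^ 5 / t := by
  have hM0 : 0 < M := by linarith
  have he0 : 0 < e := by
    by_contra! h
    nlinarith
  have hM2 : 1 ≤ M ^ 2 := one_le_pow₀ hM
  have ht4 : 4 ≤ t := by linarith
  have ht0 : 0 < t := by linarith
  -- The threshold `4 M² ≤ t` is what makes `2 t |βv| ≤ 2 t M` at most half of `t²/M ≤ t² e`.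
  have hGt : t ^ 2 ≤ 2 * M * G := by
    rw [abs_le] at hβv
    have h1 : t ^ 2 ≤ t ^ 2 * (M * e) := by nlinarith [sq_nonneg t]
    have h2 : 4 * M * (t * M) ≤ t * t := by nlinarith
    have h3 : -(t * M) ≤ t * βv := by nlinarith
    have h4 : 2 * M * G = 2 * (t ^ 2 * (M * e)) + 4 * M * (t * βv) + 2 * M * β2 := by
      rw [hG]; ring
    have h5 : 0 ≤ 2 * M * β2 := by positivity
    have h6 : 4 * M * -(t * M) ≤ 4 * M * (t * βv) := by gcongr
    nlinarith
  have hG2M : 2 * M ≤ G := by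
    have : (4 * M ^ 2) ^ 2 ≤ t ^ 2 := by gcongr
    have h2 : 16 * M ^ 2 * 1 ≤ 16 * M ^ 2 * M ^ 2 := by gcongr
    have : M * (2 * M) ≤ M * G := by nlinarith
    exact le_of_mul_le_mul_left this hM0
  have hG0 : 0 < G := by linarith
  refine ⟨hG2M, ?_, ?_⟩
  · rw [div_le_div_iff₀ (by linarith) ht0]
    have h1 : t ^ 2 ≤ 4 * M * (G - M) := by nlinarith
    have h2 : M ^ 2 * t ≤ M ^ 2 * t ^ 2 := by
      have : t ≤ t ^ 2 := by nlinarith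
      gcongr
    have h3 : M ^ 2 * t ^ 2 ≤ M ^ 2 * (4 * M * (G - M)) := by gcongr
    have h4 : 4 * M ^ 3 * (G - M) ≤ 4 * M ^ 5 * (G - M) := by
      have : M ^ 3 ≤ M ^ 5 := pow_le_pow_right₀ hM (by norm_num)
      have : 0 ≤ G - M := by linarith
      gcongr
    nlinarith
  -- Over the common denominator the `t²` parts cancel, leaving a numerator of order `t` over a
  -- denominator of order `t²`.
  · have hid : (t ^ 2 * Rv + 2 * t * Rvb + Rb) / G - Rv / e =
        (e * (2 * t * Rvb + Rb) - Rv * (2 * t * βv + β2)) / (G * e) := by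
      rw [div_sub_div _ _ hG0.ne' he0.ne']
      congr 1
      rw [hG]; ring
    rw [hid, abs_div, abs_of_pos (mul_pos hG0 he0), div_le_div_iff₀ (mul_pos hG0 he0) ht0]
    have hnum : |e * (2 * t * Rvb + Rb) - Rv * (2 * t * βv + β2)| ≤ 6 * t * M ^ 3 := by
      have h1 : |2 * t * Rvb + Rb| ≤ 2 * t * M ^ 2 + M ^ 2 := by
        refine (abs_add_le _ _).trans ?_
        rw [abs_mul, abs_of_pos (by linarith : 0 < 2 * t), abs_of_nonneg hRb0]
        gcongr
      have h2 : |2 * t * βv + β2| ≤ 2 * t * M + M := by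
        refine (abs_add_le _ _).trans ?_
        rw [abs_mul, abs_of_pos (by linarith : 0 < 2 * t), abs_of_nonneg hβ0]
        gcongr
      refine (abs_sub _ _).trans ?_
      rw [abs_mul, abs_mul, abs_of_pos he0, abs_of_nonneg hRv0]
      have h3 : e * |2 * t * Rvb + Rb| ≤ M * (2 * t * M ^ 2 + M ^ 2) := by gcongr
      have h4 : Rv * |2 * t * βv + β2| ≤ M ^ 2 * (2 * t * M + M) := by gcongr
      have h5 : 1 * M ^ 3 ≤ t * M ^ 3 := by gcongr; linarith
      nlinarith
    have hden : t ^ 2 ≤ 2 * M ^ 2 * (G * e) := by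
      have : 2 * M * G * 1 ≤ 2 * M * G * (M * e) := by gcongr
      nlinarith
    calc |e * (2 * t * Rvb + Rb) - Rv * (2 * t * βv + β2)| * t ≤ 6 * t * M ^ 3 * t := by gcongr
      _ = 6 * M ^ 3 * t ^ 2 := by ring
      _ ≤ 6 * M ^ 3 * (2 * M ^ 2 * (G * e)) := by gcongr
      _ = _ := by ring

/-- The case `E = 1`. Hypothesis `hN` bounds the part of `H` that is free of the signal; through
`hproj` it controls both `R` and `b`. -/
theorem largestRoot_expansion [NeZero m] {H : Matrix (Fin m) (Fin m) ℝ} (hH : H.PosSemidef)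
    {v w b : Fin m → ℝ} {h M : ℝ} (hvw : v ⬝ᵥ w = 1) (hh : h = w ⬝ᵥ (H *ᵥ w))
    (hb : b = (√h)⁻¹ • (H *ᵥ w - h • v)) (hM : 1 ≤ M) (he1 : v ⬝ᵥ v ≤ M) (he2 : 1 ≤ M * (v ⬝ᵥ v))
    (hN : ∀ x, (x - (v ⬝ᵥ x) • w) ⬝ᵥ (H *ᵥ (x - (v ⬝ᵥ x) • w)) ≤ M * (x ⬝ᵥ x))
    (ht : 4 * M ^ 2 ≤ √h) :
    |largestRoot H - (h * (v ⬝ᵥ v) + (b ⬝ᵥ b - (b ⬝ᵥ v) ^ 2 / (v ⬝ᵥ v)) + 2 * √h * (b ⬝ᵥ v) +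
      (v - (v ⬝ᵥ v) • w) ⬝ᵥ (H *ᵥ (v - (v ⬝ᵥ v) • w)) / (v ⬝ᵥ v))| ≤ 16 * M ^ 5 / √h := by
  have hHT := posSemidef_transpose_eq hH
  have ht0 : 0 < √h := lt_of_lt_of_le (by positivity) ht
  have hh0 : 0 < h := Real.sqrt_pos.1 ht0
  set t := √h with htdef
  have htt : t * t = h := Real.mul_self_sqrt hh0.le
  obtain ⟨g, hg⟩ : ∃ g, g = t • v + b := ⟨_, rfl⟩
  have hgH : g = t⁻¹ • (H *ᵥ w) := by
    rw [hg, hb, smul_sub, smul_smul, ← htt, inv_mul_cancel_left₀ ht0.ne']; abel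
  have hHw : H *ᵥ w = t • g := by rw [hgH, smul_smul, mul_inv_cancel₀ ht0.ne', one_smul]
  have hgw : g ⬝ᵥ w = t := by
    rw [hgH, smul_dotProduct, dotProduct_comm, ← hh, ← htt, smul_eq_mul,
      inv_mul_cancel_left₀ ht0.ne']
  have hbw : b ⬝ᵥ w = 0 := by
    have : g ⬝ᵥ w = t * (v ⬝ᵥ w) + b ⬝ᵥ w := by rw [hg, add_dotProduct, smul_dotProduct]; rfl
    rw [hgw, hvw] at this; linarith
  obtain ⟨R, hRdef⟩ : ∃ R, R = H - vecMulVec g g := ⟨_, rfl⟩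
  have hRxy (x y : Fin m → ℝ) : x ⬝ᵥ (R *ᵥ y) = x ⬝ᵥ (H *ᵥ y) - (g ⬝ᵥ x) * (g ⬝ᵥ y) := by
    rw [hRdef, sub_mulVec, dotProduct_sub, vecMulVec_mulVec]
    simp [dotProduct_comm x g, mul_comm]
  have hRT : Rᵀ = R := by rw [hRdef, transpose_sub, hHT, transpose_vecMulVec]
  -- Since `g = Hw/√h`, nonnegativity of `R` is the Cauchy-Schwarz inequality for `H` with one
  -- argument equal to `w`.
  have hR : R.PosSemidef := by
    refine .of_dotProduct_mulVec_nonneg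
      (by rw [IsHermitian, conjTranspose_eq_transpose_of_trivial, hRT]) fun x => ?_
    rw [star_trivial, hRxy]
    have := posSemidef_cauchy_schwarz hH x w
    rw [← hh, hHw, dotProduct_smul, smul_eq_mul, dotProduct_comm x g, mul_pow, ← htt] at this
    have h2 : 0 < t ^ 2 := by positivity
    nlinarith
  have hRw : R *ᵥ w = 0 := by
    rw [hRdef, sub_mulVec, vecMulVec_mulVec, hHw, hgw]
    simp
  -- `R` kills `w`, and `g·w = t`, `b·w = 0` give `g·(x - (v·x) w) = b·x`: projecting removes
  -- exactly the signal part of `g`.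
  have hproj (x : Fin m → ℝ) : (x - (v ⬝ᵥ x) • w) ⬝ᵥ (H *ᵥ (x - (v ⬝ᵥ x) • w)) =
      x ⬝ᵥ (R *ᵥ x) + (b ⬝ᵥ x) ^ 2 := by
    have h1 := hRxy (x - (v ⬝ᵥ x) • w) (x - (v ⬝ᵥ x) • w)
    have h2 : R *ᵥ (x - (v ⬝ᵥ x) • w) = R *ᵥ x := by
      rw [mulVec_sub, mulVec_smul, hRw, smul_zero, sub_zero]
    have h3 : w ⬝ᵥ (R *ᵥ x) = 0 := by rw [dotProduct_mulVec_comm hRT, hRw, dotProduct_zero]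
    have h4 : g ⬝ᵥ (x - (v ⬝ᵥ x) • w) = b ⬝ᵥ x := by
      rw [dotProduct_sub, dotProduct_smul, hgw, hg, add_dotProduct, smul_dotProduct]
      simp only [smul_eq_mul]; ring
    rw [h2, sub_dotProduct, smul_dotProduct, h3, h4] at h1
    simp only [smul_zero, sub_zero] at h1
    linarith
  have hsum (x : Fin m → ℝ) : x ⬝ᵥ (R *ᵥ x) + (b ⬝ᵥ x) ^ 2 ≤ M * (x ⬝ᵥ x) := by
    rw [← hproj]; exact hN x
  have hRM (x : Fin m → ℝ) : x ⬝ᵥ (R *ᵥ x) ≤ M * (x ⬝ᵥ x) := by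
    nlinarith [hsum x, sq_nonneg (b ⬝ᵥ x)]
  have hβ0 := dotProduct_self_nonneg' b
  -- At `x = b` the bound reads `(b·b)² ≤ M (b·b)`.
  have hβ : b ⬝ᵥ b ≤ M := by
    by_contra! hlt
    have := hsum b
    have := posSemidef_nonneg hR b
    nlinarith
  have hM0 : 0 ≤ M := by linarith
  have hMM : M * M = M ^ 2 := (sq M).symm
  have hβv : |b ⬝ᵥ v| ≤ M := by
    apply abs_le_of_sq_le_sq _ hM0
    calc (b ⬝ᵥ v) ^ 2 ≤ (b ⬝ᵥ b) * (v ⬝ᵥ v) := dotProduct_sq_le _ _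
      _ ≤ M * M := by have := dotProduct_self_nonneg' v; gcongr
      _ = _ := hMM
  have hRv : v ⬝ᵥ (R *ᵥ v) ≤ M ^ 2 := (hRM v).trans (by rw [← hMM]; gcongr)
  have hRb : b ⬝ᵥ (R *ᵥ b) ≤ M ^ 2 := (hRM b).trans (by rw [← hMM]; gcongr)
  have hRvb : |v ⬝ᵥ (R *ᵥ b)| ≤ M ^ 2 := by
    apply abs_le_of_sq_le_sq _ (by positivity)
    calc (v ⬝ᵥ (R *ᵥ b)) ^ 2 ≤ _ := posSemidef_cauchy_schwarz hR v b
      _ ≤ M ^ 2 * M ^ 2 := by have := posSemidef_nonneg hR b; gcongr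
      _ = _ := by ring
  have hG : g ⬝ᵥ g = t ^ 2 * (v ⬝ᵥ v) + 2 * t * (b ⬝ᵥ v) + b ⬝ᵥ b := by
    rw [hg, dotProduct_add, add_dotProduct, add_dotProduct, smul_dotProduct, smul_dotProduct,
      dotProduct_smul, dotProduct_smul, dotProduct_comm v b]
    simp only [smul_eq_mul]; ring
  have hRg : g ⬝ᵥ (R *ᵥ g) =
      t ^ 2 * (v ⬝ᵥ (R *ᵥ v)) + 2 * t * (v ⬝ᵥ (R *ᵥ b)) + b ⬝ᵥ (R *ᵥ b) := by
    rw [hg, mulVec_add, mulVec_smul, dotProduct_add, add_dotProduct, add_dotProduct,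
      smul_dotProduct, smul_dotProduct, dotProduct_smul, dotProduct_smul,
      dotProduct_mulVec_comm hRT b v]
    simp only [smul_eq_mul]; ring
  obtain ⟨hG2, hδ, hdiff⟩ := expansion_scalar_bound hM he1 he2 ht hβ0 hβ hβv
    (posSemidef_nonneg hR v) hRv (posSemidef_nonneg hR b) hRb hRvb hG
  rw [← hRg] at hdiff
  have hG0 : 0 < g ⬝ᵥ g := by linarith
  have hHx (x : Fin m → ℝ) : x ⬝ᵥ (H *ᵥ x) = (g ⬝ᵥ x) ^ 2 + x ⬝ᵥ (R *ᵥ x) := by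
    rw [hRxy]; ring
  have hupper := largestRoot_le hH fun x => (hHx x).le.trans
    (rank_one_perturbation_le hR hM0 hRM (by linarith) x)
  have hlower : g ⬝ᵥ g + g ⬝ᵥ (R *ᵥ g) / (g ⬝ᵥ g) ≤ largestRoot H := by
    have := rayleigh_le_largestRoot hH g
    rw [hHx] at this
    rw [← div_le_iff₀ hG0, add_div, sq, mul_div_assoc, div_self hG0.ne', mul_one] at this
    exact this
  -- The `(b·v)²/e` contained in the residual term cancels the one subtracted in the Schur term,
  -- leaving `|g|² + vᵀRv/e`.
  have htarget : h * (v ⬝ᵥ v) + (b ⬝ᵥ b - (b ⬝ᵥ v) ^ 2 / (v ⬝ᵥ v)) + 2 * t * (b ⬝ᵥ v) +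
      (v - (v ⬝ᵥ v) • w) ⬝ᵥ (H *ᵥ (v - (v ⬝ᵥ v) • w)) / (v ⬝ᵥ v) =
      g ⬝ᵥ g + v ⬝ᵥ (R *ᵥ v) / (v ⬝ᵥ v) := by
    rw [hproj, hG, ← htt, add_div]; ring
  rw [htarget]
  have h16 : 16 * M ^ 5 / t = 4 * M ^ 5 / t + 12 * M ^ 5 / t := by ring
  rw [abs_le] at hdiff ⊢
  have : 0 ≤ 4 * M ^ 5 / t := by positivity
  constructor <;> linarith [hdiff.1, hdiff.2]

end Expansion

/-- Whitening `E` by `B` reduces to `E = 1`. The argument of `hN` is a dual vector, whose squared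
length in the new coordinates is `xᵀ E x`. -/
theorem largestRoot_expansion_of_posDef {m : ℕ} [NeZero m] {S H E : Matrix (Fin m) (Fin m) ℝ}
    {v : Fin m → ℝ} (hH : H.PosSemidef) (hE : E.PosDef) (hv : v ⬝ᵥ (S⁻¹ *ᵥ v) = 1) {M : ℝ}
    (hM : 1 ≤ M) (he1 : v ⬝ᵥ (E⁻¹ *ᵥ v) ≤ M) (he2 : 1 ≤ M * (v ⬝ᵥ (E⁻¹ *ᵥ v)))
    (hN : ∀ x, complProj S v x ⬝ᵥ (H *ᵥ complProj S v x) ≤ M * (x ⬝ᵥ (E *ᵥ x)))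
    (ht : 4 * M ^ 2 ≤ √(signalSq S v H)) :
    |largestRoot (E⁻¹ * H) - (leadTerm S v H E + schurTerm S v H E + crossTerm S v H E +
      residualTerm S v H E)| ≤ 16 * M ^ 5 / √(signalSq S v H) := by
  obtain ⟨B, hB⟩ := exists_whitening hE
  have hBu := isUnit_det_of_whitening hB
  have hdot (x y : Fin m → ℝ) : (B *ᵥ x) ⬝ᵥ (B *ᵥ y) = x ⬝ᵥ (E⁻¹ *ᵥ y) := by
    rw [inv_eq_of_whitening hB, ← mulVec_mulVec, dotProduct_mulVec x, vecMul_transpose]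
  have hvw : (B *ᵥ v) ⬝ᵥ ((B * S * Bᵀ)⁻¹ *ᵥ (B *ᵥ v)) = 1 := by
    rw [inv_congr_mulVec hBu, dotProduct_inv_congr hBu, hv]
  have hN' (x : Fin m → ℝ) :
      complProj (B * S * Bᵀ) (B *ᵥ v) x ⬝ᵥ ((B * H * Bᵀ) *ᵥ complProj (B * S * Bᵀ) (B *ᵥ v) x) ≤
        M * (x ⬝ᵥ x) := by
    obtain ⟨y, rfl⟩ : ∃ y, x = (B⁻¹)ᵀ *ᵥ y := ⟨Bᵀ *ᵥ x, by
      rw [mulVec_mulVec, ← transpose_mul, mul_nonsing_inv _ hBu, transpose_one, one_mulVec]⟩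
    rw [complProj_congr hBu, congr_mulVec_inv hBu, dotProduct_comm, dotProduct_inv_congr hBu,
      dotProduct_comm]
    refine (hN y).trans_eq ?_
    congr 1
    symm
    have h := congr_mulVec_inv hBu (H := E) y
    rw [hB, one_mulVec] at h
    calc ((B⁻¹)ᵀ *ᵥ y) ⬝ᵥ ((B⁻¹)ᵀ *ᵥ y) = (B *ᵥ (E *ᵥ y)) ⬝ᵥ ((B⁻¹)ᵀ *ᵥ y) := by rw [h]
      _ = _ := by rw [dotProduct_inv_congr hBu, dotProduct_comm]
  have hBH : (B * H * Bᵀ).PosSemidef := by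
    have := hH.mul_mul_conjTranspose_same B
    rwa [conjTranspose_eq_transpose_of_trivial] at this
  have key := largestRoot_expansion hBH (v := B *ᵥ v) (h := signalSq S v H) (M := M)
    (b := B *ᵥ crossVec S v H) hvw
    (by rw [← signalSq_congr hBu]; rfl)
    (by rw [← crossVec_congr hBu, ← signalSq_congr hBu (A := B) (S := S) (v := v)]; rfl)
    hM (by rwa [hdot]) (by rwa [hdot]) hN' ht
  have hl := largestRoot_congr hBu (E := E) (H := H)
  rw [hB, inv_one, Matrix.one_mul] at hl
  have h4 := residualTerm_congr hBu (S := S) (v := v) (H := H) (E := E)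
  rw [hB] at h4
  simp only [residualTerm, complProj, inv_one, one_mulVec] at h4
  rw [hl, h4, hdot, hdot, hdot] at key
  exact key

theorem dotProduct_sq_le_of_posDef {ι : Type*} [Fintype ι] [DecidableEq ι] {E : Matrix ι ι ℝ}
    (hE : E.PosDef) (c x : ι → ℝ) :
    (c ⬝ᵥ x) ^ 2 ≤ (c ⬝ᵥ (E⁻¹ *ᵥ c)) * (x ⬝ᵥ (E *ᵥ x)) := by
  have hdet : IsUnit E.det := hE.det_pos.ne'.isUnit
  have h := posSemidef_cauchy_schwarz hE.posSemidef x (E⁻¹ *ᵥ c)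
  rw [mulVec_mulVec, mul_nonsing_inv _ hdet, one_mulVec, dotProduct_comm x c,
    dotProduct_comm (E⁻¹ *ᵥ c) c, mul_comm] at h
  exact h

/-- Factor `N = CᵀC` and apply Cauchy-Schwarz to each row of `C`. The trace is a measurable
substitute for the largest generalized eigenvalue, supplying the constant in `hN`. -/
theorem quadForm_le_trace_mul {ι : Type*} [Fintype ι] [DecidableEq ι] {E N : Matrix ι ι ℝ}
    (hE : E.PosDef) (hN : N.PosSemidef) (x : ι → ℝ) :
    x ⬝ᵥ (N *ᵥ x) ≤ (E⁻¹ * N).trace * (x ⬝ᵥ (E *ᵥ x)) := by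
  open scoped MatrixOrder in
  obtain ⟨C, hC⟩ := CStarAlgebra.nonneg_iff_eq_star_mul_self.mp hN.nonneg
  rw [star_eq_conjTranspose, conjTranspose_eq_transpose_of_trivial] at hC
  have h1 : x ⬝ᵥ (N *ᵥ x) = ∑ i, (C i ⬝ᵥ x) ^ 2 := by
    rw [hC, ← mulVec_mulVec, dotProduct_mulVec, vecMul_transpose]
    simp [dotProduct, mulVec, sq]
  have h2 : (E⁻¹ * N).trace = ∑ i, C i ⬝ᵥ (E⁻¹ *ᵥ C i) := by
    rw [hC, ← Matrix.mul_assoc, trace_mul_comm, ← Matrix.mul_assoc]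
    simp only [trace, diag_apply]
    refine Finset.sum_congr rfl fun i _ => ?_
    rw [mul_apply, dotProduct_mulVec]
    simp [dotProduct, mul_apply, vecMul]
  rw [h1, h2, Finset.sum_mul]
  exact Finset.sum_le_sum fun i _ => dotProduct_sq_le_of_posDef hE _ _

/-! ### Gram matrices of bordered families -/

/-- The Gram matrix of a finite family of vectors. -/
def gramMat {κ ι : Type*} [Fintype ι] (C : κ → ι → ℝ) : Matrix κ κ ℝ :=
  Matrix.of C * (Matrix.of C)ᵀ

section Gram

variable {κ ι : Type*} [Fintype κ] [Fintype ι]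

theorem gramMat_mulVec (C : κ → ι → ℝ) (x : κ → ℝ) :
    gramMat C *ᵥ x = Matrix.of C *ᵥ (x ᵥ* Matrix.of C) := by
  rw [gramMat, ← mulVec_mulVec, mulVec_transpose]

theorem dotProduct_gramMat_mulVec (C : κ → ι → ℝ) (x y : κ → ℝ) :
    x ⬝ᵥ (gramMat C *ᵥ y) = (x ᵥ* Matrix.of C) ⬝ᵥ (y ᵥ* Matrix.of C) := by
  rw [gramMat_mulVec, dotProduct_mulVec]

theorem posSemidef_gramMat (C : κ → ι → ℝ) : (gramMat C).PosSemidef := by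
  have := posSemidef_self_mul_conjTranspose (Matrix.of C)
  rwa [conjTranspose_eq_transpose_of_trivial] at this

variable [DecidableEq κ]

theorem posDef_gramMat_iff (C : κ → ι → ℝ) : (gramMat C).PosDef ↔ (gramMat C).det ≠ 0 :=
  (posSemidef_gramMat C).posDef_iff_det_ne_zero

theorem inv_mulVec_eq {E : Matrix κ κ ℝ} (hE : E.PosDef) {x b : κ → ℝ} (h : E *ᵥ x = b) :
    E⁻¹ *ᵥ b = x := by
  rw [← h, mulVec_mulVec, nonsing_inv_mul _ hE.det_pos.ne'.isUnit, one_mulVec]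

/-- Coefficients of the least squares regression of `y` on the family `Y`. -/
def regCoeff (Y : κ → ι → ℝ) (y : ι → ℝ) : κ → ℝ := (gramMat Y)⁻¹ *ᵥ (Matrix.of Y *ᵥ y)

/-- Residual sum of squares of the least squares regression of `y` on the family `Y`. -/
def residSq (Y : κ → ι → ℝ) (y : ι → ℝ) : ℝ :=
  y ⬝ᵥ y - (Matrix.of Y *ᵥ y) ⬝ᵥ regCoeff Y y

theorem gramMat_mulVec_regCoeff {Y : κ → ι → ℝ} (hY : (gramMat Y).PosDef) (y : ι → ℝ) :
    gramMat Y *ᵥ regCoeff Y y = Matrix.of Y *ᵥ y := by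
  rw [regCoeff, mulVec_mulVec, mul_nonsing_inv _ hY.det_pos.ne'.isUnit, one_mulVec]

end Gram

section Bordered

variable {p : ℕ} {ι : Type*} [Fintype ι] {Y : Fin p → ι → ℝ} {y : ι → ℝ}

theorem gramMat_cons_mulVec_cons (Y : Fin p → ι → ℝ) (y : ι → ℝ) (a : ℝ) (z : Fin p → ℝ) :
    gramMat (vecCons y Y) *ᵥ vecCons a z =
      vecCons (y ⬝ᵥ (a • y) + (Matrix.of Y *ᵥ y) ⬝ᵥ z)
        (a • (Matrix.of Y *ᵥ y) + gramMat Y *ᵥ z) := by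
  rw [gramMat_mulVec, cons_vecMul, cons_mulVec]
  congr 1
  · rw [dotProduct_add, dotProduct_comm y (z ᵥ* _), ← dotProduct_mulVec, dotProduct_comm z]
    rfl
  · rw [mulVec_add, mulVec_smul, gramMat_mulVec]
    rfl

/-- The coefficients `(1, -q)` produce the regression residual, which is orthogonal to `Y` and has
inner product `residSq Y y` with `y`. This is the first column of the inverse Gram matrix up to
scaling. -/
theorem gramMat_cons_mulVec_regCoeff (hY : (gramMat Y).PosDef) :
    gramMat (vecCons y Y) *ᵥ vecCons 1 (-regCoeff Y y) = residSq Y y • Pi.single 0 1 := by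
  rw [gramMat_cons_mulVec_cons, mulVec_neg, gramMat_mulVec_regCoeff hY, one_smul, one_smul,
    add_neg_cancel, dotProduct_neg, ← sub_eq_add_neg]
  ext i
  refine Fin.cases ?_ (fun i => ?_) i <;> simp [residSq]

/-- A kernel vector `(a, z)` must have `z = -a q`, and its first equation is then `a * residSq Y y =
0`. -/
theorem posDef_gramMat_cons (hY : (gramMat Y).PosDef) (hd : residSq Y y ≠ 0) :
    (gramMat (vecCons y Y)).PosDef := by
  rw [posDef_gramMat_iff]
  intro h0
  obtain ⟨x, hx0, hx⟩ := exists_mulVec_eq_zero_iff.2 h0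
  obtain ⟨a, z, rfl⟩ : ∃ a z, x = vecCons a z := ⟨x 0, vecTail x, (cons_head_tail x).symm⟩
  rw [gramMat_cons_mulVec_cons] at hx
  have h1 := congrFun hx 0
  have h2 : a • (Matrix.of Y *ᵥ y) + gramMat Y *ᵥ z = 0 := by
    ext i; exact congrFun hx i.succ
  simp only [cons_val_zero, Pi.zero_apply] at h1
  have hz : z = -(a • regCoeff Y y) := by
    have h3 : gramMat Y *ᵥ z = -(a • (Matrix.of Y *ᵥ y)) := by
      rw [eq_neg_iff_add_eq_zero, add_comm]; exact h2
    rw [← inv_mulVec_eq hY h3, mulVec_neg, mulVec_smul]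
    rfl
  have ha : a * residSq Y y = 0 := by
    rw [hz, dotProduct_neg, dotProduct_smul, dotProduct_smul] at h1
    rw [residSq, mul_sub]
    simpa [sub_eq_add_neg] using h1
  have ha0 : a = 0 := (mul_eq_zero.1 ha).resolve_right hd
  apply hx0
  rw [hz, ha0]
  ext i
  refine Fin.cases ?_ (fun i => ?_) i <;> simp

theorem inv_gramMat_cons_mulVec_single (hY : (gramMat Y).PosDef) (hd : residSq Y y ≠ 0) :
    (gramMat (vecCons y Y))⁻¹ *ᵥ Pi.single 0 1 =
      (residSq Y y)⁻¹ • vecCons 1 (-regCoeff Y y) := by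
  apply inv_mulVec_eq (posDef_gramMat_cons hY hd)
  rw [mulVec_smul, gramMat_cons_mulVec_regCoeff hY, smul_smul, inv_mul_cancel₀ hd, one_smul]

theorem inv_gramMat_cons_mulVec_cons_zero (hY : (gramMat Y).PosDef) (hd : residSq Y y ≠ 0)
    (β : Fin p → ℝ) :
    (gramMat (vecCons y Y))⁻¹ *ᵥ vecCons 0 β =
      vecCons 0 ((gramMat Y)⁻¹ *ᵥ β) -
        (regCoeff Y y ⬝ᵥ β / residSq Y y) • vecCons 1 (-regCoeff Y y) := by
  apply inv_mulVec_eq (posDef_gramMat_cons hY hd)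
  rw [mulVec_sub, mulVec_smul, gramMat_cons_mulVec_regCoeff hY, smul_smul, div_mul_cancel₀ _ hd,
    gramMat_cons_mulVec_cons, mulVec_mulVec, mul_nonsing_inv _ hY.det_pos.ne'.isUnit, one_mulVec,
    zero_smul, zero_smul, zero_add, dotProduct_zero, zero_add]
  have : (Matrix.of Y *ᵥ y) ⬝ᵥ ((gramMat Y)⁻¹ *ᵥ β) = regCoeff Y y ⬝ᵥ β := by
    rw [dotProduct_mulVec, regCoeff, ← mulVec_transpose, transpose_nonsing_inv,
      posSemidef_transpose_eq (posSemidef_gramMat Y)]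
  rw [this]
  ext i
  refine Fin.cases ?_ (fun i => ?_) i <;> simp

end Bordered

/-! ### The terms of the expansion in block coordinates -/

section Blocks

variable {p : ℕ} {ι ι' : Type*} [Fintype ι] [Fintype ι'] {Y : Fin p → ι → ℝ} {y : ι → ℝ}
  (X : Fin p → ι' → ℝ) (x : ι' → ℝ)

/-- The first basis vector. -/
abbrev e₀ (p : ℕ) : Fin (p + 1) → ℝ := Pi.single 0 1

theorem e₀_eq_cons : e₀ p = vecCons 1 0 := by
  ext i
  refine Fin.cases ?_ (fun i => ?_) i <;> simp

theorem gramMat_cons_mulVec_e₀ :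
    gramMat (vecCons x X) *ᵥ e₀ p = vecCons (x ⬝ᵥ x) (Matrix.of X *ᵥ x) := by
  rw [e₀_eq_cons, gramMat_cons_mulVec_cons, dotProduct_zero, mulVec_zero, one_smul, one_smul,
    add_zero, add_zero]

theorem signalSq_gramMat_cons : signalSq 1 (e₀ p) (gramMat (vecCons x X)) = x ⬝ᵥ x := by
  rw [signalSq, inv_one, one_mulVec, gramMat_cons_mulVec_e₀, e₀, single_one_dotProduct,
    cons_val_zero]

/-- The vector of normalized inner products of `x` with the family `X`. -/
def normCross : Fin p → ℝ := (√(x ⬝ᵥ x))⁻¹ • (Matrix.of X *ᵥ x)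

theorem crossVec_gramMat_cons :
    crossVec 1 (e₀ p) (gramMat (vecCons x X)) = vecCons 0 (normCross X x) := by
  rw [crossVec, signalSq_gramMat_cons, inv_one, one_mulVec, gramMat_cons_mulVec_e₀, e₀_eq_cons]
  ext i
  refine Fin.cases ?_ (fun i => ?_) i <;> simp [normCross]

theorem leadTerm_gramMat_cons (hY : (gramMat Y).PosDef) (hd : residSq Y y ≠ 0) :
    leadTerm 1 (e₀ p) (gramMat (vecCons x X)) (gramMat (vecCons y Y)) =
      (x ⬝ᵥ x) / residSq Y y := by
  rw [leadTerm, signalSq_gramMat_cons, inv_gramMat_cons_mulVec_single hY hd, e₀,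
    single_one_dotProduct]
  simp [div_eq_mul_inv]

theorem crossVec_dotProduct_inv (hY : (gramMat Y).PosDef) (hd : residSq Y y ≠ 0) :
    crossVec 1 (e₀ p) (gramMat (vecCons x X)) ⬝ᵥ ((gramMat (vecCons y Y))⁻¹ *ᵥ e₀ p) =
      -(normCross X x ⬝ᵥ regCoeff Y y) / residSq Y y := by
  rw [crossVec_gramMat_cons, inv_gramMat_cons_mulVec_single hY hd, dotProduct_smul,
    cons_dotProduct_cons]
  simp only [mul_one, zero_add, dotProduct_neg, smul_eq_mul]
  ring

theorem crossTerm_gramMat_cons (hY : (gramMat Y).PosDef) (hd : residSq Y y ≠ 0) :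
    crossTerm 1 (e₀ p) (gramMat (vecCons x X)) (gramMat (vecCons y Y)) =
      -(2 * √(x ⬝ᵥ x) * (normCross X x ⬝ᵥ regCoeff Y y) / residSq Y y) := by
  rw [crossTerm, signalSq_gramMat_cons, crossVec_dotProduct_inv X x hY hd]
  ring

/-- The subtracted square removes the component along `(1, -q)`, so `y` drops out altogether. Hence
the second `F` variate can be independent of the first. -/
theorem schurTerm_gramMat_cons (hY : (gramMat Y).PosDef) (hd : residSq Y y ≠ 0) :
    schurTerm 1 (e₀ p) (gramMat (vecCons x X)) (gramMat (vecCons y Y)) =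
      normCross X x ⬝ᵥ ((gramMat Y)⁻¹ *ᵥ normCross X x) := by
  rw [schurTerm, crossVec_dotProduct_inv X x hY hd, crossVec_gramMat_cons,
    inv_gramMat_cons_mulVec_cons_zero hY hd, inv_gramMat_cons_mulVec_single hY hd, e₀,
    single_one_dotProduct, dotProduct_sub, dotProduct_smul, cons_dotProduct_cons,
    cons_dotProduct_cons, dotProduct_neg, dotProduct_comm (normCross X x) (regCoeff Y y)]
  simp only [Pi.smul_apply, cons_val_zero, smul_eq_mul]
  field_simp
  ring

theorem complProj_cons (a : ℝ) (z : Fin p → ℝ) :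
    complProj 1 (e₀ p) (vecCons a z) = vecCons 0 z := by
  rw [complProj, inv_one, one_mulVec, e₀, single_one_dotProduct, ← e₀, e₀_eq_cons]
  ext i
  refine Fin.cases ?_ (fun i => ?_) i <;> simp

/-- The projection deletes the first coordinate, so `x`, and with it the signal, drops out. -/
theorem residualTerm_gramMat_cons (hY : (gramMat Y).PosDef) (hd : residSq Y y ≠ 0) :
    residualTerm 1 (e₀ p) (gramMat (vecCons x X)) (gramMat (vecCons y Y)) =
      ((regCoeff Y y ᵥ* Matrix.of X) ⬝ᵥ (regCoeff Y y ᵥ* Matrix.of X)) / residSq Y y := by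
  rw [residualTerm, inv_gramMat_cons_mulVec_single hY hd, smul_cons, complProj_cons,
    gramMat_cons_mulVec_cons, cons_dotProduct_cons, zero_mul, zero_add, zero_smul ℝ (_ : Fin p → ℝ), zero_add,
    dotProduct_gramMat_mulVec, e₀, single_one_dotProduct, cons_val_zero]
  simp only [smul_neg, neg_vecMul, smul_vecMul, dotProduct_neg, neg_dotProduct,
    smul_dotProduct, dotProduct_smul, smul_eq_mul, mul_one]
  field_simp

end Blocks

/-! ### Measurability of matrix operations -/

instance matrixBorelSpace (k l : ℕ) : BorelSpace (Matrix (Fin k) (Fin l) ℝ) :=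
  inferInstanceAs (BorelSpace (Fin k → Fin l → ℝ))

section Measurability

variable {α : Type*} [MeasurableSpace α] {k l n : ℕ}

@[fun_prop]
theorem measurable_dotProduct {ι : Type*} [Fintype ι] {f g : α → ι → ℝ} (hf : Measurable f)
    (hg : Measurable g) : Measurable fun a => f a ⬝ᵥ g a := by
  unfold dotProduct
  fun_prop

@[fun_prop]
theorem measurable_matrix_of {f : α → Fin k → Fin l → ℝ} (hf : Measurable f) :
    Measurable fun a => Matrix.of (f a) := hf

theorem measurable_matrix_row {f : α → Matrix (Fin k) (Fin l) ℝ} (hf : Measurable f) (i : Fin k) :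
    Measurable fun a => f a i := measurable_pi_iff.1 hf i

theorem measurable_matrix_entry {f : α → Matrix (Fin k) (Fin l) ℝ} (hf : Measurable f) (i : Fin k)
    (j : Fin l) : Measurable fun a => f a i j := measurable_pi_iff.1 (measurable_pi_iff.1 hf i) j

theorem measurable_matrix_iff {f : α → Matrix (Fin k) (Fin l) ℝ} :
    Measurable f ↔ ∀ i j, Measurable fun a => f a i j :=
  ⟨fun h i j => measurable_matrix_entry h i j,
    fun h => measurable_pi_iff.2 fun i => measurable_pi_iff.2 fun j => h i j⟩

@[fun_prop]
theorem measurable_mulVec {f : α → Matrix (Fin k) (Fin l) ℝ} {g : α → Fin l → ℝ}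
    (hf : Measurable f) (hg : Measurable g) : Measurable fun a => f a *ᵥ g a :=
  measurable_pi_iff.2 fun i => measurable_dotProduct (measurable_matrix_row hf i) hg

@[fun_prop]
theorem measurable_matrix_transpose {f : α → Matrix (Fin k) (Fin l) ℝ} (hf : Measurable f) :
    Measurable fun a => (f a)ᵀ :=
  measurable_matrix_iff.2 fun i j => measurable_matrix_entry hf j i

@[fun_prop]
theorem measurable_vecMul {f : α → Matrix (Fin k) (Fin l) ℝ} {g : α → Fin k → ℝ}
    (hf : Measurable f) (hg : Measurable g) : Measurable fun a => g a ᵥ* f a := by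
  simp only [← mulVec_transpose]
  fun_prop

@[fun_prop]
theorem measurable_matrix_mul {f : α → Matrix (Fin k) (Fin l) ℝ} {g : α → Matrix (Fin l) (Fin n) ℝ}
    (hf : Measurable f) (hg : Measurable g) : Measurable fun a => f a * g a := by
  refine measurable_matrix_iff.2 fun i j => ?_
  simp only [mul_apply]
  exact Finset.measurable_sum _ fun r _ =>
    (measurable_matrix_entry hf i r).mul (measurable_matrix_entry hg r j)

@[fun_prop]
theorem measurable_gramMat {f : α → Fin k → Fin n → ℝ} (hf : Measurable f) :
    Measurable fun a => gramMat (f a) := by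
  unfold gramMat
  fun_prop

@[fun_prop]
theorem measurable_matrix_det {f : α → Matrix (Fin k) (Fin k) ℝ} (hf : Measurable f) :
    Measurable fun a => (f a).det :=
  (continuous_id.matrix_det).measurable.comp hf

@[fun_prop]
theorem measurable_matrix_inv {f : α → Matrix (Fin k) (Fin k) ℝ} (hf : Measurable f) :
    Measurable fun a => (f a)⁻¹ := by
  have h : Measurable fun a => (f a).adjugate := (continuous_id.matrix_adjugate).measurable.comp hf
  have hd := measurable_matrix_det hf
  refine measurable_matrix_iff.2 fun i j => ?_
  simp only [inv_def, Ring.inverse_eq_inv', Matrix.smul_apply, smul_eq_mul]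
  exact hd.inv.mul (measurable_matrix_entry h i j)

@[fun_prop]
theorem measurable_matrix_trace {f : α → Matrix (Fin k) (Fin k) ℝ} (hf : Measurable f) :
    Measurable fun a => (f a).trace :=
  (continuous_id.matrix_trace).measurable.comp hf

@[fun_prop]
theorem measurable_regCoeff {f : α → Fin k → Fin n → ℝ} {g : α → Fin n → ℝ} (hf : Measurable f)
    (hg : Measurable g) : Measurable fun a => regCoeff (f a) (g a) := by
  unfold regCoeff
  fun_prop

@[fun_prop]
theorem measurable_residSq {f : α → Fin k → Fin n → ℝ} {g : α → Fin n → ℝ} (hf : Measurable f)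
    (hg : Measurable g) : Measurable fun a => residSq (f a) (g a) := by
  unfold residSq
  fun_prop

@[fun_prop]
theorem measurable_normCross {f : α → Fin k → Fin n → ℝ} {g : α → Fin n → ℝ} (hf : Measurable f)
    (hg : Measurable g) : Measurable fun a => normCross (f a) (g a) := by
  unfold normCross
  fun_prop

@[fun_prop]
theorem measurable_vecCons {β : Type*} [MeasurableSpace β] {f : α → β} {g : α → Fin k → β}
    (hf : Measurable f) (hg : Measurable g) : Measurable fun a => vecCons (f a) (g a) := by
  refine measurable_pi_iff.2 fun i => ?_
  refine Fin.cases ?_ (fun i => ?_) i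
  · simpa using hf
  · simpa using measurable_pi_iff.1 hg i

end Measurability

/-! ### Normal vectors with unit covariance -/

/-- The law of a vector of independent normal variables with unit variances and mean `θ`. -/
def normalVec {ι : Type*} [Fintype ι] (θ : ι → ℝ) : Measure (ι → ℝ) :=
  Measure.pi fun i => gaussianReal (θ i) 1

instance {ι : Type*} [Fintype ι] (θ : ι → ℝ) : IsProbabilityMeasure (normalVec θ) := by
  unfold normalVec; infer_instance

section NormalVec

variable {ι κ : Type*} [Fintype ι] [Fintype κ] [DecidableEq ι] [DecidableEq κ]

/-- Compare characteristic functions: the image has at `t` the value of the original at `Aᵀ t`. -/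
theorem map_mulVec_multivariateGaussian {S : Matrix ι ι ℝ} (hS : S.PosSemidef)
    {A : Matrix κ ι ℝ} (hA : A * S * Aᵀ = 1) (μ : EuclideanSpace ℝ ι) :
    (multivariateGaussian μ S).map (fun x => A *ᵥ x.ofLp) = normalVec (A *ᵥ μ.ofLp) := by
  have hmeas : Measurable fun x : EuclideanSpace ℝ ι => A *ᵥ x.ofLp :=
    measurable_pi_iff.2 fun i => measurable_dotProduct (by fun_prop) (by fun_prop)
  apply (MeasurableEquiv.toLp 2 (κ → ℝ)).map_measurableEquiv_injective
  have : IsProbabilityMeasure ((multivariateGaussian μ S).map (fun x => A *ᵥ x.ofLp)) :=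
    Measure.isProbabilityMeasure_map hmeas.aemeasurable
  have : IsProbabilityMeasure (((multivariateGaussian μ S).map (fun x => A *ᵥ x.ofLp)).map
      (MeasurableEquiv.toLp 2 (κ → ℝ))) :=
    Measure.isProbabilityMeasure_map (MeasurableEquiv.measurable _).aemeasurable
  have : IsProbabilityMeasure ((normalVec (A *ᵥ μ.ofLp)).map (MeasurableEquiv.toLp 2 (κ → ℝ))) :=
    Measure.isProbabilityMeasure_map (MeasurableEquiv.measurable _).aemeasurable
  apply Measure.ext_of_charFun
  ext t
  have hr : charFun ((normalVec (A *ᵥ μ.ofLp)).map (MeasurableEquiv.toLp 2 (κ → ℝ))) t =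
      Complex.exp ((t.ofLp ⬝ᵥ (A *ᵥ μ.ofLp) : ℝ) * Complex.I - (t.ofLp ⬝ᵥ t.ofLp : ℝ) / 2) := by
    rw [normalVec, MeasurableEquiv.coe_toLp, charFun_pi]
    simp_rw [charFun_gaussianReal, ← Complex.exp_sum, dotProduct]
    congr 1
    rw [Finset.sum_sub_distrib]
    push_cast
    rw [Finset.sum_mul, Finset.sum_div]
    congr 1
    refine Finset.sum_congr rfl fun i _ => ?_
    ring
  have hl : charFun (((multivariateGaussian μ S).map (fun x => A *ᵥ x.ofLp)).map
      (MeasurableEquiv.toLp 2 (κ → ℝ))) t =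
      charFun (multivariateGaussian μ S) (WithLp.toLp 2 (Aᵀ *ᵥ t.ofLp)) := by
    rw [Measure.map_map (MeasurableEquiv.measurable _) hmeas, charFun_apply, charFun_apply,
      integral_map ((MeasurableEquiv.measurable _).comp hmeas).aemeasurable (by fun_prop)]
    congr 1
    ext x
    congr 3
    rw [EuclideanSpace.inner_eq_star_dotProduct, EuclideanSpace.inner_eq_star_dotProduct]
    simp only [Function.comp_apply, MeasurableEquiv.coe_toLp, star_trivial]
    rw [dotProduct_mulVec, ← mulVec_transpose]
  rw [hl, hr, charFun_multivariateGaussian hS]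
  congr 1
  have h1 : inner ℝ (WithLp.toLp 2 (Aᵀ *ᵥ t.ofLp)) μ = t.ofLp ⬝ᵥ (A *ᵥ μ.ofLp) := by
    rw [EuclideanSpace.inner_eq_star_dotProduct, star_trivial, dotProduct_mulVec, ← mulVec_transpose,
      dotProduct_comm]
    rfl
  have h2 : (Aᵀ *ᵥ t.ofLp) ⬝ᵥ (S *ᵥ (Aᵀ *ᵥ t.ofLp)) = t.ofLp ⬝ᵥ t.ofLp := by
    rw [mulVec_transpose, ← dotProduct_mulVec, ← mulVec_transpose, mulVec_mulVec, mulVec_mulVec,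
      hA, one_mulVec]
  rw [h1]
  congr 2
  exact_mod_cast h2

theorem map_ofLp_multivariateGaussian_one (μ : EuclideanSpace ℝ ι) :
    (multivariateGaussian μ (1 : Matrix ι ι ℝ)).map (fun x => x.ofLp) = normalVec μ.ofLp := by
  have := map_mulVec_multivariateGaussian (PosSemidef.one) (A := (1 : Matrix ι ι ℝ)) (by simp) μ
  simpa using this

theorem map_mulVec_normalVec {A : Matrix κ ι ℝ} (hA : A * Aᵀ = 1) (θ : ι → ℝ) :
    (normalVec θ).map (fun x => A *ᵥ x) = normalVec (A *ᵥ θ) := by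
  have hmeas : Measurable fun x : ι → ℝ => A *ᵥ x :=
    measurable_pi_iff.2 fun i => measurable_dotProduct (by fun_prop) (by fun_prop)
  have h := map_ofLp_multivariateGaussian_one (WithLp.toLp 2 θ)
  simp only at h
  rw [← h, Measure.map_map hmeas (by fun_prop)]
  exact map_mulVec_multivariateGaussian PosSemidef.one (by rw [Matrix.mul_one, hA])
    (WithLp.toLp 2 θ)

theorem map_neg_normalVec_zero :
    (normalVec (0 : ι → ℝ)).map (fun x => -x) = normalVec 0 := by
  have := map_mulVec_normalVec (A := (-1 : Matrix ι ι ℝ)) (by simp) 0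
  simpa [neg_mulVec] using this

omit [DecidableEq ι] in
theorem map_dotProduct_normalVec_zero {u : ι → ℝ} (hu : u ⬝ᵥ u = 1) :
    (normalVec (0 : ι → ℝ)).map (fun x => u ⬝ᵥ x) = gaussianReal 0 1 := by
  classical
  have h := map_mulVec_normalVec (A := (Matrix.of fun _ : Unit => u)) 
    (by ext; simpa [mul_apply, dotProduct] using hu) 0
  have h2 : (normalVec ((Matrix.of fun _ : Unit => u) *ᵥ (0 : ι → ℝ))).map (fun x => x ()) =
      gaussianReal 0 1 := by
    rw [mulVec_zero]
    exact (measurePreserving_eval (fun _ : Unit => gaussianReal 0 1) ()).map_eq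
  have hm : Measurable fun x : ι → ℝ => (Matrix.of fun _ : Unit => u) *ᵥ x :=
    measurable_pi_iff.2 fun i => measurable_dotProduct (by fun_prop) (by fun_prop)
  rw [← h2, ← h, Measure.map_map (by fun_prop) hm]
  rfl

theorem lintegral_sq_gaussianReal :
    ∫⁻ x, ENNReal.ofReal (x ^ 2) ∂(gaussianReal 0 1) = 1 := by
  have h1 : Integrable (fun x : ℝ => x ^ 2) (gaussianReal 0 1) :=
    (memLp_id_gaussianReal' 2 (by simp)).integrable_sq
  rw [← ofReal_integral_eq_lintegral_ofReal h1 (ae_of_all _ fun x => sq_nonneg x)]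
  have h2 := variance_fun_id_gaussianReal (μ := 0) (v := 1)
  rw [variance_of_integral_eq_zero (by fun_prop) (by simp)] at h2
  rw [h2]
  simp

omit [DecidableEq ι] in
theorem lintegral_dotProduct_sq (c : ι → ℝ) :
    ∫⁻ x, ENNReal.ofReal ((c ⬝ᵥ x) ^ 2) ∂(normalVec 0) = ENNReal.ofReal (c ⬝ᵥ c) := by
  rcases eq_or_ne c 0 with rfl | hc
  · simp
  have hpos : 0 < c ⬝ᵥ c := by
    have := dotProduct_star_self_pos_iff.2 hc
    simpa using this
  set r := √(c ⬝ᵥ c) with hr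
  have hr0 : 0 < r := Real.sqrt_pos.2 hpos
  have hrr : r ^ 2 = c ⬝ᵥ c := Real.sq_sqrt hpos.le
  have hu : (r⁻¹ • c) ⬝ᵥ (r⁻¹ • c) = 1 := by
    rw [smul_dotProduct, dotProduct_smul, ← hrr]
    simp only [smul_eq_mul]
    field_simp
  have h (x : ι → ℝ) : (c ⬝ᵥ x) ^ 2 = r ^ 2 * ((r⁻¹ • c) ⬝ᵥ x) ^ 2 := by
    rw [smul_dotProduct, smul_eq_mul]
    field_simp
  simp_rw [h, ENNReal.ofReal_mul (sq_nonneg r)]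
  rw [lintegral_const_mul _ (by fun_prop)]
  have h3 : ∫⁻ x, ENNReal.ofReal (((r⁻¹ • c) ⬝ᵥ x) ^ 2) ∂(normalVec (0 : ι → ℝ)) =
      ∫⁻ z, ENNReal.ofReal (z ^ 2) ∂((normalVec (0 : ι → ℝ)).map fun x => (r⁻¹ • c) ⬝ᵥ x) :=
    (lintegral_map (f := fun z : ℝ => ENNReal.ofReal (z ^ 2)) (by fun_prop) (by fun_prop)).symm
  rw [h3, map_dotProduct_normalVec_zero hu, lintegral_sq_gaussianReal, mul_one, hrr]

end NormalVec

/-! ### Chi-square laws -/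

section ChiSq

/-- Rotation invariance: the mean can be turned onto the first axis, as in the definition of
`noncentralChiSq`. Dimension zero has no first axis and a zero mean has no direction, so both are
treated apart. -/
theorem map_dotProduct_self_normalVec {n : ℕ} (θ : Fin n → ℝ) :
    (normalVec θ).map (fun x => x ⬝ᵥ x) = noncentralChiSq n (θ ⬝ᵥ θ) := by
  set ω := θ ⬝ᵥ θ with hω
  have hdef : noncentralChiSq n ω =
      (normalVec (fun i : Fin n => if (i : ℕ) = 0 then √ω else 0)).map (fun x => x ⬝ᵥ x) := by
    rw [noncentralChiSq, normalVec]
    congr 1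
    ext x
    simp [dotProduct, sq]
  rw [hdef]
  rcases n with _ | p
  · congr 2
    ext i; exact i.elim0
  rcases eq_or_ne θ 0 with rfl | hθ
  · congr 2
    ext i
    simp [hω]
  have hpos : 0 < ω := by
    have := dotProduct_star_self_pos_iff.2 hθ
    simpa using this
  have hr0 : 0 < √ω := Real.sqrt_pos.2 hpos
  have hrr : √ω ^ 2 = ω := Real.sq_sqrt hpos.le
  have hu : ((√ω)⁻¹ • θ) ⬝ᵥ ((√ω)⁻¹ • θ) = 1 := by
    rw [smul_dotProduct, dotProduct_smul, ← hω]
    nth_rewrite 3 [← hrr]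
    simp only [smul_eq_mul]
    field_simp
  obtain ⟨O, hO, hOu⟩ := exists_orthogonal_mulVec_eq_single hu
  have hOθ : O *ᵥ θ = fun i : Fin (p + 1) => if (i : ℕ) = 0 then √ω else 0 := by
    have : θ = √ω • ((√ω)⁻¹ • θ) := by rw [smul_smul, mul_inv_cancel₀ hr0.ne', one_smul]
    rw [this, mulVec_smul, hOu]
    ext i
    refine Fin.cases ?_ (fun i => ?_) i <;> simp
  rw [← hOθ, ← map_mulVec_normalVec hO, Measure.map_map (by fun_prop) (by fun_prop)]
  congr 1
  ext x
  rw [Function.comp_apply, dotProduct_mulVec, vecMul_mulVec, mul_eq_one_comm.1 hO]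
  simp

theorem map_dotProduct_self_normalVec_zero (n : ℕ) :
    (normalVec (0 : Fin n → ℝ)).map (fun x => x ⬝ᵥ x) = noncentralChiSq n 0 := by
  rw [map_dotProduct_self_normalVec, dotProduct_zero]

instance (n : ℕ) (ω : ℝ) : IsProbabilityMeasure (noncentralChiSq n ω) := by
  unfold noncentralChiSq
  exact Measure.isProbabilityMeasure_map (Measurable.aemeasurable (by fun_prop))

instance (a b : ℕ) (ω : ℝ) : IsProbabilityMeasure (noncentralF a b ω) := by
  unfold noncentralF
  exact Measure.isProbabilityMeasure_map (by fun_prop)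

/-- By Fubini over the first coordinate: for fixed other coordinates a level set has at most two
points. -/
theorem noncentralChiSq_singleton {n : ℕ} (hn : n ≠ 0) (c : ℝ) :
    noncentralChiSq n 0 {c} = 0 := by
  obtain ⟨p, rfl⟩ := Nat.exists_eq_succ_of_ne_zero hn
  rw [← map_dotProduct_self_normalVec_zero, Measure.map_apply (by fun_prop) (measurableSet_singleton c)]
  have hmp := (measurePreserving_piFinSuccAbove (fun _ : Fin (p + 1) => gaussianReal 0 1) 0).symm
  have hs : MeasurableSet ((fun x : Fin (p + 1) → ℝ => x ⬝ᵥ x) ⁻¹' {c}) :=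
    (measurable_dotProduct measurable_id measurable_id) (measurableSet_singleton c)
  change (Measure.pi fun _ : Fin (p + 1) => gaussianReal 0 1) _ = 0
  rw [← hmp.measure_preimage hs.nullMeasurableSet, Measure.prod_apply_symm (hmp.measurable hs)]
  refine lintegral_eq_zero_of_ae_eq_zero (ae_of_all _ fun z => ?_)
  have := nullSingletonClass_gaussianReal (μ := 0) (v := 1) one_ne_zero
  apply Set.Finite.measure_zero
  refine (Set.toFinite {√(c - z ⬝ᵥ z), -√(c - z ⬝ᵥ z)}).subset fun t ht => ?_
  have ht' : t * t + z ⬝ᵥ z = c := by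
    have h1 : ((MeasurableEquiv.piFinSuccAbove (fun _ : Fin (p + 1) => ℝ) 0).symm (t, z)) ⬝ᵥ
      ((MeasurableEquiv.piFinSuccAbove (fun _ : Fin (p + 1) => ℝ) 0).symm (t, z)) = c := ht
    rw [← h1]
    simp [dotProduct, Fin.sum_univ_succ]
  have h2 : √(c - z ⬝ᵥ z) = |t| := by
    rw [← ht', add_sub_cancel_right, Real.sqrt_mul_self_eq_abs]
  rw [h2]
  rcases abs_choice t with h | h <;> simp [h]

end ChiSq

/-! ### Tightness and concentration -/

theorem exists_measure_Ioi_le (μ : Measure ℝ) [IsProbabilityMeasure μ] {η : ℝ} (hη : 0 < η) :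
    ∃ K, ∀ K' ≥ K, μ (Set.Ioi K') ≤ ENNReal.ofReal η := by
  have h := tendsto_measure_Iic_atTop μ
  rw [measure_univ] at h
  have h2 : Tendsto (fun x => 1 - μ (Set.Iic x)) atTop (𝓝 (1 - 1)) :=
    ENNReal.Tendsto.sub tendsto_const_nhds h (.inl ENNReal.one_ne_top)
  rw [tsub_self] at h2
  have h3 := h2.eventually_lt_const (ENNReal.ofReal_pos.2 hη)
  obtain ⟨K, hK⟩ := eventually_atTop.1 h3
  refine ⟨K, fun K' hK' => ?_⟩
  rw [← Set.compl_Iic, prob_compl_eq_one_sub measurableSet_Iic]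
  exact (hK K' hK').le

/-- Tightness handles intervals centred far away; on the remaining compact set, absence of atoms
gives small intervals and a Lebesgue number makes their length uniform. -/
theorem exists_concentration_le (μ : Measure ℝ) [IsProbabilityMeasure μ] (hμ : ∀ c, μ {c} = 0)
    {η : ℝ} (hη : 0 < η) :
    ∃ δ > 0, ∀ s, μ (Set.Icc (s - δ) (s + δ)) ≤ ENNReal.ofReal η := by
  obtain ⟨K₁, hK₁⟩ := exists_measure_Ioi_le μ hη
  have : IsProbabilityMeasure (μ.map fun x => -x) :=
    Measure.isProbabilityMeasure_map (by fun_prop)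
  obtain ⟨K₂, hK₂⟩ := exists_measure_Ioi_le (μ.map fun x => -x) hη
  have hloc (x : ℝ) : ∃ r > 0, μ (Set.Icc (x - r) (x + r)) ≤ ENNReal.ofReal η := by
    have h := tendsto_measure_Icc_nhdsWithin_right' μ x
    rw [hμ x] at h
    have h3 := (h.eventually_lt_const (ENNReal.ofReal_pos.2 hη)).and self_mem_nhdsWithin
    obtain ⟨r, hr, hr0⟩ := h3.exists
    exact ⟨r, hr0, hr.le⟩
  choose r hr0 hr using hloc
  obtain ⟨δ, hδ, hcov⟩ := lebesgue_number_lemma_of_metric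
    (isCompact_Icc (a := -K₂ - 1) (b := K₁ + 1)) (c := fun x : ℝ => Metric.ball x (r x))
    (fun _ => Metric.isOpen_ball)
    (fun x _ => Set.mem_iUnion.2 ⟨x, Metric.mem_ball_self (hr0 x)⟩)
  -- `δ / 2` puts the closed interval inside an open `δ`-ball; `1 / 2` keeps intervals centred
  -- outside the enlarged compact set within one of the tails.
  refine ⟨min (δ / 2) (1 / 2), by positivity, fun s => ?_⟩
  have hm1 := min_le_left (δ / 2) (1 / 2)
  have hm2 := min_le_right (δ / 2) (1 / 2)
  by_cases hs : s ∈ Set.Icc (-K₂ - 1) (K₁ + 1)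
  · obtain ⟨x, hx⟩ := hcov s hs
    refine (measure_mono fun y hy => ?_).trans (hr x)
    have : y ∈ Metric.ball x (r x) := by
      apply hx
      rw [Real.ball_eq_Ioo]
      exact ⟨by linarith [hy.1], by linarith [hy.2]⟩
    rw [Real.ball_eq_Ioo] at this
    exact ⟨this.1.le, this.2.le⟩
  · rw [Set.mem_Icc, not_and_or, not_le, not_le] at hs
    rcases hs with hs | hs
    · refine le_trans ?_ (hK₂ K₂ le_rfl)
      rw [Measure.map_apply (by fun_prop) measurableSet_Ioi]
      refine measure_mono fun y hy => ?_
      simp only [Set.mem_preimage, Set.mem_Ioi]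
      linarith [hy.2]
    · refine (measure_mono fun y hy => ?_).trans (hK₁ K₁ le_rfl)
      simp only [Set.mem_Ioi]
      linarith [hy.1]

theorem map_add_normalVec_zero {ι : Type*} [Fintype ι] (θ : ι → ℝ) :
    (normalVec 0).map (fun z => z + θ) = normalVec θ := by
  unfold normalVec
  have h (i : ι) : (gaussianReal ((0 : ι → ℝ) i) 1).map (fun x => x + θ i) =
      gaussianReal (θ i) 1 := by
    rw [gaussianReal_map_add_const, Pi.zero_apply, zero_add]
  simp_rw [← h]
  have (i : ι) : SigmaFinite ((gaussianReal ((0 : ι → ℝ) i) 1).map (fun x => x + θ i)) := by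
    rw [h]; infer_instance
  exact Measure.pi_map_pi (f := fun i x => x + θ i) (fun i => by fun_prop)

/-- If the noise satisfies `|z|² ≤ ω/4`, the triangle inequality puts `|z + θ|` between `√ω/2` and
`3√ω/2`. -/
theorem noncentralChiSq_compl_Icc_le {n : ℕ} (hn : n ≠ 0) {ω : ℝ} (hω : 0 ≤ ω) :
    noncentralChiSq n ω (Set.Icc (ω / 4) (4 * ω))ᶜ ≤ noncentralChiSq n 0 (Set.Ioi (ω / 4)) := by
  obtain ⟨p, rfl⟩ := Nat.exists_eq_succ_of_ne_zero hn
  set θ : Fin (p + 1) → ℝ := Pi.single 0 (√ω) with hθ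
  have hθω : θ ⬝ᵥ θ = ω := by
    rw [hθ, single_dotProduct, Pi.single_eq_same, Real.mul_self_sqrt hω]
  nth_rewrite 1 [← hθω]
  rw [← map_dotProduct_self_normalVec, ← map_dotProduct_self_normalVec_zero,
    ← map_add_normalVec_zero θ, Measure.map_map (by fun_prop) (by fun_prop),
    Measure.map_apply (by fun_prop) measurableSet_Icc.compl,
    Measure.map_apply (by fun_prop) measurableSet_Ioi]
  refine measure_mono fun z hz => ?_
  by_contra hcon
  apply hz
  simp only [Set.mem_preimage, Set.mem_Ioi, not_lt] at hcon
  simp only [Function.comp_apply, Set.mem_Icc]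
  have h1 : (z + θ) ⬝ᵥ (z + θ) = z ⬝ᵥ z + 2 * √ω * z 0 + ω := by
    rw [add_dotProduct, dotProduct_add, dotProduct_add, hθω, dotProduct_comm θ z, hθ,
      dotProduct_single]
    ring
  have h2 : z 0 ^ 2 ≤ z ⬝ᵥ z := by
    rw [sq]
    exact Finset.single_le_sum (f := fun i => z i * z i) (fun i _ => mul_self_nonneg _)
      (Finset.mem_univ 0)
  have h3 : |z 0| ≤ √ω / 2 := by
    apply abs_le_of_sq_le_sq _ (by positivity)
    rw [div_pow, Real.sq_sqrt hω]
    linarith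
  have h4 := Real.sq_sqrt hω
  have h5 := Real.sqrt_nonneg ω
  rw [abs_le] at h3
  rw [h1]
  constructor
  · nlinarith [sq_nonneg (z 0)]
  · nlinarith

theorem tendsto_noncentralChiSq_compl_Icc {n : ℕ} (hn : n ≠ 0) {η : ℝ} (hη : 0 < η) :
    ∀ᶠ ω in atTop, noncentralChiSq n ω (Set.Icc (ω / 4) (4 * ω))ᶜ ≤ ENNReal.ofReal η := by
  obtain ⟨K, hK⟩ := exists_measure_Ioi_le (noncentralChiSq n 0) hη
  filter_upwards [eventually_ge_atTop 0, eventually_ge_atTop (4 * K)] with ω h1 h2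
  exact (noncentralChiSq_compl_Icc_le hn h1).trans (hK _ (by linarith))

/-! ### The first inverse moment of a chi-square variable -/

theorem lintegral_dotProduct_self_normalVec (n : ℕ) :
    ∫⁻ x, ENNReal.ofReal (x ⬝ᵥ x) ∂(normalVec (0 : Fin n → ℝ)) = n := by
  have h (x : Fin n → ℝ) : ENNReal.ofReal (x ⬝ᵥ x) =
      ∑ i, ENNReal.ofReal ((Pi.single i 1 ⬝ᵥ x) ^ 2) := by
    rw [dotProduct, ENNReal.ofReal_sum_of_nonneg fun i _ => mul_self_nonneg _]
    simp [sq]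
  simp_rw [h]
  rw [lintegral_finsetSum _ fun i _ => by fun_prop]
  simp_rw [lintegral_dotProduct_sq]
  simp

theorem integral_exp_neg_sq_gaussianReal {u : ℝ} (hu : 0 < u) :
    ∫ x, Real.exp (-((u - 1) / 2) * x ^ 2) ∂(gaussianReal 0 1) = u ^ (-(1 / 2) : ℝ) := by
  rw [integral_gaussianReal_eq_integral_smul one_ne_zero]
  have h (x : ℝ) : gaussianPDFReal 0 1 x • Real.exp (-((u - 1) / 2) * x ^ 2) =
      (√(2 * Real.pi))⁻¹ * Real.exp (-(u / 2) * x ^ 2) := by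
    rw [gaussianPDFReal, smul_eq_mul, mul_assoc, ← Real.exp_add]
    simp only [NNReal.coe_one, mul_one, sub_zero]
    congr 2
    ring
  simp_rw [h]
  rw [integral_const_mul, integral_gaussian, ← Real.sqrt_inv, ← Real.sqrt_mul (by positivity),
    Real.rpow_neg hu.le, ← Real.sqrt_eq_rpow, ← Real.sqrt_inv]
  congr 1
  have := Real.pi_pos
  field_simp

theorem lintegral_exp_neg_normalVec (n : ℕ) {u : ℝ} (hu : 1 < u) :
    ∫⁻ x, ENNReal.ofReal (Real.exp (-((u - 1) / 2) * (x ⬝ᵥ x))) ∂(normalVec (0 : Fin n → ℝ)) =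
      ENNReal.ofReal (u ^ (-(n / 2) : ℝ)) := by
  have hu0 : 0 < u := by linarith
  have hint : Integrable (fun x : Fin n → ℝ => Real.exp (-((u - 1) / 2) * (x ⬝ᵥ x)))
      (normalVec 0) := by
    refine Integrable.of_bound (Measurable.aestronglyMeasurable (by fun_prop)) 1
      (ae_of_all _ fun x => ?_)
    rw [Real.norm_eq_abs, Real.abs_exp, Real.exp_le_one_iff]
    have := dotProduct_self_nonneg' x
    nlinarith
  rw [← ofReal_integral_eq_lintegral_ofReal hint (ae_of_all _ fun x => (Real.exp_pos _).le)]
  congr 1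
  have h (x : Fin n → ℝ) : Real.exp (-((u - 1) / 2) * (x ⬝ᵥ x)) =
      ∏ i, Real.exp (-((u - 1) / 2) * x i ^ 2) := by
    rw [← Real.exp_sum, dotProduct, Finset.mul_sum]
    simp [sq]
  simp_rw [h]
  have := integral_fintype_prod_eq_pow (𝕜 := ℝ) (ι := Fin n) (μ := gaussianReal 0 1)
    (fun x => Real.exp (-((u - 1) / 2) * x ^ 2))
  refine this.trans ?_
  rw [integral_exp_neg_sq_gaussianReal hu0, Fintype.card_fin, ← Real.rpow_natCast,
    ← Real.rpow_mul hu0.le]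
  congr 1
  ring

/-- Writes `1/q` as a mixture of exponentials, parametrized so that the chi-square Laplace transform
is the pure power `u ^ (-k/2)`. -/
theorem lintegral_exp_neg_Ioi_one {q : ℝ} (hq : 0 < q) :
    ∫⁻ u in Set.Ioi (1 : ℝ), ENNReal.ofReal (2⁻¹ * Real.exp (-((u - 1) / 2) * q)) =
      ENNReal.ofReal q⁻¹ := by
  have hd (u : ℝ) (_ : u ∈ Set.Ici (1 : ℝ)) :
      HasDerivAt (fun u => -q⁻¹ * Real.exp (-((u - 1) / 2) * q))
        (2⁻¹ * Real.exp (-((u - 1) / 2) * q)) u := by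
    have h1 : HasDerivAt (fun u : ℝ => -((u - 1) / 2) * q) (-(1 / 2) * q) u :=
      ((((hasDerivAt_id u).sub_const 1).div_const 2).neg).mul_const q
    refine (h1.exp.const_mul (-q⁻¹)).congr_deriv ?_
    field_simp
  have hpos (u : ℝ) : 0 ≤ 2⁻¹ * Real.exp (-((u - 1) / 2) * q) := by positivity
  have hlim : Tendsto (fun u => -q⁻¹ * Real.exp (-((u - 1) / 2) * q)) atTop (𝓝 0) := by
    rw [show (0 : ℝ) = -q⁻¹ * 0 by ring]
    refine Tendsto.const_mul _ (Real.tendsto_exp_atBot.comp ?_)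
    have h1 : Tendsto (fun u : ℝ => u - 1) atTop atTop := tendsto_atTop_add_const_right _ _ tendsto_id
    have h2 := h1.const_mul_atTop_of_neg (r := -(q / 2)) (by linarith)
    refine h2.congr fun u => ?_
    ring
  have hint := integrableOn_Ioi_deriv_of_nonneg' hd (fun u _ => hpos u) hlim
  have hval := integral_Ioi_of_hasDerivAt_of_nonneg' hd (fun u _ => hpos u) hlim
  rw [← ofReal_integral_eq_lintegral_ofReal hint (ae_of_all _ hpos), hval]
  simp

/-- Tonelli reduces the inverse moment to `2⁻¹ ∫ u ^ (-k/2)` over `(1, ∞)`, which converges because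
`k ≥ 3`. -/
theorem lintegral_inv_noncentralChiSq {k : ℕ} (hk : 3 ≤ k) :
    ∫⁻ q, ENNReal.ofReal q⁻¹ ∂(noncentralChiSq k 0) = ENNReal.ofReal ((k : ℝ) - 2)⁻¹ := by
  have hk' : (3 : ℝ) ≤ k := by exact_mod_cast hk
  have hk0 : k ≠ 0 := by omega
  rw [← map_dotProduct_self_normalVec_zero, lintegral_map (by fun_prop) (by fun_prop)]
  -- At zero the integral representation breaks down: `0⁻¹ = 0` while the integral diverges.
  have hae : ∀ᵐ x ∂(normalVec (0 : Fin k → ℝ)), x ⬝ᵥ x ≠ 0 := by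
    have h := noncentralChiSq_singleton hk0 0
    rw [← map_dotProduct_self_normalVec_zero,
      Measure.map_apply (by fun_prop) (measurableSet_singleton 0)] at h
    exact measure_eq_zero_iff_ae_notMem.1 h
  have h1 : ∫⁻ x, ENNReal.ofReal (x ⬝ᵥ x)⁻¹ ∂(normalVec (0 : Fin k → ℝ)) =
      ∫⁻ x, (∫⁻ u in Set.Ioi (1 : ℝ), ENNReal.ofReal (2⁻¹ * Real.exp (-((u - 1) / 2) * (x ⬝ᵥ x))))
        ∂(normalVec (0 : Fin k → ℝ)) := by
    refine lintegral_congr_ae (hae.mono fun x hx => ?_)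
    exact (lintegral_exp_neg_Ioi_one ((dotProduct_self_nonneg' x).lt_of_ne' hx)).symm
  rw [h1, lintegral_lintegral_swap (Measurable.aemeasurable (by fun_prop))]
  have h2 : ∫⁻ u in Set.Ioi (1 : ℝ), ∫⁻ x,
      ENNReal.ofReal (2⁻¹ * Real.exp (-((u - 1) / 2) * (x ⬝ᵥ x))) ∂(normalVec (0 : Fin k → ℝ)) =
      ∫⁻ u in Set.Ioi (1 : ℝ), ENNReal.ofReal (2⁻¹ * u ^ (-(k / 2) : ℝ)) := by
    refine setLIntegral_congr_fun measurableSet_Ioi fun u hu => ?_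
    simp_rw [ENNReal.ofReal_mul (show (0 : ℝ) ≤ 2⁻¹ by norm_num)]
    rw [lintegral_const_mul _ (by fun_prop), lintegral_exp_neg_normalVec k hu]
  have hlt : (-(k / 2) : ℝ) < -1 := by linarith
  have hint := (integrableOn_Ioi_rpow_of_lt hlt one_pos).const_mul (2⁻¹ : ℝ)
  rw [h2, ← ofReal_integral_eq_lintegral_ofReal hint
    ((ae_restrict_mem measurableSet_Ioi).mono fun u hu => by
      have : (0 : ℝ) < u := one_pos.trans hu
      simp only [Pi.zero_apply]
      positivity), integral_const_mul, integral_Ioi_rpow_of_lt hlt one_pos]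
  congr 1
  rw [Real.one_rpow]
  have : (k : ℝ) - 2 ≠ 0 := by linarith
  have h3 : (-(k / 2) : ℝ) + 1 = -(k - 2) / 2 := by ring
  rw [h3]
  field_simp

/-! ### Regression of a normal vector on a fixed family -/

section Regression

variable {p n k : ℕ}

/-- Whitening the Gram matrix makes the rows of `B Y` orthonormal; complete them to an orthogonal
`A`. The first `p` coordinates of `A y` determine the coefficients, the last `k` the residual sum of
squares, and these blocks are independent. `Bᵀ B` is the conditional covariance of the coefficients.
-/
theorem exists_map_regression (hn : n = p + k) {Y : Fin p → Fin n → ℝ} (hY : (gramMat Y).PosDef) :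
    ∃ B : Matrix (Fin p) (Fin p) ℝ, Bᵀ * B = (gramMat Y)⁻¹ ∧
      (normalVec (0 : Fin n → ℝ)).map (fun y => (regCoeff Y y, residSq Y y)) =
        ((normalVec (0 : Fin p → ℝ)).map (fun g => Bᵀ *ᵥ g)).prod (noncentralChiSq k 0) := by
  obtain ⟨B, hB⟩ := exists_whitening hY
  have hBinv := inv_eq_of_whitening hB
  refine ⟨B, hBinv.symm, ?_⟩
  have hA1 : (B * Matrix.of Y) * (B * Matrix.of Y)ᵀ = 1 := by
    rw [transpose_mul, Matrix.mul_assoc, ← Matrix.mul_assoc (Matrix.of Y), ← Matrix.mul_assoc]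
    exact hB
  obtain ⟨A, hA, hAl⟩ := exists_orthogonal_extension (κ := Fin p ⊕ Fin k) (ι := Fin n)
    (by simp [hn]) (Matrix.of (Sum.elim (B * Matrix.of Y) 0)) (Set.range Sum.inl) (by
      rintro _ ⟨i, rfl⟩ _ ⟨j, rfl⟩
      have h := congrFun (congrFun hA1 i) j
      rw [one_apply] at h ⊢
      simp only [Sum.inl.injEq]
      exact h)
  have hAA : Aᵀ * A = 1 := (mul_eq_one_comm_of_card_eq _ _ _ (by simp [hn])).1 hA
  have hg (y : Fin n → ℝ) : (fun i => (A *ᵥ y) (Sum.inl i)) = B *ᵥ (Matrix.of Y *ᵥ y) := by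
    ext i
    rw [mulVec_mulVec, mulVec, hAl _ ⟨i, rfl⟩]
    rfl
  have hq (y : Fin n → ℝ) : regCoeff Y y = Bᵀ *ᵥ fun i => (A *ᵥ y) (Sum.inl i) := by
    rw [hg, regCoeff, hBinv, ← mulVec_mulVec]
  have hd (y : Fin n → ℝ) : residSq Y y =
      (fun i => (A *ᵥ y) (Sum.inr i)) ⬝ᵥ (fun i => (A *ᵥ y) (Sum.inr i)) := by
    have h1 : (A *ᵥ y) ⬝ᵥ (A *ᵥ y) = y ⬝ᵥ y := by
      rw [dotProduct_mulVec, vecMul_mulVec, hAA, vecMul_one]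
    have h2 : (A *ᵥ y) ⬝ᵥ (A *ᵥ y) =
        (fun i => (A *ᵥ y) (Sum.inl i)) ⬝ᵥ (fun i => (A *ᵥ y) (Sum.inl i)) +
        (fun i => (A *ᵥ y) (Sum.inr i)) ⬝ᵥ (fun i => (A *ᵥ y) (Sum.inr i)) := by
      simp only [dotProduct, Fintype.sum_sum_type]
    rw [residSq, hq, ← h1, h2, dotProduct_mulVec, vecMul_transpose, ← hg]
    ring
  have hmA := map_mulVec_normalVec hA 0
  rw [mulVec_zero] at hmA
  have hmp := (measurePreserving_sumPiEquivProdPi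
    (fun _ : Fin p ⊕ Fin k => gaussianReal 0 1)).map_eq
  have hAmeas : Measurable fun y : Fin n → ℝ => A *ᵥ y :=
    measurable_pi_iff.2 fun i => measurable_dotProduct (by fun_prop) (by fun_prop)
  have hcomp : (fun y => (regCoeff Y y, residSq Y y)) =
      (Prod.map (fun g => Bᵀ *ᵥ g) (fun z : Fin k → ℝ => z ⬝ᵥ z)) ∘
        (MeasurableEquiv.sumPiEquivProdPi fun _ : Fin p ⊕ Fin k => ℝ) ∘ (fun y => A *ᵥ y) := by
    ext1 y
    rw [hq, hd]
    rfl
  have hm1 : Measurable fun g : Fin p → ℝ => Bᵀ *ᵥ g := by fun_prop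
  have hm2 : Measurable fun z : Fin k → ℝ => z ⬝ᵥ z := by fun_prop
  rw [hcomp, ← Measure.map_map (hm1.prodMap hm2) ((MeasurableEquiv.measurable _).comp hAmeas),
    ← Measure.map_map (MeasurableEquiv.measurable _) hAmeas, hmA,
    ← map_dotProduct_self_normalVec_zero, Measure.map_prod_map _ _ hm1 hm2]
  congr 1

theorem map_residSq (hn : n = p + k) {Y : Fin p → Fin n → ℝ} (hY : (gramMat Y).PosDef) :
    (normalVec (0 : Fin n → ℝ)).map (fun y => residSq Y y) = noncentralChiSq k 0 := by
  obtain ⟨B, -, h⟩ := exists_map_regression hn hY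
  have : IsProbabilityMeasure ((normalVec (0 : Fin p → ℝ)).map (fun g => Bᵀ *ᵥ g)) :=
    Measure.isProbabilityMeasure_map (by fun_prop)
  have h2 := congrArg (fun μ => μ.map Prod.snd) h
  simp only [Measure.map_snd_prod, measure_univ, one_smul] at h2
  rw [Measure.map_map (by fun_prop) (by fun_prop)] at h2
  exact h2

theorem ae_residSq_ne_zero (hn : n = p + k) (hk : k ≠ 0) {Y : Fin p → Fin n → ℝ}
    (hY : (gramMat Y).PosDef) : ∀ᵐ y ∂(normalVec (0 : Fin n → ℝ)), residSq Y y ≠ 0 := by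
  have h := noncentralChiSq_singleton hk 0
  rw [← map_residSq hn hY, Measure.map_apply (by fun_prop) (measurableSet_singleton 0)] at h
  exact measure_eq_zero_iff_ae_notMem.1 h

end Regression

/-! ### Standard normal data matrices -/

/-- The law of a family of `p` independent standard normal vectors in dimension `n`. -/
def stdMat (p n : ℕ) : Measure (Fin p → Fin n → ℝ) := Measure.pi fun _ => normalVec 0

instance (p n : ℕ) : IsProbabilityMeasure (stdMat p n) := by unfold stdMat; infer_instance

section StdMat

variable {p n k : ℕ}

theorem map_pi_normalVec_cons (Θ : Fin (p + 1) → Fin n → ℝ) :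
    ((normalVec (Θ 0)).prod (Measure.pi fun j : Fin p => normalVec (Θ j.succ))).map
      (fun z => vecCons z.1 z.2) = Measure.pi fun j => normalVec (Θ j) := by
  have h := (measurePreserving_piFinSuccAbove (fun j => normalVec (Θ j)) 0).symm.map_eq
  have h2 : (fun z : (Fin n → ℝ) × (Fin p → Fin n → ℝ) => vecCons z.1 z.2) =
      ⇑(MeasurableEquiv.piFinSuccAbove (fun _ : Fin (p + 1) => Fin n → ℝ) 0).symm := by
    ext z j i
    refine Fin.cases ?_ (fun j => ?_) j <;> simp
  rw [h2]
  simpa only [Fin.succAbove_zero] using h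

theorem map_stdMat_cons (p n : ℕ) :
    ((normalVec 0).prod (stdMat p n)).map (fun z => vecCons z.1 z.2) = stdMat (p + 1) n :=
  map_pi_normalVec_cons 0

theorem measurableSet_posDef_gramMat (p n : ℕ) :
    MeasurableSet {Y : Fin p → Fin n → ℝ | (gramMat Y).PosDef} := by
  simp only [posDef_gramMat_iff]
  exact (measurable_matrix_det (measurable_gramMat measurable_id)) (measurableSet_singleton 0).compl

/-- Add one vector at a time: given the earlier ones, the residual sum of squares is a chi-square
with at least one degree of freedom, hence almost surely nonzero. -/
theorem ae_posDef_gramMat (h : p ≤ n) : ∀ᵐ Y ∂(stdMat p n), (gramMat Y).PosDef := by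
  induction p with
  | zero => exact ae_of_all _ fun Y => by simp [posDef_gramMat_iff]
  | succ p ih =>
    have hm : Measurable fun z : (Fin n → ℝ) × (Fin p → Fin n → ℝ) => vecCons z.1 z.2 := by fun_prop
    rw [← map_stdMat_cons, ae_map_iff hm.aemeasurable (measurableSet_posDef_gramMat _ _)]
    have hs : MeasurableSet {z : (Fin n → ℝ) × (Fin p → Fin n → ℝ) |
      (gramMat (vecCons z.1 z.2)).PosDef} := hm (measurableSet_posDef_gramMat _ _)
    have hs' : MeasurableSet {z : (Fin p → Fin n → ℝ) × (Fin n → ℝ) |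
      (gramMat (vecCons z.2 z.1)).PosDef} := measurable_swap hs
    rw [← Measure.prod_swap, ae_map_iff measurable_swap.aemeasurable hs]
    refine (Measure.ae_prod_iff_ae_ae hs').2 ?_
    filter_upwards [ih (by omega)] with Y hY
    obtain ⟨k, hk⟩ := Nat.exists_eq_add_of_le (by omega : p ≤ n)
    filter_upwards [ae_residSq_ne_zero hk (by omega) hY] with y hy
    exact posDef_gramMat_cons hY hy

theorem map_flip_pi {ι κ : Type*} [Fintype ι] [Fintype κ] (μ : ι → κ → Measure ℝ)
    [∀ i j, IsProbabilityMeasure (μ i j)] :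
    (Measure.pi fun i => Measure.pi fun j => μ i j).map (fun x j i => x i j) =
      Measure.pi fun j => Measure.pi fun i => μ i j := by
  have h1 := Measure.infinitePi_map_curry (fun i j => μ i j)
  have h2 := Measure.infinitePi_map_curry (fun j i => μ i j)
  simp_rw [Measure.infinitePi_eq_pi] at h1 h2
  rw [← h1, ← h2]
  have h3 := (measurePreserving_piCongrLeft (α := fun _ : κ × ι => ℝ)
    (fun q : κ × ι => μ q.2 q.1) (Equiv.prodComm ι κ)).map_eq
  rw [← h3, Measure.map_map (by fun_prop) (by fun_prop), Measure.map_map (by fun_prop) (by fun_prop)]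
  congr 1

/-- Left multiplication of the matrix with rows `C j` by a square matrix. -/
def leftMul (O : Matrix (Fin p) (Fin p) ℝ) (C : Fin p → Fin n → ℝ) : Fin p → Fin n → ℝ :=
  fun j i => (O * Matrix.of C) j i

@[fun_prop]
theorem measurable_leftMul (O : Matrix (Fin p) (Fin p) ℝ) :
    Measurable fun C : Fin p → Fin n → ℝ => leftMul O C :=
  measurable_matrix_mul measurable_const (measurable_matrix_of measurable_id)

/-- Left multiplication acts on columns, whereas `stdMat` is a product over rows; after the flip
each column is a standard normal vector rotated by `O`. -/
theorem map_leftMul_stdMat {O : Matrix (Fin p) (Fin p) ℝ} (hO : O * Oᵀ = 1) :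
    (stdMat p n).map (fun C => leftMul O C) = stdMat p n := by
  have hflip := map_flip_pi (fun (_ : Fin n) (_ : Fin p) => gaussianReal 0 1)
  have hrow : (Measure.pi fun _ : Fin n => normalVec (0 : Fin p → ℝ)).map
      (fun x i => O *ᵥ (x i)) = Measure.pi fun _ : Fin n => normalVec (0 : Fin p → ℝ) := by
    have h := map_mulVec_normalVec hO 0
    rw [mulVec_zero] at h
    have : ∀ i : Fin n, SigmaFinite ((normalVec (0 : Fin p → ℝ)).map fun x => O *ᵥ x) := by
      rw [h]; infer_instance
    rw [Measure.pi_map_pi (f := fun _ x => O *ᵥ x) (fun i => by fun_prop), h]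
  change (Measure.pi fun _ : Fin p => Measure.pi fun _ : Fin n => gaussianReal 0 1).map _ =
    (Measure.pi fun _ : Fin p => Measure.pi fun _ : Fin n => gaussianReal 0 1)
  change (Measure.pi fun _ : Fin n => Measure.pi fun _ : Fin p => gaussianReal 0 1).map _ =
    (Measure.pi fun _ : Fin n => Measure.pi fun _ : Fin p => gaussianReal 0 1) at hrow
  have hm : Measurable fun C : Fin p → Fin n → ℝ => leftMul O C := by fun_prop
  have hm2 : Measurable fun (x : Fin n → Fin p → ℝ) (i : Fin n) => O *ᵥ (x i) := by fun_prop
  conv_lhs => rw [← hflip]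
  conv_rhs => rw [← hflip, ← hrow]
  rw [Measure.map_map hm (by fun_prop), Measure.map_map (by fun_prop) hm2]
  rfl

theorem gramMat_leftMul (O : Matrix (Fin p) (Fin p) ℝ) (C : Fin p → Fin n → ℝ) :
    gramMat (leftMul O C) = O * gramMat C * Oᵀ := by
  change (O * Matrix.of C) * (O * Matrix.of C)ᵀ = O * (Matrix.of C * (Matrix.of C)ᵀ) * Oᵀ
  rw [transpose_mul]
  simp only [Matrix.mul_assoc]

/-- The corner of the inverse Gram matrix is the reciprocal of the residual sum of squares, whose
conditional law does not depend on the other vectors. -/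
theorem map_inv_quadForm_e₀ (hn : n = p + k) (hk : k ≠ 0) :
    (stdMat (p + 1) n).map (fun C => (e₀ p ⬝ᵥ ((gramMat C)⁻¹ *ᵥ e₀ p))⁻¹) =
      noncentralChiSq k 0 := by
  rw [← map_stdMat_cons, Measure.map_map (by fun_prop) (by fun_prop), ← Measure.prod_swap,
    Measure.map_map (by fun_prop) measurable_swap]
  have hmp : MeasurePreserving
      (fun z : (Fin p → Fin n → ℝ) × (Fin n → ℝ) => (id z.1, residSq z.1 z.2))
      ((stdMat p n).prod (normalVec 0)) ((stdMat p n).prod (noncentralChiSq k 0)) :=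
    (MeasurePreserving.id _).skew_product (g := fun Y y => residSq Y y)
      (by unfold Function.uncurry; fun_prop)
      ((ae_posDef_gramMat (by omega)).mono fun Y hY => map_residSq hn hY)
  have h2 := (measurePreserving_snd (μ := stdMat p n) (ν := noncentralChiSq k 0)).comp hmp
  rw [← h2.map_eq]
  apply Measure.map_congr
  have hms : MeasurableSet {z : (Fin p → Fin n → ℝ) × (Fin n → ℝ) |
      (gramMat z.1).PosDef ∧ residSq z.1 z.2 ≠ 0} := by
    refine MeasurableSet.inter (measurable_fst (measurableSet_posDef_gramMat _ _)) ?_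
    exact (measurable_residSq measurable_fst measurable_snd) (measurableSet_singleton 0).compl
  have hae : ∀ᵐ z ∂((stdMat p n).prod (normalVec (0 : Fin n → ℝ))),
      (gramMat z.1).PosDef ∧ residSq z.1 z.2 ≠ 0 := by
    rw [Measure.ae_prod_iff_ae_ae hms]
    filter_upwards [ae_posDef_gramMat (show p ≤ n by omega)] with Y hY
    filter_upwards [ae_residSq_ne_zero hn hk hY] with y hy using ⟨hY, hy⟩
  filter_upwards [hae] with z hz
  simp only [Function.comp_apply, Prod.fst_swap, Prod.snd_swap]
  rw [inv_gramMat_cons_mulVec_single hz.1 hz.2, e₀, single_one_dotProduct]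
  simp

theorem map_inv_quadForm (hn : n = p + k) (hk : k ≠ 0) {u : Fin (p + 1) → ℝ} (hu : u ⬝ᵥ u = 1) :
    (stdMat (p + 1) n).map (fun C => (u ⬝ᵥ ((gramMat C)⁻¹ *ᵥ u))⁻¹) = noncentralChiSq k 0 := by
  obtain ⟨O, hO, hOu⟩ := exists_orthogonal_mulVec_eq_single hu
  rw [← map_inv_quadForm_e₀ hn hk]
  conv_rhs => rw [← map_leftMul_stdMat hO]
  have hm : Measurable fun C : Fin (p + 1) → Fin n → ℝ => leftMul O C := by fun_prop
  rw [Measure.map_map (by fun_prop) hm]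
  congr 1
  ext C
  have hOd : IsUnit O.det := isUnit_det_of_whitening (S := 1) (by rw [Matrix.mul_one, hO])
  rw [Function.comp_apply, gramMat_leftMul, e₀, ← hOu, inv_congr_mulVec hOd, dotProduct_inv_congr hOd]

end StdMat

/-! ### The joint law of the two retained terms -/

theorem measurePreserving_prodProdProdComm {α β γ δ : Type*} [MeasurableSpace α]
    [MeasurableSpace β] [MeasurableSpace γ] [MeasurableSpace δ] (μ : Measure α) (ν : Measure β)
    (ρ : Measure γ) (σ : Measure δ) [SFinite μ] [SFinite ν] [SFinite ρ] [SFinite σ] :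
    MeasurePreserving (fun z : (α × β) × (γ × δ) => ((z.1.1, z.2.1), (z.1.2, z.2.2)))
      ((μ.prod ν).prod (ρ.prod σ)) ((μ.prod ρ).prod (ν.prod σ)) := by
  refine ⟨by fun_prop, Measure.ext_of_lintegral _ fun f hf => ?_⟩
  have hL : ∫⁻ x : α × β, ∫⁻ y : γ × δ, f ((x.1, y.1), (x.2, y.2)) ∂(ρ.prod σ) ∂(μ.prod ν) =
      ∫⁻ a, ∫⁻ b, ∫⁻ y : γ × δ, f ((a, y.1), (b, y.2)) ∂(ρ.prod σ) ∂ν ∂μ :=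
    lintegral_prod (fun x : α × β => ∫⁻ y : γ × δ, f ((x.1, y.1), (x.2, y.2)) ∂(ρ.prod σ))
      (Measurable.lintegral_prod_right' (ν := ρ.prod σ)
        (f := fun q : (α × β) × (γ × δ) => f ((q.1.1, q.2.1), (q.1.2, q.2.2)))
        (by fun_prop)).aemeasurable
  have hR : ∫⁻ x : α × γ, ∫⁻ y : β × δ, f (x, y) ∂(ν.prod σ) ∂(μ.prod ρ) =
      ∫⁻ a, ∫⁻ c, ∫⁻ y : β × δ, f ((a, c), y) ∂(ν.prod σ) ∂ρ ∂μ :=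
    lintegral_prod (fun x : α × γ => ∫⁻ y : β × δ, f (x, y) ∂(ν.prod σ))
      (Measurable.lintegral_prod_right' hf).aemeasurable
  rw [lintegral_map hf (by fun_prop), lintegral_prod _ (by fun_prop), hL,
    lintegral_prod _ (by fun_prop), hR]
  refine lintegral_congr fun a => ?_
  have h1 (b : β) : ∫⁻ y, f ((a, y.1), (b, y.2)) ∂(ρ.prod σ) =
      ∫⁻ c, ∫⁻ d, f ((a, c), (b, d)) ∂σ ∂ρ := lintegral_prod _ (by fun_prop)
  have h2 (c : γ) : ∫⁻ y, f ((a, c), y) ∂(ν.prod σ) =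
      ∫⁻ b, ∫⁻ d, f ((a, c), (b, d)) ∂σ ∂ν := lintegral_prod _ (by fun_prop)
  simp only [h1, h2]
  refine lintegral_lintegral_swap (Measurable.aemeasurable ?_)
  exact Measurable.lintegral_prod_right' (f := fun q : (β × γ) × δ => f ((a, q.1.2), (q.1.1, q.2)))
    (by fun_prop)

section JointLaw

variable {p n k : ℕ}

theorem ae_normalVec_ne_zero (hn : n ≠ 0) (θ : Fin n → ℝ) : ∀ᵐ x ∂(normalVec θ), x ≠ 0 := by
  have : Nonempty (Fin n) := ⟨⟨0, Nat.pos_of_ne_zero hn⟩⟩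
  have h : normalVec θ {0} = 0 := by
    rw [normalVec, Measure.pi_singleton]
    obtain ⟨i⟩ := this
    refine Finset.prod_eq_zero (Finset.mem_univ i) ?_
    have := nullSingletonClass_gaussianReal (μ := θ i) (v := 1) one_ne_zero
    exact measure_singleton _
  exact measure_eq_zero_iff_ae_notMem.1 h

theorem dotProduct_self_pos {ι : Type*} [Fintype ι] {x : ι → ℝ} (hx : x ≠ 0) : 0 < x ⬝ᵥ x := by
  have := dotProduct_star_self_pos_iff.2 hx
  simpa using this

theorem normalize_dotProduct_self {ι : Type*} [Fintype ι] {x : ι → ℝ} (hx : x ≠ 0) :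
    ((√(x ⬝ᵥ x))⁻¹ • x) ⬝ᵥ ((√(x ⬝ᵥ x))⁻¹ • x) = 1 := by
  have hpos := dotProduct_self_pos hx
  rw [smul_dotProduct, dotProduct_smul, smul_eq_mul, smul_eq_mul, ← mul_assoc, ← mul_inv,
    Real.mul_self_sqrt hpos.le, inv_mul_cancel₀ hpos.ne']

/-- The law does not depend on `x`; this is what makes the normalized cross products independent of
`x`, whatever its mean. -/
theorem map_normCross {x : Fin n → ℝ} (hx : x ≠ 0) :
    (stdMat p n).map (fun X => normCross X x) = normalVec 0 := by
  have h := map_dotProduct_normalVec_zero (normalize_dotProduct_self hx)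
  have : ∀ _ : Fin p, SigmaFinite ((normalVec (0 : Fin n → ℝ)).map
      fun y => ((√(x ⬝ᵥ x))⁻¹ • x) ⬝ᵥ y) := by
    rw [h]; infer_instance
  have h2 := Measure.pi_map_pi (μ := fun _ : Fin p => normalVec (0 : Fin n → ℝ))
    (f := fun _ y => ((√(x ⬝ᵥ x))⁻¹ • x) ⬝ᵥ y) (fun _ => by fun_prop)
  rw [h] at h2
  refine Eq.trans ?_ h2
  rw [stdMat]
  congr 1
  ext X j
  rw [normCross, smul_dotProduct, dotProduct_comm x (X j)]
  rfl

theorem measurePreserving_signal (hn : n ≠ 0) (θ : Fin n → ℝ) :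
    MeasurePreserving (fun z : (Fin n → ℝ) × (Fin p → Fin n → ℝ) => (z.1 ⬝ᵥ z.1, normCross z.2 z.1))
      ((normalVec θ).prod (stdMat p n))
      ((noncentralChiSq n (θ ⬝ᵥ θ)).prod (normalVec (0 : Fin p → ℝ))) :=
  MeasurePreserving.skew_product ⟨by fun_prop, map_dotProduct_self_normalVec θ⟩
    (g := fun x X => normCross X x) (by unfold Function.uncurry; fun_prop)
    ((ae_normalVec_ne_zero hn θ).mono fun _ hx => map_normCross hx)

theorem measurePreserving_residSq (hn : n = p + k) :
    MeasurePreserving (fun z : (Fin n → ℝ) × (Fin p → Fin n → ℝ) => (residSq z.2 z.1, z.2))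
      ((normalVec 0).prod (stdMat p n)) ((noncentralChiSq k 0).prod (stdMat p n)) := by
  have hmp : MeasurePreserving
      (fun z : (Fin p → Fin n → ℝ) × (Fin n → ℝ) => (id z.1, residSq z.1 z.2))
      ((stdMat p n).prod (normalVec 0)) ((stdMat p n).prod (noncentralChiSq k 0)) :=
    (MeasurePreserving.id _).skew_product (g := fun Y y => residSq Y y)
      (by unfold Function.uncurry; fun_prop)
      ((ae_posDef_gramMat (by omega)).mono fun Y hY => map_residSq hn hY)
  exact (Measure.measurePreserving_swap.comp hmp).comp Measure.measurePreserving_swap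

/-- Given `β`, the ratio has the same chi-square law for every nonzero `β`, hence is independent of
`β`. The family has `p` vectors, not `p + 1`, so there is one degree of freedom more than for
`residSq`. -/
theorem measurePreserving_quadForm (hp : p ≠ 0) (hn : n = p + k) :
    MeasurePreserving (fun z : (Fin p → ℝ) × (Fin p → Fin n → ℝ) =>
        (z.1 ⬝ᵥ z.1, (z.1 ⬝ᵥ z.1) / (z.1 ⬝ᵥ ((gramMat z.2)⁻¹ *ᵥ z.1))))
      ((normalVec 0).prod (stdMat p n))
      ((noncentralChiSq p 0).prod (noncentralChiSq (k + 1) 0)) := by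
  refine MeasurePreserving.skew_product
    ⟨by fun_prop, map_dotProduct_self_normalVec_zero p⟩
    (g := fun β Y => (β ⬝ᵥ β) / (β ⬝ᵥ ((gramMat Y)⁻¹ *ᵥ β))) (by unfold Function.uncurry; fun_prop)
    ((ae_normalVec_ne_zero hp 0).mono fun β hβ => ?_)
  obtain ⟨p, rfl⟩ := Nat.exists_eq_succ_of_ne_zero hp
  rw [← map_inv_quadForm (p := p) (n := n) (k := k + 1) (by omega) (Nat.succ_ne_zero k)
    (normalize_dotProduct_self hβ)]
  congr 1
  ext Y
  rw [mulVec_smul, smul_dotProduct, dotProduct_smul, smul_eq_mul, smul_eq_mul, ← mul_assoc,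
    ← mul_inv, Real.mul_self_sqrt (dotProduct_self_nonneg' β), mul_inv, inv_inv, div_eq_mul_inv]

theorem measurePreserving_chiSq_components {nH nE : ℕ} (hnH : nH ≠ 0) (hp : p ≠ 0)
    (hnE : nE = p + k) (θ : Fin nH → ℝ) :
    MeasurePreserving (fun z : ((Fin nH → ℝ) × (Fin p → Fin nH → ℝ)) ×
        ((Fin nE → ℝ) × (Fin p → Fin nE → ℝ)) =>
        ((z.1.1 ⬝ᵥ z.1.1, residSq z.2.2 z.2.1),
          (normCross z.1.2 z.1.1 ⬝ᵥ normCross z.1.2 z.1.1,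
            (normCross z.1.2 z.1.1 ⬝ᵥ normCross z.1.2 z.1.1) /
              (normCross z.1.2 z.1.1 ⬝ᵥ ((gramMat z.2.2)⁻¹ *ᵥ normCross z.1.2 z.1.1)))))
      (((normalVec θ).prod (stdMat p nH)).prod ((normalVec 0).prod (stdMat p nE)))
      (((noncentralChiSq nH (θ ⬝ᵥ θ)).prod (noncentralChiSq k 0)).prod
        ((noncentralChiSq p 0).prod (noncentralChiSq (k + 1) 0))) :=
  ((MeasurePreserving.id _).prod (measurePreserving_quadForm hp hnE)).comp
    ((measurePreserving_prodProdProdComm _ _ _ _).comp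
      ((measurePreserving_signal hnH θ).prod (measurePreserving_residSq hnE)))

end JointLaw

/-! ### Moments of the averaged term -/

section Moments

variable {p n k : ℕ}

theorem lintegral_vecMul_sq (q : Fin p → ℝ) :
    ∫⁻ X, ENNReal.ofReal ((q ᵥ* Matrix.of X) ⬝ᵥ (q ᵥ* Matrix.of X)) ∂(stdMat p n) =
      n * ENNReal.ofReal (q ⬝ᵥ q) := by
  have hflip := map_flip_pi (fun (_ : Fin n) (_ : Fin p) => gaussianReal 0 1)
  have hst : stdMat p n = (Measure.pi fun _ : Fin n => normalVec (0 : Fin p → ℝ)).map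
      (fun x j i => x i j) := hflip.symm
  have h (x : Fin n → Fin p → ℝ) :
      ENNReal.ofReal ((q ᵥ* Matrix.of fun j i => x i j) ⬝ᵥ (q ᵥ* Matrix.of fun j i => x i j)) =
      ∑ i, ENNReal.ofReal ((q ⬝ᵥ x i) ^ 2) := by
    rw [← ENNReal.ofReal_sum_of_nonneg fun i _ => sq_nonneg _]
    simp [dotProduct, vecMul, sq]
  rw [hst, lintegral_map (by fun_prop) (by fun_prop)]
  simp_rw [h]
  rw [lintegral_finsetSum _ fun i _ => by fun_prop]
  have h2 (i : Fin n) : ∫⁻ x, ENNReal.ofReal ((q ⬝ᵥ x i) ^ 2)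
      ∂(Measure.pi fun _ : Fin n => normalVec (0 : Fin p → ℝ)) = ENNReal.ofReal (q ⬝ᵥ q) := by
    rw [← lintegral_dotProduct_sq q]
    exact (measurePreserving_eval (fun _ : Fin n => normalVec (0 : Fin p → ℝ)) i).lintegral_comp
      (f := fun y => ENNReal.ofReal ((q ⬝ᵥ y) ^ 2)) (by fun_prop)
  simp [h2]

/-- For fixed `Y` numerator and denominator are independent; the coefficients have covariance
`(gramMat Y)⁻¹`, whose trace is their mean squared length. -/
theorem lintegral_regCoeff_sq_div_residSq (hn : n = p + k) (hk : 3 ≤ k) {Y : Fin p → Fin n → ℝ}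
    (hY : (gramMat Y).PosDef) :
    ∫⁻ y, ENNReal.ofReal ((regCoeff Y y ⬝ᵥ regCoeff Y y) / residSq Y y) ∂(normalVec 0) =
      ENNReal.ofReal (gramMat Y)⁻¹.trace * ENNReal.ofReal ((k : ℝ) - 2)⁻¹ := by
  obtain ⟨B, hB, hmap⟩ := exists_map_regression hn hY
  have hm : Measurable fun z : (Fin p → ℝ) × ℝ => ENNReal.ofReal ((z.1 ⬝ᵥ z.1) / z.2) := by fun_prop
  have h1 := lintegral_map (μ := normalVec (0 : Fin n → ℝ)) hm
    (g := fun y => (regCoeff Y y, residSq Y y)) (by fun_prop)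
  rw [hmap] at h1
  rw [← h1]
  have h2 (z : (Fin p → ℝ) × ℝ) : ENNReal.ofReal ((z.1 ⬝ᵥ z.1) / z.2) =
      ENNReal.ofReal (z.1 ⬝ᵥ z.1) * ENNReal.ofReal z.2⁻¹ := by
    rw [← ENNReal.ofReal_mul (dotProduct_self_nonneg' _), div_eq_mul_inv]
  simp_rw [h2]
  have : IsProbabilityMeasure ((normalVec (0 : Fin p → ℝ)).map (fun g => Bᵀ *ᵥ g)) :=
    Measure.isProbabilityMeasure_map (by fun_prop)
  rw [lintegral_prod_mul (f := fun g : Fin p → ℝ => ENNReal.ofReal (g ⬝ᵥ g))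
    (g := fun d : ℝ => ENNReal.ofReal d⁻¹) (by fun_prop) (by fun_prop),
    lintegral_inv_noncentralChiSq hk, lintegral_map (by fun_prop) (by fun_prop)]
  congr 1
  have h3 (g : Fin p → ℝ) : ENNReal.ofReal ((Bᵀ *ᵥ g) ⬝ᵥ (Bᵀ *ᵥ g)) =
      ∑ i, ENNReal.ofReal (((fun r => B r i) ⬝ᵥ g) ^ 2) := by
    rw [← ENNReal.ofReal_sum_of_nonneg fun i _ => sq_nonneg _]
    simp [dotProduct, mulVec, sq]
  simp_rw [h3]
  rw [lintegral_finsetSum _ fun i _ => by fun_prop]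
  simp_rw [lintegral_dotProduct_sq]
  rw [← ENNReal.ofReal_sum_of_nonneg fun i _ => dotProduct_self_nonneg' _, ← hB]
  congr 1

/-- The reciprocal of a diagonal entry is a chi-square with `k + 1` degrees of freedom, so the mean
is `1/(k + 1 - 2)`. -/
theorem lintegral_inv_diag (hn : n = p + k) (hk : 3 ≤ k + 1) (j : Fin p) :
    ∫⁻ Y, ENNReal.ofReal ((gramMat Y)⁻¹ j j) ∂(stdMat p n) = ENNReal.ofReal ((k : ℝ) - 1)⁻¹ := by
  obtain ⟨p, rfl⟩ := Nat.exists_eq_succ_of_ne_zero (fun h => (h ▸ j).elim0 : p ≠ 0)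
  have hu : (Pi.single j 1 : Fin (p + 1) → ℝ) ⬝ᵥ Pi.single j 1 = 1 := by simp
  have h := lintegral_inv_noncentralChiSq hk
  rw [← map_inv_quadForm (p := p) (n := n) (by omega) (Nat.succ_ne_zero k) hu,
    lintegral_map (by fun_prop) (by fun_prop)] at h
  have hc : ((k + 1 : ℕ) : ℝ) - 2 = k - 1 := by push_cast; ring
  rw [hc] at h
  rw [← h]
  simp

theorem lintegral_trace_inv (hn : n = p + k) (hk : 2 ≤ k) :
    ∫⁻ Y, ENNReal.ofReal (gramMat Y)⁻¹.trace ∂(stdMat p n) =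
      p * ENNReal.ofReal ((k : ℝ) - 1)⁻¹ := by
  have h (Y : Fin p → Fin n → ℝ) : ENNReal.ofReal (gramMat Y)⁻¹.trace =
      ∑ j, ENNReal.ofReal ((gramMat Y)⁻¹ j j) := by
    rw [← ENNReal.ofReal_sum_of_nonneg fun i _ => (posSemidef_gramMat Y).inv.diag_nonneg]
    rfl
  have hm (j : Fin p) : Measurable fun Y : Fin p → Fin n → ℝ => ENNReal.ofReal ((gramMat Y)⁻¹ j j) :=
    ENNReal.measurable_ofReal.comp (measurable_matrix_entry (by fun_prop) j j)
  simp_rw [h]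
  rw [lintegral_finsetSum _ fun i _ => hm i]
  simp [lintegral_inv_diag hn (by omega)]

theorem lintegral_regression_ratio (hn : n = p + k) (hk : 3 ≤ k) :
    ∫⁻ z, ENNReal.ofReal ((regCoeff z.2 z.1 ⬝ᵥ regCoeff z.2 z.1) / residSq z.2 z.1)
      ∂((normalVec (0 : Fin n → ℝ)).prod (stdMat p n)) =
      p * ENNReal.ofReal ((k : ℝ) - 1)⁻¹ * ENNReal.ofReal ((k : ℝ) - 2)⁻¹ := by
  rw [lintegral_prod_symm _ (by fun_prop)]
  rw [lintegral_congr_ae ((ae_posDef_gramMat (by omega)).mono fun Y hY =>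
      lintegral_regCoeff_sq_div_residSq hn hk hY),
    lintegral_mul_const _ (by fun_prop), lintegral_trace_inv hn (by omega)]

theorem lintegral_residual {nH : ℕ} (hn : n = p + k) (hk : 3 ≤ k) :
    ∫⁻ z, ENNReal.ofReal (((regCoeff z.2.2 z.2.1 ᵥ* Matrix.of z.1) ⬝ᵥ
        (regCoeff z.2.2 z.2.1 ᵥ* Matrix.of z.1)) / residSq z.2.2 z.2.1)
      ∂((stdMat p nH).prod ((normalVec (0 : Fin n → ℝ)).prod (stdMat p n))) =
      nH * (p * ENNReal.ofReal ((k : ℝ) - 1)⁻¹ * ENNReal.ofReal ((k : ℝ) - 2)⁻¹) := by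
  rw [lintegral_prod_symm _ (by fun_prop), ← lintegral_regression_ratio hn hk,
    ← lintegral_const_mul _ (by fun_prop)]
  refine lintegral_congr fun z => ?_
  simp only [div_eq_mul_inv]
  have h (X : Fin p → Fin nH → ℝ) : ENNReal.ofReal (((regCoeff z.2 z.1 ᵥ* Matrix.of X) ⬝ᵥ
      (regCoeff z.2 z.1 ᵥ* Matrix.of X)) * (residSq z.2 z.1)⁻¹) =
      ENNReal.ofReal ((regCoeff z.2 z.1 ᵥ* Matrix.of X) ⬝ᵥ
      (regCoeff z.2 z.1 ᵥ* Matrix.of X)) * ENNReal.ofReal (residSq z.2 z.1)⁻¹ :=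
    ENNReal.ofReal_mul (dotProduct_self_nonneg' _)
  simp_rw [h]
  rw [lintegral_mul_const _ (by fun_prop), lintegral_vecMul_sq, mul_assoc,
    ← ENNReal.ofReal_mul (dotProduct_self_nonneg' _)]

end Moments

/-! ### Wishart matrices in canonical coordinates -/

section Wishart

variable {p n m : ℕ}

theorem measurable_gramMat_fun :
    Measurable (gramMat : (Fin p → Fin n → ℝ) → Matrix (Fin p) (Fin p) ℝ) :=
  measurable_gramMat measurable_id

/-- The `n` rows of the data are transformed one by one; the flip regroups the independent entries
into `m` vectors of length `n`, whose Gram matrix is taken later. -/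
theorem map_gaussianRows {S A : Matrix (Fin m) (Fin m) ℝ} (hS : S.PosDef) (hA : A * S * Aᵀ = 1)
    (M : Matrix (Fin n) (Fin m) ℝ) :
    (gaussianRows M S).map (fun X j i => (A *ᵥ X i) j) =
      Measure.pi fun j => normalVec fun i => (A *ᵥ M i) j := by
  have hm1 : Measurable fun x : Fin n → EuclideanSpace ℝ (Fin m) =>
      (Matrix.of fun i j => x i j : Matrix (Fin n) (Fin m) ℝ) :=
    measurable_matrix_iff.2 fun i j => by simp only [of_apply]; fun_prop
  have hm2 : Measurable fun (X : Matrix (Fin n) (Fin m) ℝ) (j : Fin m) (i : Fin n) =>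
      (A *ᵥ X i) j :=
    measurable_pi_iff.2 fun j => measurable_pi_iff.2 fun i =>
      (measurable_pi_apply j).comp (measurable_mulVec measurable_const
        (measurable_matrix_row measurable_id i))
  have hrow (i : Fin n) := map_mulVec_multivariateGaussian hS.posSemidef hA (WithLp.toLp 2 (M i))
  have : ∀ i : Fin n, SigmaFinite ((multivariateGaussian (WithLp.toLp 2 (M i)) S).map
      fun x => A *ᵥ x.ofLp) := fun i => by
    rw [hrow i]; infer_instance
  have hpi := Measure.pi_map_pi (μ := fun i : Fin n => multivariateGaussian (WithLp.toLp 2 (M i)) S)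
    (f := fun _ x => A *ᵥ x.ofLp) (fun i => Measurable.aemeasurable (by fun_prop))
  simp_rw [hrow] at hpi
  have hflip := map_flip_pi (fun (i : Fin n) (j : Fin m) => gaussianReal ((A *ᵥ M i) j) 1)
  change _ = Measure.pi fun j => Measure.pi fun i => gaussianReal ((A *ᵥ M i) j) 1
  change _ = Measure.pi fun i => Measure.pi fun j => gaussianReal ((A *ᵥ M i) j) 1 at hpi
  have hm3 : Measurable fun (x : Fin n → EuclideanSpace ℝ (Fin m)) (i : Fin n) =>
      A *ᵥ (x i).ofLp := measurable_pi_iff.2 fun i => by fun_prop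
  rw [← hflip, ← hpi, gaussianRows, Measure.map_map hm2 hm1, Measure.map_map (by fun_prop) hm3]
  rfl

theorem gramMat_mulVec_rows (A : Matrix (Fin m) (Fin m) ℝ) (X : Matrix (Fin n) (Fin m) ℝ) :
    gramMat (fun j i => (A *ᵥ X i) j) = A * (Xᵀ * X) * Aᵀ := by
  have h : (Matrix.of fun j i => (A *ᵥ X i) j) = A * Xᵀ := by
    ext j i
    simp [mul_apply, mulVec, dotProduct]
  rw [gramMat, h, transpose_mul, transpose_transpose]
  simp only [Matrix.mul_assoc]

theorem map_wishartOfMean {S A : Matrix (Fin m) (Fin m) ℝ} (hS : S.PosDef) (hA : A * S * Aᵀ = 1)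
    (M : Matrix (Fin n) (Fin m) ℝ) :
    (wishartOfMean M S).map (fun W => A * W * Aᵀ) =
      (Measure.pi fun j => normalVec fun i => (A *ᵥ M i) j).map gramMat := by
  have hm2 : Measurable fun (X : Matrix (Fin n) (Fin m) ℝ) (j : Fin m) (i : Fin n) =>
      (A *ᵥ X i) j :=
    measurable_pi_iff.2 fun j => measurable_pi_iff.2 fun i =>
      (measurable_pi_apply j).comp (measurable_mulVec measurable_const
        (measurable_matrix_row measurable_id i))
  rw [← map_gaussianRows hS hA, wishartOfMean, Measure.map_map (by fun_prop) (by fun_prop),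
    Measure.map_map measurable_gramMat_fun hm2]
  congr 1
  ext X : 1
  exact (gramMat_mulVec_rows A X).symm

/-- The law of the Gram matrix of a normal vector with mean `θ` and `p` standard normal vectors. -/
def blockWishart (p : ℕ) (θ : Fin n → ℝ) : Measure (Matrix (Fin (p + 1)) (Fin (p + 1)) ℝ) :=
  ((normalVec θ).prod (stdMat p n)).map fun z => gramMat (vecCons z.1 z.2)

/-- In the new coordinates the Gram matrix of the mean vectors is `c e₀ e₀ᵀ`. Its diagonal alone
shows that every mean vector but the first vanishes. -/
theorem IsWishart.exists_hasLaw_blockWishart {𝓧 : Type*} [MeasurableSpace 𝓧] {P : Measure 𝓧}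
    {S A : Matrix (Fin (p + 1)) (Fin (p + 1)) ℝ} {v : Fin (p + 1) → ℝ}
    {W : 𝓧 → Matrix (Fin (p + 1)) (Fin (p + 1)) ℝ} {c : ℝ} (hS : S.PosDef) (hA : A * S * Aᵀ = 1)
    (hAv : A *ᵥ v = e₀ p) (hW : IsWishart P W n S (c • (S⁻¹ * vecMulVec v v))) :
    ∃ θ : Fin n → ℝ, θ ⬝ᵥ θ = c ∧ HasLaw (fun x => A * W x * Aᵀ) (blockWishart p θ) P := by
  obtain ⟨M, hM, hlaw⟩ := hW
  have hMM : Mᵀ * M = c • vecMulVec v v := by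
    have h := congrArg (fun N => S * N) hM
    simp only [Matrix.mul_smul] at h
    rwa [mul_nonsing_inv_cancel_left _ _ hS.det_pos.ne'.isUnit,
      mul_nonsing_inv_cancel_left _ _ hS.det_pos.ne'.isUnit] at h
  obtain ⟨Θ, hΘ⟩ : ∃ Θ : Fin (p + 1) → Fin n → ℝ, Θ = fun j i => (A *ᵥ M i) j := ⟨_, rfl⟩
  have hgram : gramMat Θ = c • vecMulVec (e₀ p) (e₀ p) := by
    rw [hΘ, gramMat_mulVec_rows, hMM, Matrix.mul_smul, Matrix.smul_mul, mul_vecMulVec,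
      vecMulVec_mul, vecMul_transpose, hAv]
  have hdiag (j : Fin (p + 1)) : Θ j ⬝ᵥ Θ j = c * (e₀ p j * e₀ p j) := congrFun (congrFun hgram j) j
  have hzero (j : Fin p) : Θ j.succ = 0 := by
    have h := hdiag j.succ
    simp only [e₀, Pi.single_apply, Fin.succ_ne_zero, if_false, mul_zero] at h
    exact dotProduct_self_eq_zero.1 h
  refine ⟨Θ 0, by simpa using hdiag 0, ?_, ?_⟩
  · have hm : Measurable fun N : Matrix (Fin (p + 1)) (Fin (p + 1)) ℝ => A * N * Aᵀ := by fun_prop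
    exact hm.comp_aemeasurable hlaw.aemeasurable
  · have hm : Measurable fun N : Matrix (Fin (p + 1)) (Fin (p + 1)) ℝ => A * N * Aᵀ := by fun_prop
    have h1 := AEMeasurable.map_map_of_aemeasurable hm.aemeasurable hlaw.aemeasurable
    have h2 := map_pi_normalVec_cons Θ
    simp_rw [hzero] at h2
    rw [hlaw.map_eq, map_wishartOfMean hS hA] at h1
    change Measure.map ((fun N => A * N * Aᵀ) ∘ W) P = _
    rw [← h1]
    change Measure.map gramMat (Measure.pi fun j => normalVec ((fun j i => (A *ᵥ M i) j) j)) = _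
    rw [← hΘ, ← h2, Measure.map_map measurable_gramMat_fun (by fun_prop), blockWishart,
      stdMat]
    rfl

theorem ae_posSemidef_blockWishart (θ : Fin n → ℝ) :
    ∀ᵐ W ∂(blockWishart p θ), W.PosSemidef := by
  have hs : MeasurableSet {W : Matrix (Fin (p + 1)) (Fin (p + 1)) ℝ | W.PosSemidef} := by
    -- An uncountable intersection, so measurability is obtained from closedness.
    have : {W : Matrix (Fin (p + 1)) (Fin (p + 1)) ℝ | W.PosSemidef} =
        {W | Wᵀ = W} ∩ ⋂ x : Fin (p + 1) → ℝ, {W | 0 ≤ x ⬝ᵥ (W *ᵥ x)} := by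
      ext W
      simp only [Set.mem_inter_iff, Set.mem_iInter, Set.mem_ofPred_eq]
      refine ⟨fun h => ⟨posSemidef_transpose_eq h, posSemidef_nonneg h⟩, fun h => ?_⟩
      refine .of_dotProduct_mulVec_nonneg
        (by rw [IsHermitian, conjTranspose_eq_transpose_of_trivial, h.1]) fun x => ?_
      rw [star_trivial]; exact h.2 x
    rw [this]
    apply IsClosed.measurableSet
    refine IsClosed.inter (isClosed_eq (by fun_prop) continuous_id) (isClosed_iInter fun x => ?_)
    exact isClosed_le continuous_const
      (continuous_const.dotProduct (continuous_id.matrix_mulVec continuous_const))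
  rw [blockWishart, ae_map_iff (by fun_prop) hs]
  exact ae_of_all _ fun z => posSemidef_gramMat _

theorem measurePreserving_blockWishart (θ : Fin n → ℝ) :
    MeasurePreserving (fun z : (Fin n → ℝ) × (Fin p → Fin n → ℝ) => gramMat (vecCons z.1 z.2))
      ((normalVec θ).prod (stdMat p n)) (blockWishart p θ) :=
  ⟨by fun_prop, rfl⟩

theorem measurePreserving_blockWishart_prod {nH nE : ℕ} (θ : Fin nH → ℝ) (θ' : Fin nE → ℝ) :
    MeasurePreserving (fun z : ((Fin nH → ℝ) × (Fin p → Fin nH → ℝ)) ×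
        ((Fin nE → ℝ) × (Fin p → Fin nE → ℝ)) =>
        (gramMat (vecCons z.1.1 z.1.2), gramMat (vecCons z.2.1 z.2.2)))
      (((normalVec θ).prod (stdMat p nH)).prod ((normalVec θ').prod (stdMat p nE)))
      ((blockWishart p θ).prod (blockWishart p θ')) :=
  (measurePreserving_blockWishart θ).prod (measurePreserving_blockWishart θ')

end Wishart

/-! ### Measurability of the terms -/

section TermsMeasurable

variable {m : ℕ} {α : Type*} [MeasurableSpace α] {f g : α → Matrix (Fin m) (Fin m) ℝ}
  (S : Matrix (Fin m) (Fin m) ℝ) (v : Fin m → ℝ)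

@[fun_prop]
theorem measurable_signalSq (hf : Measurable f) : Measurable fun a => signalSq S v (f a) := by
  unfold signalSq; fun_prop

@[fun_prop]
theorem measurable_crossVec (hf : Measurable f) : Measurable fun a => crossVec S v (f a) := by
  unfold crossVec; fun_prop

@[fun_prop]
theorem measurable_complProj {h : α → Fin m → ℝ} (hh : Measurable h) :
    Measurable fun a => complProj S v (h a) := by
  unfold complProj; fun_prop

@[fun_prop]
theorem measurable_leadTerm (hf : Measurable f) (hg : Measurable g) :
    Measurable fun a => leadTerm S v (f a) (g a) := by
  unfold leadTerm; fun_prop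

@[fun_prop]
theorem measurable_crossTerm (hf : Measurable f) (hg : Measurable g) :
    Measurable fun a => crossTerm S v (f a) (g a) := by
  unfold crossTerm; fun_prop

@[fun_prop]
theorem measurable_schurTerm (hf : Measurable f) (hg : Measurable g) :
    Measurable fun a => schurTerm S v (f a) (g a) := by
  unfold schurTerm; fun_prop

@[fun_prop]
theorem measurable_residualTerm (hf : Measurable f) (hg : Measurable g) :
    Measurable fun a => residualTerm S v (f a) (g a) := by
  unfold residualTerm; fun_prop

end TermsMeasurable

/-! ### The terms under the canonical Wishart laws -/

section Model

variable {p nH nE k : ℕ}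

/-- The law of the normal data behind a pair of independent canonical Wishart matrices. -/
abbrev dataLaw (p nE : ℕ) {nH : ℕ} (θ : Fin nH → ℝ) :
    Measure (((Fin nH → ℝ) × (Fin p → Fin nH → ℝ)) × ((Fin nE → ℝ) × (Fin p → Fin nE → ℝ))) :=
  ((normalVec θ).prod (stdMat p nH)).prod ((normalVec 0).prod (stdMat p nE))

/-- The pair of Gram matrices of a pair of normal data matrices. -/
abbrev gramPair {p nH nE : ℕ}
    (z : ((Fin nH → ℝ) × (Fin p → Fin nH → ℝ)) × ((Fin nE → ℝ) × (Fin p → Fin nE → ℝ))) :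
    Matrix (Fin (p + 1)) (Fin (p + 1)) ℝ × Matrix (Fin (p + 1)) (Fin (p + 1)) ℝ :=
  (gramMat (vecCons z.1.1 z.1.2), gramMat (vecCons z.2.1 z.2.2))

/-- The law of a pair of independent canonical Wishart matrices. -/
abbrev modelLaw (p nE : ℕ) {nH : ℕ} (θ : Fin nH → ℝ) :
    Measure (Matrix (Fin (p + 1)) (Fin (p + 1)) ℝ × Matrix (Fin (p + 1)) (Fin (p + 1)) ℝ) :=
  (blockWishart p θ).prod (blockWishart p (0 : Fin nE → ℝ))

theorem measurePreserving_gramPair (θ : Fin nH → ℝ) :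
    MeasurePreserving gramPair (dataLaw p nE θ) (modelLaw p nE θ) :=
  measurePreserving_blockWishart_prod θ 0

theorem ae_regular_normal (hnE : nE = p + k) (hk : k ≠ 0) :
    ∀ᵐ z ∂((normalVec (0 : Fin nE → ℝ)).prod (stdMat p nE)),
      (gramMat z.2).PosDef ∧ residSq z.2 z.1 ≠ 0 := by
  have hms : MeasurableSet {z : (Fin p → Fin nE → ℝ) × (Fin nE → ℝ) |
      (gramMat z.1).PosDef ∧ residSq z.1 z.2 ≠ 0} := by
    refine MeasurableSet.inter (measurable_fst (measurableSet_posDef_gramMat _ _)) ?_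
    exact (measurable_residSq measurable_fst measurable_snd) (measurableSet_singleton 0).compl
  have hae : ∀ᵐ z ∂((stdMat p nE).prod (normalVec (0 : Fin nE → ℝ))),
      (gramMat z.1).PosDef ∧ residSq z.1 z.2 ≠ 0 := by
    rw [Measure.ae_prod_iff_ae_ae hms]
    filter_upwards [ae_posDef_gramMat (show p ≤ nE by omega)] with Y hY
    filter_upwards [ae_residSq_ne_zero hnE hk hY] with y hy using ⟨hY, hy⟩
  exact Measure.measurePreserving_swap.quasiMeasurePreserving.ae hae

theorem ae_regular (hnE : nE = p + k) (hk : k ≠ 0) (θ : Fin nH → ℝ) :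
    ∀ᵐ z ∂(dataLaw p nE θ), (gramMat z.2.2).PosDef ∧ residSq z.2.2 z.2.1 ≠ 0 :=
  Measure.quasiMeasurePreserving_snd.ae (ae_regular_normal hnE hk)

theorem ae_posDef_blockWishart (hnE : nE = p + k) (hk : k ≠ 0) :
    ∀ᵐ E ∂(blockWishart p (0 : Fin nE → ℝ)), E.PosDef := by
  have hdet : ∀ᵐ E ∂(blockWishart p (0 : Fin nE → ℝ)), E.det ≠ 0 := by
    rw [blockWishart]
    refine (ae_map_iff (p := fun E : Matrix (Fin (p + 1)) (Fin (p + 1)) ℝ => E.det ≠ 0)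
      (Measurable.aemeasurable (by fun_prop))
      ((measurable_matrix_det measurable_id) (measurableSet_singleton 0).compl)).2 ?_
    filter_upwards [ae_regular_normal hnE hk] with z hz
    exact (posDef_gramMat_cons hz.1 hz.2).det_pos.ne'
  filter_upwards [hdet, ae_posSemidef_blockWishart 0] with E h1 h2
  exact h2.posDef_iff_det_ne_zero.2 h1

theorem ae_posSemidef_posDef_modelLaw (hnE : nE = p + k) (hk : k ≠ 0) (θ : Fin nH → ℝ) :
    ∀ᵐ W ∂(modelLaw p nE θ), W.1.PosSemidef ∧ W.2.PosDef :=
  (Measure.quasiMeasurePreserving_fst.ae (ae_posSemidef_blockWishart θ)).and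
    (Measure.quasiMeasurePreserving_snd.ae (ae_posDef_blockWishart hnE hk))

theorem map_leadTerm_schurTerm (hnH : nH ≠ 0) (hp : p ≠ 0) (hnE : nE = p + k) (hk : k ≠ 0)
    (θ : Fin nH → ℝ) {c₁ c₂ : ℝ} (hc₁ : c₁ = nH / k) (hc₂ : c₂ = p / (k + 1 : ℕ)) :
    (modelLaw p nE θ).map (fun W => (leadTerm 1 (e₀ p) W.1 W.2 / c₁,
      schurTerm 1 (e₀ p) W.1 W.2 / c₂)) =
      (noncentralF nH k (θ ⬝ᵥ θ)).prod (noncentralF p (k + 1) 0) := by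
  rw [← (measurePreserving_gramPair θ).map_eq, Measure.map_map (by fun_prop) (by fun_prop)]
  have hψ : Measurable fun q : ℝ × ℝ => (q.1 / (nH : ℝ)) / (q.2 / (k : ℝ)) := by fun_prop
  have hψ' : Measurable fun q : ℝ × ℝ => (q.1 / (p : ℝ)) / (q.2 / ((k + 1 : ℕ) : ℝ)) := by fun_prop
  have hmp := measurePreserving_chiSq_components hnH hp hnE θ
  rw [noncentralF, noncentralF, Measure.map_prod_map _ _ hψ hψ', ← hmp.map_eq,
    Measure.map_map (hψ.prodMap hψ') hmp.measurable]
  apply Measure.map_congr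
  filter_upwards [ae_regular hnE hk θ] with z hz
  simp only [Function.comp_apply, Prod.map_apply]
  rw [leadTerm_gramMat_cons _ _ hz.1 hz.2, schurTerm_gramMat_cons _ _ hz.1 hz.2, hc₁, hc₂,
    div_div_div_comm, div_div_div_comm (normCross z.1.2 z.1.1 ⬝ᵥ normCross z.1.2 z.1.1)]
  congr 2
  -- For zero cross products both sides vanish by the convention for division by zero, so no null
  -- set need be removed.
  rcases eq_or_ne (normCross z.1.2 z.1.1) 0 with h | h
  · simp [h]
  · rw [div_div_cancel₀ (dotProduct_self_pos h).ne']

/-- The reflection `y ↦ -y` preserves the law of the data, negates the regression coefficients and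
leaves the residual sum of squares unchanged. -/
theorem map_neg_crossTerm (hnE : nE = p + k) (hk : k ≠ 0) (θ : Fin nH → ℝ) :
    (modelLaw p nE θ).map (fun W => -crossTerm 1 (e₀ p) W.1 W.2) =
      (modelLaw p nE θ).map (fun W => crossTerm 1 (e₀ p) W.1 W.2) := by
  have hT : MeasurePreserving (fun z : ((Fin nH → ℝ) × (Fin p → Fin nH → ℝ)) ×
      ((Fin nE → ℝ) × (Fin p → Fin nE → ℝ)) => (z.1, ((-z.2.1 : Fin nE → ℝ), z.2.2)))
      (dataLaw p nE θ) (dataLaw p nE θ) :=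
    (MeasurePreserving.id _).prod
      (MeasurePreserving.prod ⟨by fun_prop, map_neg_normalVec_zero⟩ (MeasurePreserving.id _))
  rw [← (measurePreserving_gramPair θ).map_eq, Measure.map_map (by fun_prop) (by fun_prop),
    Measure.map_map (by fun_prop) (by fun_prop)]
  conv_rhs => rw [← hT.map_eq]
  rw [Measure.map_map (by fun_prop) hT.measurable]
  apply Measure.map_congr
  filter_upwards [ae_regular hnE hk θ] with z hz
  have hq : regCoeff z.2.2 (-z.2.1) = -regCoeff z.2.2 z.2.1 := by
    rw [regCoeff, mulVec_neg, mulVec_neg, regCoeff]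
  have hd : residSq z.2.2 (-z.2.1) = residSq z.2.2 z.2.1 := by
    rw [residSq, hq, mulVec_neg, neg_dotProduct_neg, neg_dotProduct_neg, residSq]
  have hd' : residSq z.2.2 (-z.2.1) ≠ 0 := hd.symm ▸ hz.2
  simp only [Function.comp_apply]
  rw [crossTerm_gramMat_cons _ _ hz.1 hz.2, crossTerm_gramMat_cons _ _ hz.1 hd', hd, hq,
    dotProduct_neg]
  ring

theorem lintegral_residualTerm (hnE : nE = p + k) (hk : 3 ≤ k) (θ : Fin nH → ℝ) :
    ∫⁻ W, ENNReal.ofReal (residualTerm 1 (e₀ p) W.1 W.2) ∂(modelLaw p nE θ) =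
      ENNReal.ofReal (((nH : ℝ) * p) / (((k : ℝ) - 1) * (k - 2))) := by
  have hk' : (3 : ℝ) ≤ k := by exact_mod_cast hk
  have h1 : (0 : ℝ) ≤ ((k : ℝ) - 1)⁻¹ := by
    have : (0 : ℝ) ≤ k - 1 := by linarith
    positivity
  rw [← (measurePreserving_gramPair θ).lintegral_comp (by fun_prop)]
  have h2 : ∫⁻ z, ENNReal.ofReal (residualTerm 1 (e₀ p) (gramPair z).1 (gramPair z).2)
      ∂(dataLaw p nE θ) = ∫⁻ z, ENNReal.ofReal (((regCoeff z.2.2 z.2.1 ᵥ* Matrix.of z.1.2) ⬝ᵥ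
        (regCoeff z.2.2 z.2.1 ᵥ* Matrix.of z.1.2)) / residSq z.2.2 z.2.1) ∂(dataLaw p nE θ) := by
    refine lintegral_congr_ae ?_
    filter_upwards [ae_regular hnE (by omega) θ] with z hz
    rw [residualTerm_gramMat_cons _ _ hz.1 hz.2]
  have hmp : MeasurePreserving (fun z : ((Fin nH → ℝ) × (Fin p → Fin nH → ℝ)) ×
      ((Fin nE → ℝ) × (Fin p → Fin nE → ℝ)) => (z.1.2, z.2)) (dataLaw p nE θ)
      ((stdMat p nH).prod ((normalVec 0).prod (stdMat p nE))) :=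
    measurePreserving_snd.prod (MeasurePreserving.id _)
  have h3 := lintegral_residual (nH := nH) hnE hk
  rw [← hmp.lintegral_comp (by fun_prop)] at h3
  rw [h2, h3, ← ENNReal.ofReal_natCast nH, ← ENNReal.ofReal_natCast p,
    ← ENNReal.ofReal_mul (by positivity), ← ENNReal.ofReal_mul (by positivity),
    ← ENNReal.ofReal_mul (by positivity)]
  congr 1
  rw [div_eq_mul_inv, mul_inv]
  ring

/-- Needed only for integrability of the cross term, which `abs_crossTerm_le` dominates by the lead
and residual terms. -/
theorem lintegral_leadTerm_lt_top (hnE : nE = p + k) (hk : 3 ≤ k) (θ : Fin nH → ℝ) :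
    ∫⁻ W, ENNReal.ofReal (leadTerm 1 (e₀ p) W.1 W.2) ∂(modelLaw p nE θ) < ⊤ := by
  rw [← (measurePreserving_gramPair θ).lintegral_comp (by fun_prop)]
  have h2 : ∫⁻ z, ENNReal.ofReal (leadTerm 1 (e₀ p) (gramPair z).1 (gramPair z).2)
      ∂(dataLaw p nE θ) = ∫⁻ z, ENNReal.ofReal (z.1.1 ⬝ᵥ z.1.1) *
        ENNReal.ofReal (residSq z.2.2 z.2.1)⁻¹ ∂(dataLaw p nE θ) := by
    refine lintegral_congr_ae ?_
    filter_upwards [ae_regular hnE (by omega) θ] with z hz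
    rw [leadTerm_gramMat_cons _ _ hz.1 hz.2, ← ENNReal.ofReal_mul (dotProduct_self_nonneg' _),
      div_eq_mul_inv]
  rw [h2, lintegral_prod_mul (f := fun z : (Fin nH → ℝ) × (Fin p → Fin nH → ℝ) =>
    ENNReal.ofReal (z.1 ⬝ᵥ z.1)) (g := fun z : (Fin nE → ℝ) × (Fin p → Fin nE → ℝ) =>
    ENNReal.ofReal (residSq z.2 z.1)⁻¹) (by fun_prop) (by fun_prop)]
  refine ENNReal.mul_lt_top ?_ ?_
  · have h := (measurePreserving_fst (μ := normalVec θ) (ν := stdMat p nH)).lintegral_comp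
      (f := fun x : Fin nH → ℝ => ENNReal.ofReal (x ⬝ᵥ x)) (by fun_prop)
    rw [h, ← map_add_normalVec_zero, lintegral_map (by fun_prop) (by fun_prop)]
    have hle (x : Fin nH → ℝ) : ENNReal.ofReal ((x + θ) ⬝ᵥ (x + θ)) ≤
        2 * ENNReal.ofReal (x ⬝ᵥ x) + 2 * ENNReal.ofReal (θ ⬝ᵥ θ) := by
      have h2 : (2 : ENNReal) = ENNReal.ofReal 2 := by simp
      have h3 : 0 ≤ x ⬝ᵥ x := dotProduct_self_nonneg' x
      have h4 : 0 ≤ θ ⬝ᵥ θ := dotProduct_self_nonneg' θ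
      rw [h2, ← ENNReal.ofReal_mul zero_le_two, ← ENNReal.ofReal_mul zero_le_two,
        ← ENNReal.ofReal_add (by positivity) (by positivity)]
      apply ENNReal.ofReal_le_ofReal
      have h5 := dotProduct_self_nonneg' (x - θ)
      rw [sub_dotProduct, dotProduct_sub, dotProduct_sub] at h5
      rw [add_dotProduct, dotProduct_add, dotProduct_add]
      linarith
    refine (lintegral_mono hle).trans_lt ?_
    rw [lintegral_add_right _ (by fun_prop), lintegral_const_mul _ (by fun_prop),
      lintegral_dotProduct_self_normalVec, lintegral_const, measure_univ, mul_one]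
    exact ENNReal.add_lt_top.2 ⟨ENNReal.mul_lt_top (by simp) (by simp),
      ENNReal.mul_lt_top (by simp) (by simp)⟩
  · have h := (measurePreserving_fst.comp (measurePreserving_residSq hnE)).lintegral_comp
      (f := fun d : ℝ => ENNReal.ofReal d⁻¹) (by fun_prop)
    simp only [Function.comp_apply] at h
    rw [h, lintegral_inv_noncentralChiSq hk]
    exact ENNReal.ofReal_lt_top

end Model

/-! ### Bounds for the terms -/

section Bounds

variable {m p : ℕ} {S H E : Matrix (Fin m) (Fin m) ℝ} {v : Fin m → ℝ}

theorem signalSq_nonneg (hH : H.PosSemidef) : 0 ≤ signalSq S v H := posSemidef_nonneg hH _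

/-- With `u = Qᵀ E⁻¹ v` the cross term is `2 wᵀHu`, while lead times residual term is
`(wᵀHw)(uᵀHu)`; this is Cauchy-Schwarz for `H`. -/
theorem crossTerm_sq_le (hH : H.PosSemidef) (he : 0 < v ⬝ᵥ (E⁻¹ *ᵥ v)) :
    crossTerm S v H E ^ 2 ≤ 4 * leadTerm S v H E * residualTerm S v H E := by
  set h := signalSq S v H with hh
  have hprod : leadTerm S v H E * residualTerm S v H E =
      h * (complProj S v (E⁻¹ *ᵥ v) ⬝ᵥ (H *ᵥ complProj S v (E⁻¹ *ᵥ v))) := by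
    rw [leadTerm, residualTerm, ← hh]
    field_simp
  rw [mul_assoc, hprod]
  rcases (signalSq_nonneg hH : 0 ≤ signalSq S v H).eq_or_lt with h0 | h0
  · rw [← hh] at h0
    rw [crossTerm, ← hh, ← h0]
    simp
  · rw [← hh] at h0
    have hsq : √h ≠ 0 := (Real.sqrt_pos.2 h0).ne'
    have hcross : crossTerm S v H E =
        2 * ((S⁻¹ *ᵥ v) ⬝ᵥ (H *ᵥ complProj S v (E⁻¹ *ᵥ v))) := by
      rw [crossTerm, crossVec, ← hh, smul_dotProduct, smul_eq_mul, mul_assoc,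
        mul_inv_cancel_left₀ hsq, complProj, mulVec_sub, mulVec_smul, dotProduct_sub,
        dotProduct_smul, smul_eq_mul, sub_dotProduct, smul_dotProduct, smul_eq_mul,
        dotProduct_mulVec_comm (posSemidef_transpose_eq hH) (S⁻¹ *ᵥ v) (E⁻¹ *ᵥ v),
        dotProduct_comm (H *ᵥ _), hh, signalSq]
      ring
    have := posSemidef_cauchy_schwarz hH (S⁻¹ *ᵥ v) (complProj S v (E⁻¹ *ᵥ v))
    rw [hcross, mul_pow]
    have h4 : signalSq S v H = (S⁻¹ *ᵥ v) ⬝ᵥ (H *ᵥ (S⁻¹ *ᵥ v)) := rfl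
    rw [hh, h4]
    linarith

theorem residualTerm_nonneg (hH : H.PosSemidef) (he : 0 ≤ v ⬝ᵥ (E⁻¹ *ᵥ v)) :
    0 ≤ residualTerm S v H E :=
  div_nonneg (posSemidef_nonneg hH _) he

theorem leadTerm_nonneg (hH : H.PosSemidef) (he : 0 ≤ v ⬝ᵥ (E⁻¹ *ᵥ v)) :
    0 ≤ leadTerm S v H E :=
  mul_nonneg (signalSq_nonneg hH) he

theorem abs_crossTerm_le (hH : H.PosSemidef) (he : 0 < v ⬝ᵥ (E⁻¹ *ᵥ v)) :
    |crossTerm S v H E| ≤ leadTerm S v H E + residualTerm S v H E := by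
  have h1 := leadTerm_nonneg (S := S) hH he.le
  have h2 := residualTerm_nonneg (S := S) hH he.le
  apply abs_le_of_sq_le_sq _ (by positivity)
  nlinarith [crossTerm_sq_le (S := S) hH he, sq_nonneg (leadTerm S v H E - residualTerm S v H E)]

theorem inv_quadForm_e₀_pos {E : Matrix (Fin (p + 1)) (Fin (p + 1)) ℝ} (hE : E.PosDef) :
    0 < e₀ p ⬝ᵥ (E⁻¹ *ᵥ e₀ p) := by
  have h : e₀ p ≠ 0 := by simp [e₀]
  simpa using hE.inv.dotProduct_mulVec_pos h

/-- The matrix obtained from `H` by replacing its first row and first column by zeros. -/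
def lowerBlock {p : ℕ} (H : Matrix (Fin (p + 1)) (Fin (p + 1)) ℝ) :
    Matrix (Fin (p + 1)) (Fin (p + 1)) ℝ :=
  Matrix.diagonal (vecCons 0 1) * H * (Matrix.diagonal (vecCons 0 1))ᵀ

/-- A bound for the size of `(H, E)` that does not involve the signal. -/
def noiseSize {p : ℕ} (H E : Matrix (Fin (p + 1)) (Fin (p + 1)) ℝ) : ℝ :=
  e₀ p ⬝ᵥ (E⁻¹ *ᵥ e₀ p) + (e₀ p ⬝ᵥ (E⁻¹ *ᵥ e₀ p))⁻¹ + (E⁻¹ * lowerBlock H).trace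

theorem complProj_e₀ (x : Fin (p + 1) → ℝ) :
    complProj 1 (e₀ p) x = (Matrix.diagonal (vecCons 0 1))ᵀ *ᵥ x := by
  have : x = vecCons (x 0) (vecTail x) := (cons_head_tail x).symm
  rw [this, complProj_cons, diagonal_transpose]
  ext i
  rw [mulVec_diagonal]
  refine Fin.cases ?_ (fun i => ?_) i <;> simp

theorem complProj_quadForm (H : Matrix (Fin (p + 1)) (Fin (p + 1)) ℝ) (x : Fin (p + 1) → ℝ) :
    complProj 1 (e₀ p) x ⬝ᵥ (H *ᵥ complProj 1 (e₀ p) x) = x ⬝ᵥ (lowerBlock H *ᵥ x) := by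
  rw [complProj_e₀, lowerBlock, ← mulVec_mulVec, ← mulVec_mulVec, dotProduct_mulVec x,
    mulVec_transpose]

theorem posSemidef_lowerBlock {H : Matrix (Fin (p + 1)) (Fin (p + 1)) ℝ} (hH : H.PosSemidef) :
    (lowerBlock H).PosSemidef := by
  have := hH.mul_mul_conjTranspose_same (Matrix.diagonal (vecCons (0 : ℝ) (1 : Fin p → ℝ)))
  rwa [conjTranspose_eq_transpose_of_trivial] at this

/-- The vector carrying the mean is replaced by zero, so `noiseSize` is a function of standard
normal data only. -/
theorem lowerBlock_gramMat_cons {n : ℕ} (x : Fin n → ℝ) (X : Fin p → Fin n → ℝ) :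
    lowerBlock (gramMat (vecCons x X)) = gramMat (vecCons 0 X) := by
  rw [lowerBlock, ← gramMat_leftMul]
  congr 1
  ext j i
  rw [leftMul, diagonal_mul]
  refine Fin.cases ?_ (fun j => ?_) j <;> simp

theorem trace_inv_mul_lowerBlock_nonneg {H E : Matrix (Fin (p + 1)) (Fin (p + 1)) ℝ}
    (hH : H.PosSemidef) (hE : E.PosDef) : 0 ≤ (E⁻¹ * lowerBlock H).trace := by
  have h := quadForm_le_trace_mul hE (posSemidef_lowerBlock hH) (e₀ p)
  have h2 := posSemidef_nonneg (posSemidef_lowerBlock hH) (e₀ p)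
  have h3 : 0 < e₀ p ⬝ᵥ (E *ᵥ e₀ p) := by
    have h : e₀ p ≠ 0 := by simp [e₀]
    simpa using hE.dotProduct_mulVec_pos h
  exact nonneg_of_mul_nonneg_left (h2.trans h) h3

/-- All three summands of `noiseSize` are nonnegative, so each is at most `M`; they give one
conclusion each. -/
theorem le_of_noiseSize_le {H E : Matrix (Fin (p + 1)) (Fin (p + 1)) ℝ} (hH : H.PosSemidef)
    (hE : E.PosDef) {M : ℝ} (hM : noiseSize H E ≤ M) :
    e₀ p ⬝ᵥ (E⁻¹ *ᵥ e₀ p) ≤ M ∧ 1 ≤ M * (e₀ p ⬝ᵥ (E⁻¹ *ᵥ e₀ p)) ∧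
      ∀ x, complProj 1 (e₀ p) x ⬝ᵥ (H *ᵥ complProj 1 (e₀ p) x) ≤ M * (x ⬝ᵥ (E *ᵥ x)) := by
  have h1 := inv_quadForm_e₀_pos hE
  have h2 := trace_inv_mul_lowerBlock_nonneg hH hE
  have h3 : 0 < (e₀ p ⬝ᵥ (E⁻¹ *ᵥ e₀ p))⁻¹ := inv_pos.2 h1
  rw [noiseSize] at hM
  refine ⟨by linarith, ?_, fun x => ?_⟩
  · rw [← inv_mul_cancel₀ h1.ne']
    gcongr
    linarith
  · rw [complProj_quadForm]
    refine (quadForm_le_trace_mul hE (posSemidef_lowerBlock hH) x).trans ?_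
    have := posSemidef_nonneg hE.posSemidef x
    gcongr
    linarith

theorem residualTerm_le_of_noiseSize_le {H E : Matrix (Fin (p + 1)) (Fin (p + 1)) ℝ}
    (hH : H.PosSemidef) (hE : E.PosDef) {M : ℝ} (hM : noiseSize H E ≤ M) :
    residualTerm 1 (e₀ p) H E ≤ M := by
  have h1 := inv_quadForm_e₀_pos hE
  rw [residualTerm, div_le_iff₀ h1]
  refine ((le_of_noiseSize_le hH hE hM).2.2 _).trans_eq ?_
  rw [mulVec_mulVec, mul_nonsing_inv _ hE.det_pos.ne'.isUnit, one_mulVec, dotProduct_comm (E⁻¹ *ᵥ _)]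

/-- A signal of at least `ω/4` has root at least `√ω/2`, which doubles the constants `4` and `16` of
the deterministic expansion. -/
theorem largestRoot_expansion_le {H E : Matrix (Fin (p + 1)) (Fin (p + 1)) ℝ}
    (hH : H.PosSemidef) (hE : E.PosDef) {M ω : ℝ} (hM1 : 1 ≤ M) (hM : noiseSize H E ≤ M)
    (hω : 8 * M ^ 2 ≤ √ω) (h1 : ω / 4 ≤ signalSq 1 (e₀ p) H) :
    |largestRoot (E⁻¹ * H) - (leadTerm 1 (e₀ p) H E + schurTerm 1 (e₀ p) H E +
      crossTerm 1 (e₀ p) H E + residualTerm 1 (e₀ p) H E)| ≤ 32 * M ^ 5 * (√ω)⁻¹ := by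
  obtain ⟨h2, h3, h4⟩ := le_of_noiseSize_le hH hE hM
  have hω0 : 0 < √ω := lt_of_lt_of_le (by positivity) hω
  have hs : √ω / 2 ≤ √(signalSq 1 (e₀ p) H) := by
    apply Real.le_sqrt_of_sq_le
    rw [div_pow, Real.sq_sqrt (Real.sqrt_pos.1 hω0).le]
    linarith
  have hs0 : 0 < √(signalSq 1 (e₀ p) H) := by linarith
  refine (largestRoot_expansion_of_posDef hH hE (by simp) hM1 h2 h3 h4 (by linarith)).trans ?_
  rw [← div_eq_mul_inv, div_le_div_iff₀ hs0 hω0]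
  have : 0 ≤ M ^ 5 := by positivity
  nlinarith

theorem abs_crossTerm_le_sqrt {H E : Matrix (Fin (p + 1)) (Fin (p + 1)) ℝ}
    (hH : H.PosSemidef) (hE : E.PosDef) {M ω : ℝ} (hM1 : 1 ≤ M) (hM : noiseSize H E ≤ M)
    (hω : 0 ≤ ω) (h2 : signalSq 1 (e₀ p) H ≤ 4 * ω) :
    |crossTerm 1 (e₀ p) H E| ≤ 4 * M * √ω := by
  have he := inv_quadForm_e₀_pos hE
  apply abs_le_of_sq_le_sq _ (by positivity)
  refine (crossTerm_sq_le hH he).trans ?_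
  have h5 : leadTerm 1 (e₀ p) H E ≤ 4 * ω * M :=
    mul_le_mul h2 (le_of_noiseSize_le hH hE hM).1 he.le (by positivity)
  have h6 := residualTerm_le_of_noiseSize_le hH hE hM
  have h7 := residualTerm_nonneg (S := 1) hH he.le
  rw [mul_pow, Real.sq_sqrt hω]
  calc 4 * leadTerm 1 (e₀ p) H E * residualTerm 1 (e₀ p) H E ≤ 4 * (4 * ω * M) * M := by gcongr
    _ = _ := by ring

end Bounds

/-! ### Probability of the regular event -/

section Tight

variable {p nH nE k : ℕ}

@[fun_prop]
theorem measurable_noiseSize {α : Type*} [MeasurableSpace α]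
    {f g : α → Matrix (Fin (p + 1)) (Fin (p + 1)) ℝ} (hf : Measurable f) (hg : Measurable g) :
    Measurable fun a => noiseSize (f a) (g a) := by
  unfold noiseSize lowerBlock
  fun_prop

/-- The quantifier over `θ` comes after `K`: the law of `noiseSize` is the image of a fixed
probability measure, the same for every `θ`. -/
theorem exists_noiseSize_le (p nH nE : ℕ) {η : ℝ} (hη : 0 < η) :
    ∃ K, ∀ θ : Fin nH → ℝ, ∀ M ≥ K,
      modelLaw p nE θ {W | M < noiseSize W.1 W.2} ≤ ENNReal.ofReal η := by
  let f : (Fin p → Fin nH → ℝ) × ((Fin nE → ℝ) × (Fin p → Fin nE → ℝ)) → ℝ := fun z =>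
    noiseSize (gramMat (vecCons 0 z.1)) (gramMat (vecCons z.2.1 z.2.2))
  have hf : Measurable f := by fun_prop
  have : IsProbabilityMeasure
      (((stdMat p nH).prod ((normalVec (0 : Fin nE → ℝ)).prod (stdMat p nE))).map f) :=
    Measure.isProbabilityMeasure_map hf.aemeasurable
  obtain ⟨K, hK⟩ := exists_measure_Ioi_le
    (((stdMat p nH).prod ((normalVec (0 : Fin nE → ℝ)).prod (stdMat p nE))).map f) hη
  refine ⟨K, fun θ M hM => le_trans (le_of_eq ?_) (hK M hM)⟩
  have hmp : MeasurePreserving (fun z : ((Fin nH → ℝ) × (Fin p → Fin nH → ℝ)) ×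
      ((Fin nE → ℝ) × (Fin p → Fin nE → ℝ)) => (z.1.2, z.2)) (dataLaw p nE θ)
      ((stdMat p nH).prod ((normalVec 0).prod (stdMat p nE))) :=
    measurePreserving_snd.prod (MeasurePreserving.id _)
  have hm : Measurable fun W : Matrix (Fin (p + 1)) (Fin (p + 1)) ℝ ×
      Matrix (Fin (p + 1)) (Fin (p + 1)) ℝ => noiseSize W.1 W.2 := by fun_prop
  rw [← (measurePreserving_gramPair θ).map_eq, Measure.map_apply (by fun_prop)
    (measurableSet_lt measurable_const hm), ← hmp.map_eq, Measure.map_map hf hmp.measurable,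
    Measure.map_apply (hf.comp hmp.measurable) measurableSet_Ioi]
  congr 1
  ext z
  simp only [Set.mem_preimage, Set.mem_ofPred_eq, Function.comp_apply, Set.mem_Ioi, f, noiseSize,
    lowerBlock_gramMat_cons]

theorem map_signalSq (hnH : nH ≠ 0) (θ : Fin nH → ℝ) :
    (modelLaw p nE θ).map (fun W => signalSq 1 (e₀ p) W.1) = noncentralChiSq nH (θ ⬝ᵥ θ) := by
  have hmp := (measurePreserving_fst.comp
    (measurePreserving_signal (p := p) hnH θ)).comp (measurePreserving_fst (μ :=
      (normalVec θ).prod (stdMat p nH)) (ν := (normalVec (0 : Fin nE → ℝ)).prod (stdMat p nE)))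
  rw [← hmp.map_eq, ← (measurePreserving_gramPair θ).map_eq,
    Measure.map_map (by fun_prop) (by fun_prop)]
  congr 1
  ext z
  exact signalSq_gramMat_cons _ _

/-- The event that `(H, E)` is nondegenerate, with noise bounded by `M` and signal of order `ω`. -/
def regularEvent (p : ℕ) (M ω : ℝ) :
    Set (Matrix (Fin (p + 1)) (Fin (p + 1)) ℝ × Matrix (Fin (p + 1)) (Fin (p + 1)) ℝ) :=
  {W | W.1.PosSemidef ∧ W.2.PosDef ∧ noiseSize W.1 W.2 ≤ M ∧
    signalSq 1 (e₀ p) W.1 ∈ Set.Icc (ω / 4) (4 * ω)}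

theorem exists_measure_compl_regularEvent_le (hnH : nH ≠ 0) (hnE : nE = p + k) (hk : k ≠ 0) {η : ℝ}
    (hη : 0 < η) :
    ∃ M, 1 ≤ M ∧ ∀ᶠ ω in atTop, ∀ θ : Fin nH → ℝ, θ ⬝ᵥ θ = ω →
      modelLaw p nE θ (regularEvent p M ω)ᶜ ≤ ENNReal.ofReal η := by
  obtain ⟨K, hK⟩ := exists_noiseSize_le p nH nE (half_pos hη)
  refine ⟨max K 1, le_max_right _ _, ?_⟩
  filter_upwards [tendsto_noncentralChiSq_compl_Icc hnH (half_pos hη)] with ω hω θ hθ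
  have hsub : (regularEvent p (max K 1) ω)ᶜ ⊆ {W | ¬(W.1.PosSemidef ∧ W.2.PosDef)} ∪
      ({W | max K 1 < noiseSize W.1 W.2} ∪
        (fun W => signalSq 1 (e₀ p) W.1) ⁻¹' (Set.Icc (ω / 4) (4 * ω))ᶜ) := by
    intro W hW
    by_contra hcon
    simp only [Set.mem_union, Set.mem_ofPred_eq, not_or, not_not, not_lt, Set.mem_preimage,
      Set.mem_compl_iff] at hcon
    exact hW ⟨hcon.1.1, hcon.1.2, hcon.2.1, hcon.2.2⟩
  refine (measure_mono hsub).trans ((measure_union_le _ _).trans ?_)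
  rw [ae_iff.1 (ae_posSemidef_posDef_modelLaw hnE hk θ), zero_add]
  refine (measure_union_le _ _).trans ?_
  rw [← add_halves η, ENNReal.ofReal_add (by positivity) (by positivity)]
  refine add_le_add (hK θ _ (le_max_left _ _)) ?_
  rw [← Measure.map_apply (by fun_prop) measurableSet_Icc.compl, map_signalSq hnH, hθ]
  exact hω

end Tight

/-! ### Anticoncentration of the approximating law -/

section Concentration

variable {a₁ b₁ a₂ b₂ : ℕ} {c₁ : ℝ}

theorem exists_concentration_inv_noncentralChiSq {k : ℕ} (hk : k ≠ 0) {η : ℝ} (hη : 0 < η) :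
    ∃ δ > 0, ∀ s, noncentralChiSq k 0 {q | q⁻¹ ∈ Set.Icc (s - δ) (s + δ)} ≤ ENNReal.ofReal η := by
  have : IsProbabilityMeasure ((noncentralChiSq k 0).map fun q => q⁻¹) :=
    Measure.isProbabilityMeasure_map (by fun_prop)
  obtain ⟨δ, hδ, h⟩ := exists_concentration_le ((noncentralChiSq k 0).map fun q => q⁻¹)
    (fun c => by
      rw [Measure.map_apply (by fun_prop) (measurableSet_singleton c), Set.inv_preimage,
        Set.inv_singleton, noncentralChiSq_singleton hk]) hη
  refine ⟨δ, hδ, fun s => ?_⟩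
  have h2 := h s
  rwa [Measure.map_apply (by fun_prop) measurableSet_Icc] at h2

/-- Here `c₁ x = h/q` with independent chi-squares. For `h ≥ ω/4` the window of half-width `K√ω`
becomes, after division by `h`, one of half-width at most `4K/√ω` for the atomless variable `1/q`.
-/
theorem eventually_noncentralF_concentration_le (ha₁ : a₁ ≠ 0) (hb₁ : b₁ ≠ 0) (hc₁ : c₁ = a₁ / b₁)
    (K : ℝ) {η : ℝ} (hη : 0 < η) :
    ∀ᶠ ω in atTop, ∀ s, noncentralF a₁ b₁ ω
      {x | c₁ * x ∈ Set.Icc (s - K * √ω) (s + K * √ω)} ≤ ENNReal.ofReal η := by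
  obtain ⟨δ, hδ, hconc⟩ := exists_concentration_inv_noncentralChiSq hb₁ (half_pos hη)
  have hlarge : ∀ᶠ ω in atTop, 4 * K / δ ≤ √ω := Real.tendsto_sqrt_atTop.eventually_ge_atTop _
  filter_upwards [tendsto_noncentralChiSq_compl_Icc ha₁ (half_pos hη), hlarge,
    eventually_gt_atTop 0] with ω h1 h2 hω s
  have hms : MeasurableSet {x | c₁ * x ∈ Set.Icc (s - K * √ω) (s + K * √ω)} :=
    (measurable_const_mul c₁) measurableSet_Icc
  have hψ : Measurable fun q : ℝ × ℝ => (q.1 / (a₁ : ℝ)) / (q.2 / (b₁ : ℝ)) := by fun_prop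
  rw [noncentralF, Measure.map_apply hψ hms,
    Measure.prod_apply (hψ hms)]
  -- Atypical values of the numerator are charged their full mass through the indicator.
  have hle (h : ℝ) : noncentralChiSq b₁ 0 (Prod.mk h ⁻¹'
      ((fun q : ℝ × ℝ => (q.1 / (a₁ : ℝ)) / (q.2 / (b₁ : ℝ))) ⁻¹'
        {x | c₁ * x ∈ Set.Icc (s - K * √ω) (s + K * √ω)})) ≤
      (Set.Icc (ω / 4) (4 * ω))ᶜ.indicator 1 h + ENNReal.ofReal (η / 2) := by
    by_cases hh : h ∈ Set.Icc (ω / 4) (4 * ω)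
    · rw [Set.indicator_of_notMem (by simpa using hh), zero_add]
      refine (measure_mono ?_).trans (hconc (s / h))
      intro q hq
      have hh0 : 0 < h := by linarith [hh.1]
      have hscale : c₁ * ((h / a₁) / (q / b₁)) = h * q⁻¹ := by
        have : (a₁ : ℝ) ≠ 0 := by exact_mod_cast ha₁
        have : (b₁ : ℝ) ≠ 0 := by exact_mod_cast hb₁
        rw [hc₁, div_div_div_eq]
        rcases eq_or_ne q 0 with rfl | hq0
        · simp
        · field_simp
      have hδh : K * √ω ≤ δ * h := by
        rw [div_le_iff₀ hδ] at h2
        have h3 := Real.mul_self_sqrt hω.le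
        have h4 : 4 * K * √ω ≤ √ω * δ * √ω := by gcongr
        have h5 : δ * (ω / 4) ≤ δ * h := by gcongr; exact hh.1
        have h6 : √ω * δ * √ω = δ * ω := by rw [mul_right_comm, h3, mul_comm]
        linarith
      simp only [Set.mem_preimage, Set.mem_ofPred_eq, hscale, Set.mem_Icc] at hq ⊢
      have h7 : h * (s / h) = s := mul_div_cancel₀ _ hh0.ne'
      constructor
      · refine le_of_mul_le_mul_left ?_ hh0
        rw [mul_sub, h7]
        linarith [hq.1]
      · refine le_of_mul_le_mul_left ?_ hh0
        rw [mul_add, h7]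
        linarith [hq.2]
    · rw [Set.indicator_of_mem (by simpa using hh)]
      exact prob_le_one.trans le_self_add
  refine (lintegral_mono hle).trans ?_
  rw [lintegral_add_right _ (by fun_prop), lintegral_indicator_one measurableSet_Icc.compl,
    lintegral_const, measure_univ, mul_one]
  refine (add_le_add_left h1 _).trans_eq ?_
  rw [← ENNReal.ofReal_add (by positivity) (by positivity), add_halves]

/-- Conditioning on the second variate only translates the window, and the bound for the first is
uniform in its centre. -/
theorem eventually_combinedFLaw_concentration_le (ha₁ : a₁ ≠ 0) (hb₁ : b₁ ≠ 0)
    (hc₁ : c₁ = a₁ / b₁) (c₂ c K : ℝ) {η : ℝ} (hη : 0 < η) :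
    ∀ᶠ ω in atTop, ∀ t, combinedFLaw a₁ b₁ a₂ b₂ c₁ c₂ c ω
      (Set.Icc (t - K * √ω) (t + K * √ω)) ≤ ENNReal.ofReal η := by
  filter_upwards [eventually_noncentralF_concentration_le ha₁ hb₁ hc₁ K hη] with ω hω t
  have hm : Measurable fun q : ℝ × ℝ => c₁ * q.1 + c₂ * q.2 + c := by fun_prop
  rw [combinedFLaw, Measure.map_apply hm measurableSet_Icc,
    Measure.prod_apply_symm (hm measurableSet_Icc)]
  refine (lintegral_mono (g := fun _ => ENNReal.ofReal η) fun y => ?_).trans_eq (by simp)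
  refine (measure_mono ?_).trans (hω (t - c₂ * y - c))
  intro x hx
  simp only [Set.mem_preimage, Set.mem_Icc, Set.mem_ofPred_eq] at hx ⊢
  constructor <;> linarith [hx.1, hx.2]

end Concentration

/-! ### Transfer to the general model -/

section Transfer

variable {𝓧 : Type*} [MeasurableSpace 𝓧] {P : Measure 𝓧}

theorem hasLaw_comp_of_map_eq {α β : Type*} [MeasurableSpace α] [MeasurableSpace β] {μ : Measure α}
    {ν : Measure β} {Φ : 𝓧 → α} {Y : α → β} (h : HasLaw Φ μ P) (hY : Measurable Y)
    (hmap : μ.map Y = ν) : HasLaw (fun x => Y (Φ x)) ν P :=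
  HasLaw.comp ⟨hY.aemeasurable, hmap⟩ h

theorem integrable_comp_of_hasLaw {α : Type*} [MeasurableSpace α] {μ : Measure α}
    {Φ : 𝓧 → α} {Y : α → ℝ} (h : HasLaw Φ μ P) (hY : Integrable Y μ) :
    Integrable (fun x => Y (Φ x)) P := by
  rw [← h.map_eq] at hY
  exact hY.comp_aemeasurable h.aemeasurable

theorem hasLaw_leadTerm_schurTerm {p nH nE k : ℕ} (hnH : nH ≠ 0) (hp : p ≠ 0) (hnE : nE = p + k)
    (hk : k ≠ 0) {θ : Fin nH → ℝ} {c₁ c₂ : ℝ} (hc₁ : c₁ = nH / k) (hc₂ : c₂ = p / (k + 1 : ℕ))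
    {Φ : 𝓧 → Matrix (Fin (p + 1)) (Fin (p + 1)) ℝ × Matrix (Fin (p + 1)) (Fin (p + 1)) ℝ}
    (h : HasLaw Φ (modelLaw p nE θ) P) :
    HasLaw (fun x => (leadTerm 1 (e₀ p) (Φ x).1 (Φ x).2 / c₁,
        schurTerm 1 (e₀ p) (Φ x).1 (Φ x).2 / c₂))
      ((noncentralF nH k (θ ⬝ᵥ θ)).prod (noncentralF p (k + 1) 0)) P:= by
  have hmap := map_leadTerm_schurTerm hnH hp hnE hk θ hc₁ hc₂
  have hm : Measurable fun W : Matrix (Fin (p + 1)) (Fin (p + 1)) ℝ ×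
      Matrix (Fin (p + 1)) (Fin (p + 1)) ℝ =>
      (leadTerm 1 (e₀ p) W.1 W.2 / c₁, schurTerm 1 (e₀ p) W.1 W.2 / c₂) := by fun_prop
  exact hasLaw_comp_of_map_eq h hm hmap

variable [IsProbabilityMeasure P]

theorem exists_hasLaw_modelLaw {p nH nE : ℕ} {S A : Matrix (Fin (p + 1)) (Fin (p + 1)) ℝ}
    {v : Fin (p + 1) → ℝ} {H E : 𝓧 → Matrix (Fin (p + 1)) (Fin (p + 1)) ℝ} {ω : ℝ}
    (hS : S.PosDef) (hA : A * S * Aᵀ = 1) (hAv : A *ᵥ v = e₀ p)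
    (hH : IsWishart P H nH S (ω • (S⁻¹ * vecMulVec v v))) (hE : IsWishart P E nE S 0)
    (hHE : IndepFun H E P) :
    ∃ θ : Fin nH → ℝ, θ ⬝ᵥ θ = ω ∧
      HasLaw (fun x => (A * H x * Aᵀ, A * E x * Aᵀ)) (modelLaw p nE θ) P := by
  obtain ⟨θ, hθ, hlH⟩ := hH.exists_hasLaw_blockWishart hS hA hAv
  obtain ⟨θ', hθ', hlE⟩ := IsWishart.exists_hasLaw_blockWishart (c := 0) hS hA hAv
    (by rwa [zero_smul])
  obtain rfl := dotProduct_self_eq_zero.1 hθ'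
  refine ⟨θ, hθ, hlH.aemeasurable.prodMk hlE.aemeasurable, ?_⟩
  have hm : Measurable fun W : Matrix (Fin (p + 1)) (Fin (p + 1)) ℝ => A * W * Aᵀ := by fun_prop
  have hind : IndepFun (fun x => A * H x * Aᵀ) (fun x => A * E x * Aᵀ) P := hHE.comp hm hm
  rw [(indepFun_iff_map_prod_eq_prod_map_map hlH.aemeasurable hlE.aemeasurable).1 hind,
    hlH.map_eq, hlE.map_eq]

theorem hasLaw_and_indepFun_of_hasLaw_prod {F G : 𝓧 → ℝ} {μ ν : Measure ℝ}
    [IsProbabilityMeasure μ] [IsProbabilityMeasure ν]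
    (h : HasLaw (fun x => (F x, G x)) (μ.prod ν) P) :
    HasLaw F μ P ∧ HasLaw G ν P ∧ IndepFun F G P := by
  have hF : HasLaw F μ P := measurePreserving_fst.comp_hasLaw h
  have hG : HasLaw G ν P := measurePreserving_snd.comp_hasLaw h
  exact ⟨hF, hG, (indepFun_iff_hasLaw_prodMk_prod hF hG).2 h⟩

/-- Two random variables that differ by at most `δ` with high probability have close distribution
functions, if the law of one of them puts little mass on intervals of length `2 δ`. -/
theorem abs_sub_measureReal_Iic_le {l Y : 𝓧 → ℝ} {μ : Measure ℝ} [IsProbabilityMeasure μ]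
    (hY : HasLaw Y μ P) {δ η : ℝ} (hη : 0 ≤ η)
    (hB : P {x | δ < |l x - Y x|} ≤ ENNReal.ofReal η) (t : ℝ)
    (hμ : μ (Set.Icc (t - δ) (t + δ)) ≤ ENNReal.ofReal η) :
    |P.real {x | l x ≤ t} - μ.real (Set.Iic t)| ≤ 2 * η := by
  have hreal {s : Set ℝ} (hs : MeasurableSet s) : P.real (Y ⁻¹' s) = μ.real s := by
    rw [Measure.real, Measure.real, ← hY.map_eq, Measure.map_apply_of_aemeasurable hY.aemeasurable hs]
  have hB' : P.real {x | δ < |l x - Y x|} ≤ η := ENNReal.toReal_le_of_le_ofReal hη hB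
  have hμ' : P.real (Y ⁻¹' Set.Icc (t - δ) (t + δ)) ≤ η := by
    rw [hreal measurableSet_Icc]
    exact ENNReal.toReal_le_of_le_ofReal hη hμ
  rw [← hreal measurableSet_Iic]
  have h1 : P.real {x | l x ≤ t} ≤ P.real (Y ⁻¹' Set.Iic t) +
      (P.real (Y ⁻¹' Set.Icc (t - δ) (t + δ)) + P.real {x | δ < |l x - Y x|}) := by
    refine le_trans (measureReal_mono ?_) ((measureReal_union_le _ _).trans
      (add_le_add_right (measureReal_union_le _ _) _))
    intro x hx
    by_contra hcon
    simp only [Set.mem_union, Set.mem_preimage, Set.mem_Iic, Set.mem_Icc, Set.mem_ofPred_eq, not_or,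
      not_le, not_lt, not_and] at hcon hx
    have := abs_le.1 hcon.2.2
    linarith [hcon.2.1 (by linarith)]
  have h2 : P.real (Y ⁻¹' Set.Iic t) ≤ P.real {x | l x ≤ t} +
      (P.real (Y ⁻¹' Set.Icc (t - δ) (t + δ)) + P.real {x | δ < |l x - Y x|}) := by
    refine le_trans (measureReal_mono ?_) ((measureReal_union_le _ _).trans
      (add_le_add_right (measureReal_union_le _ _) _))
    intro x hx
    by_contra hcon
    simp only [Set.mem_union, Set.mem_preimage, Set.mem_Iic, Set.mem_Icc, Set.mem_ofPred_eq, not_or,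
      not_le, not_lt, not_and] at hcon hx
    have := abs_le.1 hcon.2.2
    linarith [hcon.2.1 (by linarith)]
  rw [abs_le]
  constructor <;> linarith

end Transfer

/-! ### Means of the cross and residual terms, and the total error on the regular event -/

section Moments

variable {p nH nE k : ℕ}

theorem integrable_residualTerm (hnE : nE = p + k) (hk : 3 ≤ k) (θ : Fin nH → ℝ) :
    Integrable (fun W => residualTerm 1 (e₀ p) W.1 W.2) (modelLaw p nE θ) ∧
      ∫ W, residualTerm 1 (e₀ p) W.1 W.2 ∂(modelLaw p nE θ) =
        ((nH : ℝ) * p) / (((k : ℝ) - 1) * (k - 2)) := by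
  have hm : Measurable fun W : Matrix (Fin (p + 1)) (Fin (p + 1)) ℝ ×
      Matrix (Fin (p + 1)) (Fin (p + 1)) ℝ => residualTerm 1 (e₀ p) W.1 W.2 := by fun_prop
  have h0 : ∀ᵐ W ∂(modelLaw p nE θ), 0 ≤ residualTerm 1 (e₀ p) W.1 W.2 := by
    filter_upwards [ae_posSemidef_posDef_modelLaw hnE (by omega) θ] with W hW
    exact residualTerm_nonneg hW.1 (inv_quadForm_e₀_pos hW.2).le
  have hk' : (3 : ℝ) ≤ k := by exact_mod_cast hk
  constructor
  · refine (lintegral_ofReal_ne_top_iff_integrable hm.aestronglyMeasurable h0).1 ?_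
    rw [lintegral_residualTerm hnE hk]
    exact ENNReal.ofReal_ne_top
  · rw [integral_eq_lintegral_of_nonneg_ae h0 hm.aestronglyMeasurable,
      lintegral_residualTerm hnE hk, ENNReal.toReal_ofReal]
    exact div_nonneg (by positivity) (mul_nonneg (by linarith) (by linarith))

theorem integrable_crossTerm (hnE : nE = p + k) (hk : 3 ≤ k) (θ : Fin nH → ℝ) :
    Integrable (fun W => crossTerm 1 (e₀ p) W.1 W.2) (modelLaw p nE θ) := by
  have hm : Measurable fun W : Matrix (Fin (p + 1)) (Fin (p + 1)) ℝ ×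
      Matrix (Fin (p + 1)) (Fin (p + 1)) ℝ => crossTerm 1 (e₀ p) W.1 W.2 := by fun_prop
  have hml : Measurable fun W : Matrix (Fin (p + 1)) (Fin (p + 1)) ℝ ×
      Matrix (Fin (p + 1)) (Fin (p + 1)) ℝ => leadTerm 1 (e₀ p) W.1 W.2 := by fun_prop
  have hae := ae_posSemidef_posDef_modelLaw hnE (by omega : k ≠ 0) θ
  have hl : Integrable (fun W => leadTerm 1 (e₀ p) W.1 W.2) (modelLaw p nE θ) := by
    refine (lintegral_ofReal_ne_top_iff_integrable hml.aestronglyMeasurable ?_).1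
      (lintegral_leadTerm_lt_top hnE hk θ).ne
    filter_upwards [hae] with W hW using leadTerm_nonneg hW.1 (inv_quadForm_e₀_pos hW.2).le
  refine (hl.add (integrable_residualTerm hnE hk θ).1).mono' hm.aestronglyMeasurable ?_
  filter_upwards [hae] with W hW using abs_crossTerm_le hW.1 (inv_quadForm_e₀_pos hW.2)

theorem integral_crossTerm (hnE : nE = p + k) (hk : k ≠ 0) (θ : Fin nH → ℝ) :
    ∫ W, crossTerm 1 (e₀ p) W.1 W.2 ∂(modelLaw p nE θ) = 0 := by
  have hm : Measurable fun W : Matrix (Fin (p + 1)) (Fin (p + 1)) ℝ ×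
      Matrix (Fin (p + 1)) (Fin (p + 1)) ℝ => crossTerm 1 (e₀ p) W.1 W.2 := by fun_prop
  have h := congrArg (fun μ : Measure ℝ => ∫ y, y ∂μ) (map_neg_crossTerm hnE hk θ)
  rw [integral_map (by fun_prop) (by fun_prop), integral_map (by fun_prop) (by fun_prop),
    integral_neg] at h
  linarith

/-- The constant collects the expansion error `32 M⁵`, the cross term `4 M √ω`, the residual term
`M` and `|c|`, all weakened to order `√ω` by `1 ≤ √ω`. -/
theorem abs_largestRoot_sub_le {H E : Matrix (Fin (p + 1)) (Fin (p + 1)) ℝ}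
    {M ω : ℝ} (hM1 : 1 ≤ M) (hω : 8 * M ^ 2 ≤ √ω) (hW : (H, E) ∈ regularEvent p M ω) (c : ℝ) :
    |largestRoot (E⁻¹ * H) - (leadTerm 1 (e₀ p) H E + schurTerm 1 (e₀ p) H E + c)| ≤
      (32 * M ^ 5 + 5 * M + |c|) * √ω := by
  obtain ⟨hH, hE, hM, h1, h2⟩ := hW
  have hs1 : 1 ≤ √ω := by nlinarith
  have hω0 : 0 ≤ ω := (Real.sqrt_pos.1 (by linarith)).le
  have e1 := abs_le.1 (largestRoot_expansion_le hH hE hM1 hM hω h1)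
  have e2 := abs_le.1 (abs_crossTerm_le_sqrt hH hE hM1 hM hω0 h2)
  have e3 := residualTerm_le_of_noiseSize_le hH hE hM
  have e4 := residualTerm_nonneg (S := 1) hH (inv_quadForm_e₀_pos hE).le
  have e5 : 32 * M ^ 5 * (√ω)⁻¹ ≤ 32 * M ^ 5 * √ω := by
    gcongr
    exact (inv_le_one_of_one_le₀ hs1).trans hs1
  have e6 : M ≤ M * √ω := le_mul_of_one_le_right (by linarith) hs1
  have e7 : |c| ≤ |c| * √ω := le_mul_of_one_le_right (abs_nonneg c) hs1
  have e8 := abs_le.1 (le_refl |c|)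
  rw [abs_le]
  constructor <;> linarith [e1.1, e1.2, e2.1, e2.2, e8.1, e8.2]

end Moments

end RoyRoot

end

/-! ### Assembly of the main theorem -/

theorem proposition4
    {m nH nE ν : ℕ} (hm : 1 < m) (hnH : 1 ≤ nH) (hν : 1 < ν) (hnE : nE = m + ν)
    -- covariance matrix, and the direction of the rank one noncentrality
    (S : Matrix (Fin m) (Fin m) ℝ) (hS : S.PosDef)
    (v : Fin m → ℝ) (hv : v ⬝ᵥ (S⁻¹ *ᵥ v) = 1)
    -- for each `ω > 0`: independent `H ∼ W_m(nH, S, ω S⁻¹ v vᵀ)` and `E ∼ W_m(nE, S)`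
    {𝓧 : ℝ → Type*} [∀ ω, MeasurableSpace (𝓧 ω)]
    (P : ∀ ω, Measure (𝓧 ω)) [∀ ω, IsProbabilityMeasure (P ω)]
    (H E : ∀ ω, 𝓧 ω → Matrix (Fin m) (Fin m) ℝ)
    (hH : ∀ ω, 0 < ω → IsWishart (P ω) (H ω) nH S (ω • (S⁻¹ * vecMulVec v v)))
    (hE : ∀ ω, 0 < ω → IsWishart (P ω) (E ω) nE S 0)
    (hHE : ∀ ω, 0 < ω → IndepFun (H ω) (E ω) (P ω))
    -- the parameters
    (a₁ b₁ a₂ b₂ : ℕ) (ha₁ : a₁ = nH) (hb₁ : b₁ = ν + 1) (ha₂ : a₂ = m - 1) (hb₂ : b₂ = ν + 2)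
    (c₁ c₂ c₃ : ℝ) (hc₁ : c₁ = (a₁ : ℝ) / b₁) (hc₂ : c₂ = (a₂ : ℝ) / b₂)
    (hc₃ : c₃ = ((a₁ : ℝ) * a₂) / ((ν : ℝ) * (ν - 1)))
    -- the statistic, the two `F` variates and the two neglected terms
    (l₁ F₁ F₂ T₁ T₂ : ∀ ω, 𝓧 ω → ℝ)
    (hl₁ : ∀ ω x, l₁ ω x = largestRoot ((E ω x)⁻¹ * H ω x))
    (hF₁ : ∀ ω x, F₁ ω x = leadTerm S v (H ω x) (E ω x) / c₁)
    (hF₂ : ∀ ω x, F₂ ω x = schurTerm S v (H ω x) (E ω x) / c₂)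
    (hT₁ : ∀ ω x, T₁ ω x = crossTerm S v (H ω x) (E ω x))
    (hT₂ : ∀ ω x, T₂ ω x = residualTerm S v (H ω x) (E ω x)) :
    -- second order expansion of the largest root
    IsBigOp P
      (fun ω x => l₁ ω x - (c₁ * F₁ ω x + c₂ * F₂ ω x + T₁ ω x + T₂ ω x))
      (fun ω => (√ω)⁻¹) ∧
    -- exact law of the retained terms
    (∀ ω, 0 < ω →
      HasLaw (F₁ ω) (noncentralF a₁ b₁ ω) (P ω) ∧
      HasLaw (F₂ ω) (noncentralF a₂ b₂ 0) (P ω) ∧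
      IndepFun (F₁ ω) (F₂ ω) (P ω)) ∧
    -- the neglected term is symmetric with mean zero
    (∀ ω, 0 < ω →
      (P ω).map (fun x => -T₁ ω x) = (P ω).map (T₁ ω) ∧
      Integrable (T₁ ω) (P ω) ∧ ∫ x, T₁ ω x ∂(P ω) = 0) ∧
    -- the averaged term has mean `c₃`
    (∀ ω, 0 < ω → Integrable (T₂ ω) (P ω) ∧ ∫ x, T₂ ω x ∂(P ω) = c₃) ∧
    -- the resulting approximation: total error of smaller order than the leading term
    IsBigOp P (fun ω x => l₁ ω x - (c₁ * F₁ ω x + c₂ * F₂ ω x + c₃)) (fun ω => √ω) ∧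
    -- the resulting approximation of distribution functions, uniformly in the threshold;
    -- at this order it does not depend on the value of the additive constant
    (∀ c : ℝ, Tendsto
      (fun ω => ⨆ t : ℝ, |(P ω).real {x | l₁ ω x ≤ t} -
        (combinedFLaw a₁ b₁ a₂ b₂ c₁ c₂ c ω).real (Set.Iic t)|)
      atTop (𝓝 0)) := by
  subst a₁ b₁ a₂ b₂
  obtain ⟨p, rfl⟩ : ∃ p, m = p + 1 := ⟨m - 1, by omega⟩
  have hp : p ≠ 0 := by omega
  have hnH0 : nH ≠ 0 := by omega
  -- In the canonical model `k = ν + 1`, so `1 < ν` is exactly `3 ≤ k`, the condition for the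
  -- inverse moment.
  have hnE' : nE = p + (ν + 1) := by omega
  have hk : ν + 1 ≠ 0 := by omega
  have hk3 : 3 ≤ ν + 1 := by omega
  rw [Nat.add_sub_cancel] at hc₂ hc₃ ⊢
  have hc₁0 : c₁ ≠ 0 := by rw [hc₁]; positivity
  have hc₂0 : c₂ ≠ 0 := by rw [hc₂]; positivity
  obtain ⟨A, hA, hAv⟩ := exists_whitening_single hS hv
  have hAu := isUnit_det_of_whitening hA
  obtain ⟨Φ, hΦ⟩ : ∃ Φ : ∀ ω, 𝓧 ω → Matrix (Fin (p + 1)) (Fin (p + 1)) ℝ ×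
      Matrix (Fin (p + 1)) (Fin (p + 1)) ℝ, ∀ ω x, Φ ω x = (A * H ω x * Aᵀ, A * E ω x * Aᵀ) :=
    ⟨_, fun _ _ => rfl⟩
  have hlaw (ω) (hω : 0 < ω) : ∃ θ : Fin nH → ℝ, θ ⬝ᵥ θ = ω ∧
      HasLaw (Φ ω) (modelLaw p nE θ) (P ω) := by
    rw [funext (hΦ ω)]
    exact exists_hasLaw_modelLaw hS hA hAv (hH ω hω) (hE ω hω) (hHE ω hω)
  have el (ω x) : l₁ ω x = largestRoot ((Φ ω x).2⁻¹ * (Φ ω x).1) := by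
    rw [hΦ, hl₁, largestRoot_congr hAu]
  have eL (ω x) : F₁ ω x = leadTerm 1 (e₀ p) (Φ ω x).1 (Φ ω x).2 / c₁ := by
    rw [hΦ, hF₁, ← leadTerm_congr hAu, hA, hAv]
  have eS (ω x) : F₂ ω x = schurTerm 1 (e₀ p) (Φ ω x).1 (Φ ω x).2 / c₂ := by
    rw [hΦ, hF₂, ← schurTerm_congr hAu, hA, hAv]
  have eT (ω) : T₁ ω = fun x => crossTerm 1 (e₀ p) (Φ ω x).1 (Φ ω x).2 := by
    funext x
    rw [hΦ, hT₁, ← crossTerm_congr hAu, hA, hAv]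
  have eR (ω) : T₂ ω = fun x => residualTerm 1 (e₀ p) (Φ ω x).1 (Φ ω x).2 := by
    funext x
    rw [hΦ, hT₂, ← residualTerm_congr hAu, hA, hAv]
  have hF (ω) (hω : 0 < ω) : HasLaw (fun x => (F₁ ω x, F₂ ω x))
      ((noncentralF nH (ν + 1) ω).prod (noncentralF p (ν + 2) 0)) (P ω) := by
    obtain ⟨θ, hθ, h⟩ := hlaw ω hω
    have h2 := hasLaw_leadTerm_schurTerm hnH0 hp hnE' hk hc₁ hc₂ h
    rw [hθ] at h2
    simpa only [eL, eS] using h2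
  have hreg (η : ℝ) (hη : 0 < η) : ∃ M, 1 ≤ M ∧ ∀ᶠ ω in atTop, 8 * M ^ 2 ≤ √ω ∧
      P ω {x | Φ ω x ∉ regularEvent p M ω} ≤ ENNReal.ofReal η := by
    obtain ⟨M, hM1, hM⟩ := exists_measure_compl_regularEvent_le hnH0 hnE' hk hη
    refine ⟨M, hM1, ?_⟩
    filter_upwards [hM, Real.tendsto_sqrt_atTop.eventually_ge_atTop (8 * M ^ 2),
      eventually_gt_atTop 0] with ω h1 h2 h3
    obtain ⟨θ, hθ, h⟩ := hlaw ω h3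
    refine ⟨h2, le_trans ?_ (h1 θ hθ)⟩
    rw [← h.map_eq]
    -- Only this inequality is needed, so the regular event need not be shown measurable.
    exact Measure.le_map_apply h.aemeasurable _
  have happrox (c : ℝ) : IsBigOp P (fun ω x => l₁ ω x - (c₁ * F₁ ω x + c₂ * F₂ ω x + c))
      (fun ω => √ω) := by
    intro η hη
    obtain ⟨M, hM1, hM⟩ := hreg η hη
    refine ⟨32 * M ^ 5 + 5 * M + |c|, ?_⟩
    filter_upwards [hM] with ω h
    refine (measure_mono fun x hx hW => ?_).trans h.2
    have := abs_largestRoot_sub_le hM1 h.1 hW c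
    rw [Set.mem_ofPred_eq, el, eL, eS, mul_div_cancel₀ _ hc₁0, mul_div_cancel₀ _ hc₂0] at hx
    linarith
  refine ⟨?_, fun ω hω => hasLaw_and_indepFun_of_hasLaw_prod (hF ω hω), fun ω hω => ?_,
    fun ω hω => ?_, happrox c₃, fun c => ?_⟩
  · intro η hη
    obtain ⟨M, hM1, hM⟩ := hreg η hη
    refine ⟨32 * M ^ 5, ?_⟩
    filter_upwards [hM] with ω h
    refine (measure_mono fun x hx hW => ?_).trans h.2
    have := largestRoot_expansion_le hW.1 hW.2.1 hM1 hW.2.2.1 h.1 hW.2.2.2.1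
    rw [Set.mem_ofPred_eq, el, eL, eS, eT, eR, mul_div_cancel₀ _ hc₁0,
      mul_div_cancel₀ _ hc₂0] at hx
    linarith
  · obtain ⟨θ, hθ, h⟩ := hlaw ω hω
    have hm : Measurable fun W : Matrix (Fin (p + 1)) (Fin (p + 1)) ℝ ×
        Matrix (Fin (p + 1)) (Fin (p + 1)) ℝ => crossTerm 1 (e₀ p) W.1 W.2 := by fun_prop
    have hlawT := hasLaw_comp_of_map_eq h hm rfl
    have hlawN := hasLaw_comp_of_map_eq h hm.neg (map_neg_crossTerm hnE' hk θ)
    refine ⟨?_, ?_, ?_⟩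
    · rw [eT]
      exact hlawN.map_eq.trans hlawT.map_eq.symm
    · rw [eT]
      exact integrable_comp_of_hasLaw h (integrable_crossTerm hnE' hk3 θ)
    · rw [eT, ← integral_crossTerm hnE' hk θ]
      exact h.integral_comp hm.aestronglyMeasurable
  · obtain ⟨θ, hθ, h⟩ := hlaw ω hω
    have hm : Measurable fun W : Matrix (Fin (p + 1)) (Fin (p + 1)) ℝ ×
        Matrix (Fin (p + 1)) (Fin (p + 1)) ℝ => residualTerm 1 (e₀ p) W.1 W.2 := by fun_prop
    obtain ⟨hint, hval⟩ := integrable_residualTerm hnE' hk3 θ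
    constructor
    · rw [eR]
      exact integrable_comp_of_hasLaw h hint
    · have hcast : (((ν + 1 : ℕ) : ℝ) - 1) * (((ν + 1 : ℕ) : ℝ) - 2) = (ν : ℝ) * (ν - 1) := by
        push_cast
        ring
      rw [eR, hc₃, ← hcast, ← hval]
      exact h.integral_comp hm.aestronglyMeasurable
  · rw [Metric.tendsto_nhds]
    intro ε hε
    -- With `η = ε / 4` the comparison of distribution functions gives `2 η = ε / 2`, which stays
    -- strictly below `ε` after the supremum.
    obtain ⟨K, hK⟩ := happrox c (ε / 4) (by positivity)
    filter_upwards [hK, eventually_gt_atTop 0,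
      eventually_combinedFLaw_concentration_le (a₂ := p) (b₂ := ν + 2) hnH0 hk hc₁ c₂ c
        K (η := ε / 4) (by positivity)] with ω h1 hω h2
    have hY : HasLaw (fun x => c₁ * F₁ ω x + c₂ * F₂ ω x + c)
        (combinedFLaw nH (ν + 1) p (ν + 2) c₁ c₂ c ω) (P ω) :=
      hasLaw_comp_of_map_eq (Y := fun q : ℝ × ℝ => c₁ * q.1 + c₂ * q.2 + c) (hF ω hω) (by fun_prop) rfl
    have : IsProbabilityMeasure (combinedFLaw nH (ν + 1) p (ν + 2) c₁ c₂ c ω) :=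
      hY.isProbabilityMeasure_iff.1 inferInstance
    rw [Real.dist_0_eq_abs, abs_of_nonneg (Real.iSup_nonneg fun t => abs_nonneg _)]
    refine lt_of_le_of_lt (ciSup_le fun t =>
      abs_sub_measureReal_Iic_le hY (by positivity) h1 t (h2 t)) ?_
    linarith
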